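/- A rank-2 Frobenius system $\mathcal F=(R,A,\Delta,\varepsilon)$ consists of a commutative ring $R$ and a commutative, cocommutative Frobenius algebra $A$ over $R$ (multiplication $m$, comultiplication $\Delta$, counit $\varepsilon$, with $\Delta\circ m=(\mathrm{id}\otimes m)\circ(\Delta\otimes\mathrm{id})$) that is free as an $R$-module on $1$ and some $X\in A$. $R$ is graded or filtered, $1$ and $X$ have degrees $0$ and $-2$, and $m,\Delta,\varepsilon$ have degrees $0,-2,2$. For an oriented 2-ended tangle diagram $D$ in a disk, $C_{\mathcal F}(D)$ denotes the complex of $A$-modules obtained from the cube of resolutions of $D$: a state $v$ with $|v|$ one-smoothings contributes the tensor product over $R$ of one copy of $A\{1\}$ for the strand joining the end points and one for each circle, in homological degree $|v|-n_-$ and with quantum shift $\{|v|+n_+-2n_-\}$; the differential is the signed sum of $m$ (for merging saddles) and $\Delta$ (for splitting saddles), and $A$ acts on the factor of the strand. Here $n_\pm$ are the numbers of positive and negative crossings and $M\{k\}_j=M_{j-k}$. Let $\mathcal F_{\mathbb Z[G]}$ be the system with $R=\mathbb Z[G]$, $A_{\mathbb Z[G]}=\mathbb Z[G][X]/(X^2+GX)$,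 $\varepsilon(1)=0$, $\varepsilon(X)=1$, $\Delta(1)=1\otimes X+X\otimes 1+G\,1\otimes 1$, $\Delta(X)=X\otimes X$, $\deg G=-2$, and put $$\llbracket D\rrbracket = C_{\mathcal F_{\mathbb Z[G]}}(D)\otimes_{A_{\mathbb Z[G]}}A_{\mathbb Z[G]}/(X)\{-1\},$$ a complex of $\mathbb Z[G]$-modules. Let $\mathcal F_{\mathrm{univ}}$ be the system with $R_{\mathrm{univ}}=\mathbb Z[h,t]$, $A_{\mathrm{univ}}=\mathbb Z[h,t][X]/(X^2-hX-t)$, $\varepsilon(1)=0$, $\varepsilon(X)=1$, $\Delta(1)=1\otimes X+X\otimes1-h\,1\otimes 1$, $\Delta(X)=X\otimes X+t\,1\otimes1$, $\deg h=-2$, $\deg t=-4$, and write $C_{\mathrm{univ}}$ for $C_{\mathcal F_{\mathrm{univ}}}$. **Theorem.** Let $D$ be an oriented 2-ended tangle diagram. 1. For every rank-2 Frobenius system $\mathcal F=(R,A,\Delta,\varepsilon)$, regard $A$ as a $\mathbb Z[G]$-module by letting $G$ act as $m\circ\Delta\colon A\to A$ (the value of $\mathcal F$ on the genus-one curtain).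 Then there is an isomorphism of complexes of $A$-modules, preserving the quantum grading (or filtration), $$C_{\mathcal F}(D)\;\cong\;\llbracket D\rrbracket\otimes_{\mathbb Z[G]}A\{1\}.$$ 2. For $\mathcal F=\mathcal F_{\mathrm{univ}}$ the element $G$ acts on $A_{\mathrm{univ}}$ as multiplication by $2X-h$. 3. Conversely, there is an isomorphism of complexes of $\mathbb Z[G]$-modules, preserving the quantum grading, $$\llbracket D\rrbracket\;\cong\;C_{\mathrm{univ}}(D)\otimes_{A_{\mathrm{univ}}}\mathbb Z[G]\{-1\},$$ where $\mathbb Z[G]$ is an $A_{\mathrm{univ}}$-module on which $X$ and $t$ act as $0$ and $h$ acts as $-G$. -/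

import Mathlib

open scoped TensorProduct

namespace Khovanov

/-! ### Two-ended tangle diagrams -/

/-- The ends of arcs of a diagram with `n` crossings: the end `(c, i)` is the `i`-th of the four
edge-ends at the crossing `c`, and `Sum.inr false`, `Sum.inr true` are the two end points
`x`, `y` of the tangle. -/
abbrev Dart (n : ℕ) : Type := (Fin n × Fin 4) ⊕ Bool

/-- The rotation system: counterclockwise successor at a crossing. The boundary circle of the disk
is regarded as one further vertex, of degree two, at which the two end points are exchanged. -/
def rot (n : ℕ) : Equiv.Perm (Dart n) where
  toFun := Sum.map (fun p => (p.1, p.2 + 1)) not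
  invFun := Sum.map (fun p => (p.1, p.2 - 1)) not
  left_inv := by rintro (⟨c, i⟩ | b) <;> simp
  right_inv := by rintro (⟨c, i⟩ | b) <;> simp

/-- Ends at a crossing are numbered counterclockwise starting from the incoming end of the
under-strand, so the under-strand runs from end `0` to end `2`. At a positive crossing the
over-strand runs from end `3` to end `1`, at a negative one from end `1` to end `3`.
`isOut` says which ends are directed away from their vertex; the tangle's arc starts at `x` and
ends at `y`. -/
def isOut {n : ℕ} (pos : Fin n → Bool) : Dart n → Bool
  | Sum.inl (c, i) => if pos c then i == 1 || i == 2 else i == 2 || i == 3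
  | Sum.inr b => !b

/-- The equivalence relation generated by `d ∼ f d` and `d ∼ g d`. -/
def orbits {X : Type*} (f g : Equiv.Perm X) : Setoid X :=
  Relation.EqvGen.setoid fun d e => e = f d ∨ e = g d

/-- An oriented two-ended tangle diagram in a disk, given by its planar combinatorial map
(an oriented planar diagram code).  `arc` exchanges the two ends of each edge of the diagram, and
`loops` is the number of components without crossings other than the arc of the tangle.
`planar` is Euler's formula `V - E + F = 2 κ` (`κ` the number of connected components) for the map
on the sphere that arises by collapsing the boundary of the disk to a vertex: there are `n + 1`
vertices and `2 n + 1` edges, and the faces are the cycles of the permutation `rot * arc`. -/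
structure TangleDiagram where
  /-- number of crossings -/
  n : ℕ
  /-- whether a crossing is positive -/
  pos : Fin n → Bool
  /-- number of crossingless closed components -/
  loops : ℕ
  /-- the involution that exchanges the two ends of each edge -/
  arc : Equiv.Perm (Dart n)
  arc_arc : ∀ d, arc (arc d) = d
  isOut_arc : ∀ d, isOut pos (arc d) = !isOut pos d
  planar : (n + 1) + Nat.card (Quotient (Equiv.Perm.SameCycle.setoid (rot n * arc))) =
    (2 * n + 1) + 2 * Nat.card (Quotient (orbits (rot n) arc))

/-- A state is the set of crossings which are given the `1`-smoothing. The `0`-smoothing of a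
crossing joins the ends `0, 1` and the ends `2, 3`; the `1`-smoothing joins `1, 2` and `3, 0`.
(The two end points are exchanged as well; they lie on the same strand in any case.) -/
def smoothing {n : ℕ} (v : Finset (Fin n)) : Equiv.Perm (Dart n) :=
  Function.Involutive.toPerm
    (Sum.map (fun p => (p.1, if p.1 ∈ v then ![3, 2, 1, 0] p.2 else ![1, 0, 3, 2] p.2)) not) (by
      rintro (⟨c, i⟩ | b)
      · by_cases h : c ∈ v <;> fin_cases i <;> simp [h]
      · simp)

namespace TangleDiagram

variable (D : TangleDiagram)

/-- number of positive crossings -/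
def nPos : ℕ := (Finset.univ.filter fun c => D.pos c = true).card

/-- number of negative crossings -/
def nNeg : ℕ := (Finset.univ.filter fun c => D.pos c = false).card

/-- Two ends are related if they lie on the same component of the smoothed diagram. -/
def conn (v : Finset (Fin D.n)) : Setoid (Dart D.n) := orbits D.arc (smoothing v)

/-- The components of the smoothed diagram: the special strand and the circles. -/
abbrev Comp (v : Finset (Fin D.n)) : Type := Quotient (D.conn v) ⊕ Fin D.loops

noncomputable instance (v : Finset (Fin D.n)) : Fintype (D.Comp v) := Fintype.ofFinite _

/-- The component that contains a given end. -/
def comp (v : Finset (Fin D.n)) (d : Dart D.n) : D.Comp v := Sum.inl (Quotient.mk (D.conn v) d)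

/-- The special strand, which joins the two end points of the tangle. -/
def strand (v : Finset (Fin D.n)) : D.Comp v := D.comp v (Sum.inr false)

/-- The `i`-th end at the crossing `c`. -/
abbrev corner (c : Fin D.n) (i : Fin 4) : Dart D.n := Sum.inl (c, i)

/-- The change of the smoothing of `c` from `0` to `1` splits a component of the state `v`
(otherwise it merges two components). -/
def Splits (v : Finset (Fin D.n)) (c : Fin D.n) : Prop :=
  D.comp v (D.corner c 0) = D.comp v (D.corner c 2)

/-- The component of the state `w` that contains (a chosen point of) a component of `v`. -/
noncomputable def transport (v w : Finset (Fin D.n)) : D.Comp v → D.Comp w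
  | Sum.inl q => D.comp w q.out
  | Sum.inr l => Sum.inr l

/-! ### Planarity implies that a change of smoothing merges or splits -/

section planarity

/-- Two elements of a cycle are separated by composing with their transposition. -/
theorem sameCycle_swap {X : Type*} [Finite X] [DecidableEq X] (P : Equiv.Perm X) {x y : X}
    (hxy : x ≠ y) : P.SameCycle x y ↔ ¬ (P * Equiv.swap x y).SameCycle x y := by
  have key : ∀ m : ℕ, (∀ j, 0 < j → j < m → (P ^ j) x ≠ x ∧ (P ^ j) x ≠ y) →
      ∀ j, 0 < j → j ≤ m → ((P * Equiv.swap x y) ^ j) y = (P ^ j) x := by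
    intro m hm j hj hjm
    induction j with
    | zero => omega
    | succ j ih =>
      rcases Nat.eq_zero_or_pos j with rfl | hj0
      · simp
      · rw [pow_succ', Equiv.Perm.mul_apply, ih hj0 (by omega), pow_succ', Equiv.Perm.mul_apply,
          Equiv.Perm.mul_apply, Equiv.swap_apply_of_ne_of_ne (hm j hj0 (by omega)).1
            (hm j hj0 (by omega)).2]
  constructor
  · intro h hQ
    classical
    have hex : ∃ k : ℕ, (P ^ k) x = y := h.exists_nat_pow_eq
    have hk := Nat.find_spec hex
    have hkmin := fun j => Nat.find_min (m := j) hex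
    set k := Nat.find hex with hkdef
    have hk0 : 0 < k := by
      rcases Nat.eq_zero_or_pos k with h0 | h0
      · rw [h0] at hk; exact absurd (by simpa using hk) hxy
      · exact h0
    have hne : ∀ j, 0 < j → j < k → (P ^ j) x ≠ x ∧ (P ^ j) x ≠ y := by
      intro j hj hjk
      refine ⟨fun hx => ?_, hkmin j hjk⟩
      refine hkmin (k - j) (by omega) ?_
      have : (P ^ ((k - j) + j)) x = y := by rw [Nat.sub_add_cancel hjk.le]; exact hk
      rwa [pow_add, Equiv.Perm.mul_apply, hx] at this
    have hcyc : ((P * Equiv.swap x y) ^ k) y = y := by rw [key k hne k hk0 le_rfl, hk]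
    obtain ⟨m, hm⟩ := hQ.symm.exists_nat_pow_eq
    have hred : ((P * Equiv.swap x y) ^ (m % k)) y = x := by
      rw [← Nat.mod_add_div m k, pow_add, pow_mul, Equiv.Perm.mul_apply] at hm
      have hfix : ∀ t : ℕ, (((P * Equiv.swap x y) ^ k) ^ t) y = y := by
        intro t
        induction t with
        | zero => simp
        | succ t ih => rw [pow_succ, Equiv.Perm.mul_apply, hcyc, ih]
      rwa [hfix] at hm
    have hlt := Nat.mod_lt m hk0
    rcases Nat.eq_zero_or_pos (m % k) with h0 | h0
    · rw [h0] at hred; exact hxy (by simpa using hred.symm)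
    · rw [key k hne _ h0 hlt.le] at hred
      exact (hne _ h0 hlt).1 hred
  · intro hQ
    by_contra h
    apply hQ
    have hex : ∃ m : ℕ, 0 < m ∧ (P ^ m) x = x :=
      ⟨orderOf P, orderOf_pos P, by rw [pow_orderOf_eq_one]; rfl⟩
    classical
    obtain ⟨hm0, hm⟩ := Nat.find_spec hex
    have hmin := fun j => Nat.find_min (m := j) hex
    set m := Nat.find hex
    have hne : ∀ j, 0 < j → j < m → (P ^ j) x ≠ x ∧ (P ^ j) x ≠ y := by
      intro j hj hjm
      exact ⟨fun hx => hmin j hjm ⟨hj, hx⟩, fun hy => h ⟨j, by simpa using hy⟩⟩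
    refine Equiv.Perm.SameCycle.symm ⟨m, ?_⟩
    rw [zpow_natCast, key m hne m hm0 le_rfl, hm]

/-- On a planar map, every `ZMod 2`-cycle of edges separates the faces into two classes. -/
theorem exists_face_coloring (z : Dart D.n → ZMod 2) (hz : ∀ d, z (D.arc d) = z d)
    (hv : ∀ g : Dart D.n → ZMod 2, (∀ d, g (rot D.n d) = g d) → ∑ d, z d * g d = 0) :
    ∃ f : Dart D.n → ZMod 2, (∀ d, f (rot D.n (D.arc d)) = f d) ∧
      ∀ d, f d + f (D.arc d) = z d := by
  classical
  let Out := {d : Dart D.n // isOut D.pos d = true}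
  let sV := Equiv.Perm.SameCycle.setoid (rot D.n)
  let sF := Equiv.Perm.SameCycle.setoid (rot D.n * D.arc)
  let sK := orbits (rot D.n) D.arc
  let del : ∀ s : Setoid (Dart D.n), (Quotient s → ZMod 2) →ₗ[ZMod 2] (Out → ZMod 2) := fun s =>
    { toFun := fun g d => g (Quotient.mk s d.1) + g (Quotient.mk s (D.arc d.1))
      map_add' := by intro a b; ext d; simp only [Pi.add_apply]; ring
      map_smul' := by intro a b; ext d; simp only [Pi.smul_apply, smul_eq_mul, RingHom.id_apply]; ring }
  have hdel : ∀ s g d, del s g d = g (Quotient.mk s d.1) + g (Quotient.mk s (D.arc d.1)) :=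
    fun s g d => rfl
  -- sums over all ends are sums over outgoing ends
  have hsum : ∀ u : Dart D.n → ZMod 2, ∑ d, u d = ∑ d : Out, (u d.1 + u (D.arc d.1)) := by
    intro u
    have h1 : ∑ d : Out, u (D.arc d.1) = ∑ d : {d // ¬ isOut D.pos d = true}, u d.1 := by
      refine Fintype.sum_equiv (D.arc.subtypeEquiv fun d => ?_) _ _ (fun d => rfl)
      rw [D.isOut_arc]; simp
    rw [Finset.sum_add_distrib, h1]
    exact (Fintype.sum_subtype_add_sum_subtype (fun d => isOut D.pos d = true) u).symm
  have hE : Fintype.card Out = 2 * D.n + 1 := by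
    have h1 : Fintype.card Out = Fintype.card {d // ¬ isOut D.pos d = true} := by
      refine Fintype.card_congr (D.arc.subtypeEquiv fun d => ?_)
      rw [D.isOut_arc]; simp
    have h2 := Fintype.card_subtype_compl (fun d => isOut D.pos d = true)
    have h3 : Fintype.card (Dart D.n) = 4 * D.n + 2 := by simp [Dart]; ring
    have h4 : Fintype.card Out ≤ Fintype.card (Dart D.n) := Fintype.card_subtype_le _
    change Fintype.card Out = _ at h1
    have h5 : Fintype.card {d // ¬ isOut D.pos d = true} = Fintype.card (Dart D.n) - Fintype.card Out := h2
    omega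
  -- kernels
  have hker : ∀ (s : Setoid (Dart D.n)) (W : Submodule (ZMod 2) (Quotient s → ZMod 2)),
      (∀ g ∈ W, ∀ d, g (Quotient.mk s (rot D.n d)) = g (Quotient.mk s d) ∧
        g (Quotient.mk s (D.arc d)) = g (Quotient.mk s d)) →
      Module.finrank (ZMod 2) W ≤ Nat.card (Quotient sK) := by
    intro s W hW
    let j : W →ₗ[ZMod 2] (Quotient sK → ZMod 2) :=
      { toFun := fun g q => g.1 (Quotient.mk s q.out)
        map_add' := fun a b => rfl
        map_smul' := fun a b => rfl }
    have hj : Function.Injective j := by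
      rw [← LinearMap.ker_eq_bot, LinearMap.ker_eq_bot']
      intro g hg
      ext q
      induction q using Quotient.inductionOn with
      | h d =>
        have hconst : ∀ a b, Relation.EqvGen (fun d e => e = rot D.n d ∨ e = D.arc d) a b →
            g.1 (Quotient.mk s a) = g.1 (Quotient.mk s b) := by
          intro a b hab
          induction hab with
          | rel a b h =>
            rcases h with rfl | rfl
            · exact ((hW g.1 g.2 a).1).symm
            · exact ((hW g.1 g.2 a).2).symm
          | refl => rfl
          | symm _ _ _ ih => exact ih.symm
          | trans _ _ _ _ _ ih1 ih2 => exact ih1.trans ih2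
        have h1 : g.1 (Quotient.mk s (Quotient.mk sK d).out) = 0 := congrFun hg (Quotient.mk sK d)
        rw [← hconst _ _ (Quotient.exact (Quotient.out_eq (Quotient.mk sK d))), h1]; rfl
    have := LinearMap.finrank_le_finrank_of_injective hj
    rwa [Module.finrank_fintype_fun_eq_card, ← Nat.card_eq_fintype_card] at this
  have two : ∀ a b : ZMod 2, a + b = 0 → b = a := by decide
  have hkerarc : ∀ s g, g ∈ LinearMap.ker (del s) → ∀ d,
      g (Quotient.mk s (D.arc d)) = g (Quotient.mk s d) := by
    intro s g hg d
    have hg' : ∀ d : Out, g (Quotient.mk s d.1) + g (Quotient.mk s (D.arc d.1)) = 0 :=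
      fun d => congrFun hg d
    by_cases hd : isOut D.pos d = true
    · exact two _ _ (hg' ⟨d, hd⟩)
    · have := hg' ⟨D.arc d, by rw [D.isOut_arc]; simpa using hd⟩
      simp only [D.arc_arc] at this
      exact (two _ _ this).symm
  have hV : Module.finrank (ZMod 2) (LinearMap.ker (del sV)) ≤ Nat.card (Quotient sK) := by
    refine hker sV _ fun g hg d => ⟨?_, hkerarc _ _ hg d⟩
    congr 1
    exact Quotient.sound (Equiv.Perm.SameCycle.symm ⟨1, rfl⟩)
  have hFface : ∀ (g : Quotient sF → ZMod 2) d,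
      g (Quotient.mk sF (rot D.n (D.arc d))) = g (Quotient.mk sF d) := by
    intro g d
    congr 1
    exact Quotient.sound (Equiv.Perm.SameCycle.symm ⟨1, rfl⟩)
  have hF : Module.finrank (ZMod 2) (LinearMap.ker (del sF)) ≤ Nat.card (Quotient sK) := by
    refine hker sF _ fun g hg d => ⟨?_, hkerarc _ _ hg d⟩
    have h1 := hFface g (D.arc d)
    rw [D.arc_arc] at h1
    rw [h1, hkerarc _ _ hg]
  -- number of vertices
  have hVcard : D.n + 1 ≤ Fintype.card (Quotient sV) := by
    let vert : Dart D.n → Option (Fin D.n) := Sum.elim (fun p => some p.1) (fun _ => none)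
    have hvert : ∀ d, vert (rot D.n d) = vert d := by rintro (⟨c, i⟩ | b) <;> rfl
    have hvs : ∀ a b, sV a b → vert a = vert b := by
      rintro a b h
      obtain ⟨k, rfl⟩ := Equiv.Perm.SameCycle.exists_nat_pow_eq h
      induction k with
      | zero => rfl
      | succ k ih => rw [pow_succ', Equiv.Perm.mul_apply, hvert]; exact ih ⟨k, by simp⟩
    have : Function.Surjective (Quotient.lift vert hvs) := by
      rintro (_ | c)
      · exact ⟨Quotient.mk sV (Sum.inr true), rfl⟩
      · exact ⟨Quotient.mk sV (Sum.inl (c, 0)), rfl⟩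
    simpa using Fintype.card_le_of_surjective _ this
  -- the cycle space
  let L : (Out → ZMod 2) →ₗ[ZMod 2] Module.Dual (ZMod 2) (Quotient sV → ZMod 2) :=
    (del sV).dualMap ∘ₗ (dotProductEquiv (ZMod 2) Out).toLinearMap
  have hL : ∀ w g, L w g = ∑ d : Out, w d * (del sV g d) := fun w g => rfl
  have hLrank : Module.finrank (ZMod 2) (LinearMap.range L) =
      Module.finrank (ZMod 2) (LinearMap.range (del sV)) := by
    rw [← LinearMap.finrank_range_dualMap_eq_finrank_range (del sV)]
    change Module.finrank (ZMod 2) (LinearMap.range (_ ∘ₗ _)) = _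
    rw [LinearMap.range_comp_of_range_eq_top _ (LinearEquiv.range _)]
  have hle : LinearMap.range (del sF) ≤ LinearMap.ker L := by
    rintro _ ⟨f, rfl⟩
    rw [LinearMap.mem_ker]
    refine LinearMap.ext fun g => ?_
    rw [hL]
    let f' : Dart D.n → ZMod 2 := fun d => f (Quotient.mk sF d)
    let g' : Dart D.n → ZMod 2 := fun d => g (Quotient.mk sV d)
    have hg' : ∀ d, g' (rot D.n d) = g' d := by
      intro d
      change g _ = g _
      congr 1
      exact Quotient.sound (Equiv.Perm.SameCycle.symm ⟨1, rfl⟩)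
    have hf' : ∀ d, f' (D.arc d) = f' (rot D.n d) := by
      intro d
      have h1 := hFface f (D.arc d)
      rw [D.arc_arc] at h1
      exact h1.symm
    have e1 : ∑ d : Out, (del sF f d) * (del sV g d) =
        ∑ d, f' d * g' d + ∑ d, f' (D.arc d) * g' d := by
      rw [hsum, hsum (fun d => f' (D.arc d) * g' d), ← Finset.sum_add_distrib]
      refine Finset.sum_congr rfl fun d _ => ?_
      rw [hdel, hdel]
      simp only [D.arc_arc]
      change (f' d.1 + f' (D.arc d.1)) * (g' d.1 + g' (D.arc d.1)) = _
      ring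
    have e2 : ∑ d, f' (D.arc d) * g' d = ∑ d, f' d * g' d := by
      rw [← Equiv.sum_comp (rot D.n) (fun d => f' d * g' d)]
      exact Finset.sum_congr rfl fun d _ => by rw [hf', hg']
    rw [e1, e2]
    exact CharTwo.add_self_eq_zero _
  have heq : LinearMap.range (del sF) = LinearMap.ker L := by
    apply Submodule.eq_of_le_of_finrank_le hle
    have r1 := LinearMap.finrank_range_add_finrank_ker L
    have r2 := LinearMap.finrank_range_add_finrank_ker (del sV)
    have r3 := LinearMap.finrank_range_add_finrank_ker (del sF)
    rw [Module.finrank_fintype_fun_eq_card] at r1 r2 r3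
    have pl := D.planar
    change _ + Nat.card (Quotient sF) = _ + 2 * Nat.card (Quotient sK) at pl
    rw [Nat.card_eq_fintype_card (α := Quotient sF)] at pl
    omega
  have hzL : (fun d : Out => z d.1) ∈ LinearMap.ker L := by
    rw [LinearMap.mem_ker]
    refine LinearMap.ext fun g => ?_
    rw [hL]
    have h1 := hv (fun d => g (Quotient.mk sV d)) (fun d => by
      congr 1
      exact Quotient.sound (Equiv.Perm.SameCycle.symm ⟨1, rfl⟩))
    rw [hsum] at h1
    rw [LinearMap.zero_apply, ← h1]
    refine Finset.sum_congr rfl fun d _ => ?_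
    rw [hdel, hz]; ring
  rw [← heq] at hzL
  obtain ⟨f, hf⟩ := hzL
  refine ⟨fun d => f (Quotient.mk sF d), hFface f, fun d => ?_⟩
  by_cases hd : isOut D.pos d = true
  · exact congrFun hf ⟨d, hd⟩
  · have := congrFun hf ⟨D.arc d, by rw [D.isOut_arc]; simpa using hd⟩
    rw [hdel] at this
    simp only [D.arc_arc, hz] at this
    rw [add_comm]; exact this

/-- A source-sink orientation: it alternates around every vertex and along every edge. -/
theorem exists_checkerboard : ∃ o : Dart D.n → ZMod 2,
    (∀ d, o (rot D.n d) = o d + 1) ∧ ∀ d, o (D.arc d) = o d + 1 := by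
  have e : ∀ a b : ZMod 2, a + b = 1 → b = a + 1 := by decide
  have e2 : ∀ a : ZMod 2, a + 1 + 1 = a := by decide
  obtain ⟨f, h1, h2⟩ := D.exists_face_coloring (fun _ => 1) (fun _ => rfl) (by
    intro g hg
    have hc : ∀ c, g (Sum.inl (c, 1)) = g (Sum.inl (c, 0)) ∧ g (Sum.inl (c, 2)) = g (Sum.inl (c, 0))
        ∧ g (Sum.inl (c, 3)) = g (Sum.inl (c, 0)) := by
      intro c
      have a1 := hg (Sum.inl (c, 0))
      have a2 := hg (Sum.inl (c, 1))
      have a3 := hg (Sum.inl (c, 2))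
      change g (Sum.inl (c, 1)) = _ at a1
      change g (Sum.inl (c, 2)) = _ at a2
      change g (Sum.inl (c, 3)) = _ at a3
      exact ⟨a1, a2.trans a1, a3.trans (a2.trans a1)⟩
    have hb := hg (Sum.inr false)
    change g (Sum.inr true) = _ at hb
    have k2 : ∀ a : ZMod 2, a + a = 0 := by decide
    simp only [one_mul, Fintype.sum_sum_type, Fintype.sum_prod_type, Fin.sum_univ_four,
      Fintype.sum_bool, hb, k2, hc, zero_add, Finset.sum_const_zero])
  refine ⟨f, fun d => ?_, fun d => e _ _ (h2 d)⟩
  have := h1 (D.arc d)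
  rw [D.arc_arc] at this
  rw [this, e _ _ (h2 d)]


theorem comp_eq {v : Finset (Fin D.n)} {d e : Dart D.n} :
    D.comp v d = D.comp v e ↔ D.conn v d e := by
  rw [comp, comp, Sum.inl.injEq, Quotient.eq]

theorem conn_arc (v : Finset (Fin D.n)) (d : Dart D.n) : D.conn v d (D.arc d) :=
  Relation.EqvGen.rel _ _ (Or.inl rfl)

theorem conn_smoothing (v : Finset (Fin D.n)) (d : Dart D.n) : D.conn v d (smoothing v d) :=
  Relation.EqvGen.rel _ _ (Or.inr rfl)

theorem smoothing_smoothing {n : ℕ} (v : Finset (Fin n)) (d : Dart n) :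
    smoothing v (smoothing v d) = d :=
  Function.Involutive.toPerm_involutive _ d

theorem smoothing_corner {n : ℕ} (v : Finset (Fin n)) (c : Fin n) (i : Fin 4) :
    smoothing v (Sum.inl (c, i)) =
      Sum.inl (c, if c ∈ v then ![3, 2, 1, 0] i else ![1, 0, 3, 2] i) := rfl

theorem smoothing_parity {o : Dart D.n → ZMod 2} (ho : ∀ d, o (rot D.n d) = o d + 1)
    (v : Finset (Fin D.n)) (d : Dart D.n) : o (smoothing v d) = o d + 1 := by
  have two : ∀ a : ZMod 2, a + 1 + 1 = a := by decide
  rcases d with ⟨c, i⟩ | b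
  · have h1 := ho (D.corner c 0)
    have h2 := ho (D.corner c 1)
    have h3 := ho (D.corner c 2)
    change o (D.corner c 1) = _ at h1
    change o (D.corner c 2) = _ at h2
    change o (D.corner c 3) = _ at h3
    rw [h1, two] at h2
    rw [h2] at h3
    rw [smoothing_corner]
    by_cases hc : c ∈ v
    · rw [if_pos hc]; fin_cases i <;> simp [h1, h2, h3, two]
    · rw [if_neg hc]; fin_cases i <;> simp [h1, h2, h3, two]
  · exact ho (Sum.inr b)

theorem corner_parity {o : Dart D.n → ZMod 2} (ho : ∀ d, o (rot D.n d) = o d + 1)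
    (c : Fin D.n) : o (D.corner c 2) = o (D.corner c 0) := by
  have two : ∀ a : ZMod 2, a + 1 + 1 = a := by decide
  have h1 := ho (D.corner c 0)
  have h2 := ho (D.corner c 1)
  change o (D.corner c 1) = _ at h1
  change o (D.corner c 2) = _ at h2
  rw [h2, h1, two]

theorem conn_iff_sameCycle {v : Finset (Fin D.n)} {o : Dart D.n → ZMod 2}
    (ho : ∀ d, o (rot D.n d) = o d + 1) (ho' : ∀ d, o (D.arc d) = o d + 1) (c : Fin D.n) :
    D.conn v (D.corner c 0) (D.corner c 2) ↔
      (D.arc * smoothing v).SameCycle (D.corner c 0) (D.corner c 2) := by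
  have two : ∀ a b : ZMod 2, a ≠ b → a + 1 = b := by decide
  have two' : ∀ a : ZMod 2, a + 1 ≠ a := by decide
  have hs : ∀ d, o (smoothing v d) = o d + 1 := D.smoothing_parity ho v
  let f : Dart D.n → Dart D.n := fun d => if o d = o (D.corner c 0) then d else smoothing v d
  have hf1 : ∀ d, o d = o (D.corner c 0) → f d = d := fun d h => if_pos h
  have hf2 : ∀ d, o d ≠ o (D.corner c 0) → f d = smoothing v d := fun d h => if_neg h
  have key : ∀ d e, D.conn v d e → (D.arc * smoothing v).SameCycle (f d) (f e) := by
    intro d e h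
    induction h with
    | rel d e h =>
      rcases h with rfl | rfl
      · by_cases hd : o d = o (D.corner c 0)
        · rw [hf1 d hd, hf2 _ (by rw [ho', ← hd]; exact two' _)]
          refine Equiv.Perm.SameCycle.symm ⟨1, ?_⟩
          rw [zpow_one, Equiv.Perm.mul_apply, smoothing_smoothing, D.arc_arc]
        · rw [hf2 d hd, hf1 _ (by rw [ho']; exact two _ _ hd)]
          refine ⟨1, ?_⟩
          rw [zpow_one, Equiv.Perm.mul_apply, smoothing_smoothing]
      · by_cases hd : o d = o (D.corner c 0)
        · rw [hf1 d hd, hf2 _ (by rw [hs, ← hd]; exact two' _), smoothing_smoothing]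
        · rw [hf2 d hd, hf1 _ (by rw [hs]; exact two _ _ hd)]
    | refl => exact Equiv.Perm.SameCycle.refl _ _
    | symm _ _ _ ih => exact ih.symm
    | trans _ _ _ _ _ ih1 ih2 => exact ih1.trans ih2
  constructor
  · intro h
    have h1 := key _ _ h
    rwa [hf1 _ rfl, hf1 _ (D.corner_parity ho c)] at h1
  · intro h
    obtain ⟨k, hk⟩ := h.exists_nat_pow_eq
    have : ∀ k : ℕ, D.conn v (D.corner c 0) (((D.arc * smoothing v) ^ k) (D.corner c 0)) := by
      intro k
      induction k with
      | zero => exact (D.conn v).refl _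
      | succ k ih =>
        rw [pow_succ', Equiv.Perm.mul_apply]
        exact (D.conn v).trans ih ((D.conn v).trans (D.conn_smoothing v _) (D.conn_arc v _))
    rw [← hk]; exact this k

theorem splits_iff {v : Finset (Fin D.n)} {c : Fin D.n} (hc : c ∉ v) :
    D.Splits v c ↔ D.comp (insert c v) (D.corner c 0) ≠ D.comp (insert c v) (D.corner c 2) := by
  obtain ⟨o, ho, ho'⟩ := D.exists_checkerboard
  rw [Splits, comp_eq, Ne, comp_eq, D.conn_iff_sameCycle ho ho', D.conn_iff_sameCycle ho ho',
    sameCycle_swap _ (by simp)]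
  have hs := D.smoothing_parity ho
  have two : ∀ a : ZMod 2, a + 1 + 1 = a := by decide
  have two1 : ∀ a : ZMod 2, a ≠ a + 1 := by decide
  have hpow : ∀ k : ℕ, o (((D.arc * smoothing (insert c v)) ^ k) (D.corner c 0)) =
      o (D.corner c 0) ∧ ((D.arc * smoothing (insert c v)) ^ k) (D.corner c 0) =
        ((D.arc * smoothing v * Equiv.swap (D.corner c 0) (D.corner c 2)) ^ k) (D.corner c 0) := by
    intro k
    induction k with
    | zero => simp
    | succ k ih =>
      rw [pow_succ', pow_succ', Equiv.Perm.mul_apply, Equiv.Perm.mul_apply (_ * _ * _), ← ih.2]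
      generalize ((D.arc * smoothing (insert c v)) ^ k) (D.corner c 0) = d at ih
      refine ⟨by rw [Equiv.Perm.mul_apply, ho', hs, two, ih.1], ?_⟩
      rw [Equiv.Perm.mul_apply, Equiv.Perm.mul_apply, Equiv.Perm.mul_apply]
      congr 1
      have hd := ih.1
      rcases d with ⟨e, i⟩ | b
      · by_cases he : e = c
        · subst he
          have h1 := ho (D.corner e 0)
          have h2 := ho (D.corner e 1)
          have h3 := ho (D.corner e 2)
          change o (D.corner e 1) = _ at h1
          change o (D.corner e 2) = _ at h2
          change o (D.corner e 3) = _ at h3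
          rw [h1, two] at h2
          rw [h2] at h3
          fin_cases i
          · change smoothing (insert e v) (D.corner e 0) =
              smoothing v (Equiv.swap (D.corner e 0) (D.corner e 2) (D.corner e 0))
            rw [Equiv.swap_apply_left]
            simp [smoothing, hc]
          · exact absurd (hd.symm.trans h1) (two1 _)
          · change smoothing (insert e v) (D.corner e 2) =
              smoothing v (Equiv.swap (D.corner e 0) (D.corner e 2) (D.corner e 2))
            rw [Equiv.swap_apply_right]
            simp [smoothing, hc]
          · exact absurd (hd.symm.trans h3) (two1 _)
        · rw [Equiv.swap_apply_of_ne_of_ne (by simp [he]) (by simp [he])]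
          simp [smoothing, he]
      · rw [Equiv.swap_apply_of_ne_of_ne (by simp) (by simp)]
        simp [smoothing]
  rw [not_iff_not]
  constructor
  · intro h
    obtain ⟨k, hk⟩ := h.exists_nat_pow_eq
    refine ⟨k, ?_⟩
    rw [zpow_natCast, (hpow k).2, hk]
  · intro h
    obtain ⟨k, hk⟩ := h.exists_nat_pow_eq
    refine ⟨k, ?_⟩
    rw [zpow_natCast, ← (hpow k).2, hk]

end planarity

/-! ### How the components change -/

section components

variable {D} {v w : Finset (Fin D.n)} {c : Fin D.n}

theorem conn_corner_zero (hc : c ∉ v) : D.conn v (D.corner c 0) (D.corner c 1) ∧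
    D.conn v (D.corner c 2) (D.corner c 3) := by
  have h0 := D.conn_smoothing v (D.corner c 0)
  have h2 := D.conn_smoothing v (D.corner c 2)
  rw [smoothing_corner, if_neg hc] at h0 h2
  exact ⟨h0, h2⟩

theorem conn_corner_one (hc : c ∈ v) : D.conn v (D.corner c 0) (D.corner c 3) ∧
    D.conn v (D.corner c 2) (D.corner c 1) := by
  have h0 := D.conn_smoothing v (D.corner c 0)
  have h2 := D.conn_smoothing v (D.corner c 2)
  rw [smoothing_corner, if_pos hc] at h0 h2
  exact ⟨h0, h2⟩

/-- Two states that differ at the single crossing `c`, at which the components of `w` through the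
ends `0` and `2` are different, whereas they agree in `v`. -/
structure Refines (v w : Finset (Fin D.n)) (c : Fin D.n) : Prop where
  ne : D.comp w (D.corner c 0) ≠ D.comp w (D.corner c 2)
  eq : D.comp v (D.corner c 0) = D.comp v (D.corner c 2)
  le : ∀ d e, D.comp w d = D.comp w e → D.comp v d = D.comp v e
  ge : ∀ d e, D.comp v d = D.comp v e → D.comp w d = D.comp w e ∨
    (D.comp w d = D.comp w (D.corner c 0) ∧ D.comp w e = D.comp w (D.corner c 2)) ∨
    (D.comp w d = D.comp w (D.corner c 2) ∧ D.comp w e = D.comp w (D.corner c 0))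

theorem refines_aux (h : ∀ e, e ≠ c → (e ∈ v ↔ e ∈ w))
    (hv : ∀ i j, D.conn v (D.corner c i) (D.corner c j))
    (hw : D.comp w (D.corner c 0) ≠ D.comp w (D.corner c 2))
    (hw' : ∀ i, D.conn w (D.corner c i) (D.corner c 0) ∨ D.conn w (D.corner c i) (D.corner c 2)) :
    Refines v w c := by
  have hsm : ∀ d, (∃ i j, d = D.corner c i ∧ smoothing v d = D.corner c j ∧
      ∃ k, smoothing w d = D.corner c k) ∨ smoothing v d = smoothing w d := by
    rintro (⟨e, i⟩ | b)
    · by_cases he : e = c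
      · subst he
        exact Or.inl ⟨i, _, rfl, rfl, _, rfl⟩
      · right
        simp [smoothing, h e he]
    · right; simp [smoothing]
  refine ⟨hw, D.comp_eq.2 (hv 0 2), fun d e hde => ?_, fun d e hde => ?_⟩
  · rw [comp_eq] at hde ⊢
    induction hde with
    | rel d e hr =>
      rcases hr with rfl | rfl
      · exact D.conn_arc v d
      · rcases hsm d with ⟨i, j, rfl, -, k, hk⟩ | hd
        · rw [hk]; exact hv _ _
        · rw [← hd]; exact D.conn_smoothing v d
    | refl => exact (D.conn v).refl _
    | symm _ _ _ ih => exact (D.conn v).symm ih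
    | trans _ _ _ _ _ ih1 ih2 => exact (D.conn v).trans ih1 ih2
  · rw [comp_eq] at hde
    induction hde with
    | rel d e hr =>
      rcases hr with rfl | rfl
      · exact Or.inl (D.comp_eq.2 (D.conn_arc w d))
      · rcases hsm d with ⟨i, j, rfl, hj, -⟩ | hd
        · rw [hj]
          rcases hw' i with a | a <;> rcases hw' j with b | b <;> rw [← comp_eq] at a b <;>
            simp [a, b]
        · rw [hd]; exact Or.inl (D.comp_eq.2 (D.conn_smoothing w d))
    | refl => exact Or.inl rfl
    | symm _ _ _ ih =>
      rcases ih with a | ⟨a, b⟩ | ⟨a, b⟩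
      · exact Or.inl a.symm
      · exact Or.inr (Or.inr ⟨b, a⟩)
      · exact Or.inr (Or.inl ⟨b, a⟩)
    | trans _ _ _ _ _ ih1 ih2 =>
      rcases ih1 with a | ⟨a, b⟩ | ⟨a, b⟩ <;> rcases ih2 with a2 | ⟨a2, b2⟩ | ⟨a2, b2⟩ <;> grind

theorem Splits.refines (hs : D.Splits v c) (hc : c ∉ v) : Refines v (insert c v) c := by
  have h1 := (D.splits_iff hc).1 hs
  have h2 := conn_corner_zero hc
  have h3 := conn_corner_one (Finset.mem_insert_self c v)
  rw [Splits, comp_eq] at hs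
  refine refines_aux (fun e he => by simp [he]) ?_ h1 ?_
  · have : ∀ i, D.conn v (D.corner c i) (D.corner c 0) := by
      intro i
      fin_cases i
      · exact (D.conn v).refl _
      · exact (D.conn v).symm h2.1
      · exact (D.conn v).symm hs
      · exact (D.conn v).symm ((D.conn v).trans hs h2.2)
    exact fun i j => (D.conn v).trans (this i) ((D.conn v).symm (this j))
  · intro i
    fin_cases i
    · exact Or.inl ((D.conn _).refl _)
    · exact Or.inr ((D.conn _).symm h3.2)
    · exact Or.inr ((D.conn _).refl _)
    · exact Or.inl ((D.conn _).symm h3.1)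

theorem refines_of_not_splits (hs : ¬ D.Splits v c) (hc : c ∉ v) : Refines (insert c v) v c := by
  have h1 := hs
  rw [D.splits_iff hc, not_not, comp_eq] at h1
  have h2 := conn_corner_zero hc
  have h3 := conn_corner_one (Finset.mem_insert_self c v)
  refine refines_aux (fun e he => by simp [he]) ?_ hs ?_
  · have : ∀ i, D.conn (insert c v) (D.corner c i) (D.corner c 0) := by
      intro i
      fin_cases i
      · exact (D.conn _).refl _
      · exact (D.conn _).symm ((D.conn _).trans h1 h3.2)
      · exact (D.conn _).symm h1
      · exact (D.conn _).symm h3.1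
    exact fun i j => (D.conn _).trans (this i) ((D.conn _).symm (this j))
  · intro i
    fin_cases i
    · exact Or.inl ((D.conn _).refl _)
    · exact Or.inl ((D.conn _).symm h2.1)
    · exact Or.inr ((D.conn _).refl _)
    · exact Or.inr ((D.conn _).symm h2.2)

theorem comp_out (q : Quotient (D.conn v)) : D.comp v q.out = Sum.inl q := by
  rw [comp, Quotient.out_eq]

theorem Refines.card (h : Refines v w c) :
    Fintype.card (D.Comp w) = Fintype.card (D.Comp v) + 1 := by
  classical
  let f : {k : D.Comp w // k ≠ D.comp w (D.corner c 2)} → D.Comp v := fun k => D.transport w v k.1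
  have hf : Function.Bijective f := by
    constructor
    · rintro ⟨q | l, hk⟩ ⟨q' | l', hk'⟩ hkk
      · have : D.comp v q.out = D.comp v q'.out := hkk
        rw [← comp_out] at hk hk'
        rw [Subtype.mk.injEq, ← comp_out, ← comp_out]
        rcases h.ge _ _ this with a | ⟨a, b⟩ | ⟨a, b⟩
        · exact a
        · exact absurd b hk'
        · exact absurd a hk
      · exact absurd hkk (by simp [f, transport, comp])
      · exact absurd hkk (by simp [f, transport, comp])
      · simpa [f, transport] using hkk
    · have key : ∀ d, D.comp w d ≠ D.comp w (D.corner c 2) → ∃ k, f k = D.comp v d := by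
        intro d hd
        refine ⟨⟨D.comp w d, hd⟩, ?_⟩
        change D.comp v _ = D.comp v d
        apply h.le
        exact comp_out _
      rintro (q | l)
      · rw [← comp_out]
        by_cases hd : D.comp w q.out = D.comp w (D.corner c 2)
        · rw [h.le _ _ hd, ← h.eq]
          exact key _ h.ne
        · exact key _ hd
      · exact ⟨⟨Sum.inr l, by simp [comp]⟩, rfl⟩
  have h1 := Fintype.card_congr (Equiv.ofBijective f hf)
  have h2 := Fintype.card_subtype_compl (fun k : D.Comp w => k = D.comp w (D.corner c 2))
  have h3 : 0 < Fintype.card (D.Comp w) := Fintype.card_pos_iff.2 ⟨D.comp w (D.corner c 2)⟩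
  rw [Fintype.card_subtype_eq] at h2
  have h4 : Fintype.card {k : D.Comp w // k ≠ D.comp w (D.corner c 2)} =
    Fintype.card (D.Comp w) - 1 := by convert h2
  omega

theorem card_insert_comp (hc : c ∉ v) :
    (Fintype.card (D.Comp (insert c v)) : ℤ) + 1 = Fintype.card (D.Comp v) +
      2 * (open Classical in if D.Splits v c then 1 else 0) := by
  by_cases hs : D.Splits v c
  · rw [if_pos hs, (hs.refines hc).card]; push_cast; ring
  · rw [if_neg hs, (refines_of_not_splits hs hc).card]; push_cast; ring

/-- The two ways around a square of states. -/
theorem square_cases {c' : Fin D.n} (hc : c ∉ v) (hc' : c' ∉ v) (hcc : c ≠ c') :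
    ((D.Splits v c ↔ D.Splits (insert c' v) c) ∧ (D.Splits v c' ↔ D.Splits (insert c v) c')) ∨
    ((D.Splits v c ∧ D.Splits v c' ∧ ¬ D.Splits (insert c' v) c ∧ ¬ D.Splits (insert c v) c') ∧
      ∀ i ∈ [(0 : Fin 4), 2], ∀ j ∈ [(0 : Fin 4), 2],
        D.comp (insert c' (insert c v)) (D.corner c i) =
          D.comp (insert c' (insert c v)) (D.corner c' j)) ∨
    ((¬ D.Splits v c ∧ ¬ D.Splits v c' ∧ D.Splits (insert c' v) c ∧ D.Splits (insert c v) c') ∧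
      ((D.comp (insert c' (insert c v)) (D.corner c 0) =
          D.comp (insert c' (insert c v)) (D.corner c' 0) ∧
        D.comp (insert c' (insert c v)) (D.corner c 2) =
          D.comp (insert c' (insert c v)) (D.corner c' 2)) ∨
      (D.comp (insert c' (insert c v)) (D.corner c 0) =
          D.comp (insert c' (insert c v)) (D.corner c' 2) ∧
        D.comp (insert c' (insert c v)) (D.corner c 2) =
          D.comp (insert c' (insert c v)) (D.corner c' 0)))) := by
  have m1 : c' ∉ insert c v := by simp [hc', hcc.symm]
  have m2 : c ∉ insert c' v := by simp [hc, hcc]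
  have comm : insert c (insert c' v) = insert c' (insert c v) := Finset.insert_comm _ _ _
  have a1 := card_insert_comp hc
  have a2 := card_insert_comp m1
  have b1 := card_insert_comp hc'
  have b2 := card_insert_comp m2
  rw [comm] at b2
  by_cases p : D.Splits v c <;> by_cases q : D.Splits v c' <;>
    by_cases p' : D.Splits (insert c' v) c <;> by_cases q' : D.Splits (insert c v) c' <;>
    simp only [p, q, p', q', if_true, if_false] at a1 a2 b1 b2 <;> (first | (exfalso; omega) | skip)
  · exact Or.inl (by simp [p, q, p', q'])
  · right; left
    refine ⟨⟨p, q, p', q'⟩, ?_⟩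
    have r1 := p.refines hc
    have r2 := refines_of_not_splits q' m1
    have r3 := refines_of_not_splits p' m2
    rw [comm] at r3
    have q2 := q'
    rw [Splits] at q q2
    have hk : D.comp (insert c' (insert c v)) (D.corner c' 0) =
        D.comp (insert c' (insert c v)) (D.corner c 0) := by
      rcases r1.ge _ _ q with a | ⟨a, -⟩ | ⟨a, -⟩
      · exact absurd a q2
      · exact r2.le _ _ a
      · exact (r2.le _ _ a).trans r3.eq.symm
    have e1 := r2.eq
    have e2 := r3.eq
    intro i hi j hj
    simp only [List.mem_cons, List.not_mem_nil, or_false] at hi hj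
    rcases hi with rfl | rfl <;> rcases hj with rfl | rfl <;> grind
  · exact Or.inl (by simp [p, q, p', q'])
  · exact Or.inl (by simp [p, q, p', q'])
  · right; right
    refine ⟨⟨p, q, p', q'⟩, ?_⟩
    have r3 := p'.refines m2
    rw [comm] at r3
    have r4 := q'.refines m1
    have r5 := refines_of_not_splits q hc'
    rcases r3.ge _ _ r5.eq with a | ⟨a, b⟩ | ⟨a, b⟩
    · exact absurd a r4.ne
    · exact Or.inl ⟨a.symm, b.symm⟩
    · exact Or.inr ⟨b.symm, a.symm⟩
  · exact Or.inl (by simp [p, q, p', q'])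

end components


end TangleDiagram

/-! ### Quantum gradings and filtrations

A quantum grading or filtration on a module is recorded by the family of additive subgroups
`deg k` of the elements of degree `k` (respectively of filtration level `k`). -/

/-- Degrees in a tensor product: spanned by the `m ⊗ n` with `deg m + deg n = k`. -/
def tensorDeg {S M N : Type*} [CommRing S] [AddCommGroup M] [Module S M] [AddCommGroup N]
    [Module S N] (p : ℤ → AddSubgroup M) (q : ℤ → AddSubgroup N) (k : ℤ) :
    AddSubgroup (M ⊗[S] N) :=
  AddSubgroup.closure {z | ∃ i j : ℤ, ∃ m ∈ p i, ∃ n ∈ q j, i + j = k ∧ z = m ⊗ₜ[S] n}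

/-- Degrees in the free module with basis `1, X`, where `deg 1 = 0` and `deg X = -2`: the element
`r 1 + s X` has degree `k` if `r` has degree `k` and `s` has degree `k + 2`. -/
noncomputable def freeDeg {R A : Type*} [CommRing R] [AddCommGroup A] [Module R A]
    (b : Module.Basis (Fin 2) R A) (deg : ℤ → AddSubgroup R) (k : ℤ) : AddSubgroup A :=
  (deg k).comap ((b.coord 0).toAddMonoidHom) ⊓ (deg (k + 2)).comap ((b.coord 1).toAddMonoidHom)

/-- A Frobenius system `(R, A, Δ, ε)` of rank two: a commutative and cocommutative Frobenius
algebra `A` over `R`, freely generated as an `R`-module by `1` and an element `X`. The ring `R`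
carries a multiplicative family `deg` of additive subgroups: the homogeneous parts of a grading, or
the steps of a filtration (or all `deg k = ⊤`, if there is no grading). The induced family on `A`
has `deg 1 = 0` and `deg X = -2`. As the degree of a cobordism is its Euler characteristic (minus
the number of strands), the counit has degree `2` and the comultiplication has degree `-2`. -/
structure FrobeniusSystem (R A : Type*) [CommRing R] [CommRing A] [Algebra R A] extends
    Coalgebra R A where
  comm_comp_comul : (TensorProduct.comm R A A).toLinearMap ∘ₗ comul = comul
  frobenius : comul ∘ₗ LinearMap.mul' R A =
    (LinearMap.mul' R A).lTensor A ∘ₗ (TensorProduct.assoc R A A A).toLinearMap ∘ₗ comul.rTensor A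
  basis : Module.Basis (Fin 2) R A
  basis_zero : basis 0 = 1
  deg : ℤ → AddSubgroup R
  one_mem_deg : (1 : R) ∈ deg 0
  mul_mem_deg : ∀ {i j : ℤ} {r s : R}, r ∈ deg i → s ∈ deg j → r * s ∈ deg (i + j)
  X_mul_X_mem : basis 1 * basis 1 ∈ freeDeg basis deg (-4)
  counit_mem : ∀ {k : ℤ} {a : A}, a ∈ freeDeg basis deg k → counit a ∈ deg (k + 2)
  comul_mem : ∀ {k : ℤ} {a : A}, a ∈ freeDeg basis deg k →
    comul a ∈ tensorDeg (freeDeg basis deg) (freeDeg basis deg) (k - 2)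

/-! ### Complexes -/

/-- A cochain complex of `S`-modules with a quantum grading or filtration on each chain module
that is preserved by the differential. -/
structure QComplex (S : Type*) [CommRing S] where
  X : ℤ → Type*
  [grp : ∀ i, AddCommGroup (X i)]
  [mod : ∀ i, Module S (X i)]
  d : ∀ i, X i →ₗ[S] X (i + 1)
  d_comp_d : ∀ i, d (i + 1) ∘ₗ d i = 0
  deg : ∀ i : ℤ, ℤ → AddSubgroup (X i)
  d_mem : ∀ i k x, x ∈ deg i k → d i x ∈ deg (i + 1) k

attribute [instance] QComplex.grp QComplex.mod

namespace QComplex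

/-- An isomorphism of complexes of `S`-modules, of quantum degree `0` in both directions. -/
structure Iso {S : Type*} [CommRing S] (C D : QComplex S) where
  e : ∀ i, C.X i ≃ₗ[S] D.X i
  comm : ∀ i x, e (i + 1) (C.d i x) = D.d i (e i x)
  mem_deg_iff : ∀ i k x, e i x ∈ D.deg i k ↔ x ∈ C.deg i k

/-- The shift `C{m}` of the quantum degree: `C{m}` has in degree `k` what `C` has in
degree `k - m`. -/
def shift {S : Type*} [CommRing S] (C : QComplex S) (m : ℤ) : QComplex S where
  X := C.X
  d := C.d
  d_comp_d := C.d_comp_d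
  deg i k := C.deg i (k - m)
  d_mem i _ x h := C.d_mem i _ x h

/-- The complex `C ⊗_S S'`, where `S'` is an `S`-module through the ring homomorphism `f` and has
the quantum degrees `q`. -/
noncomputable def baseChange {S S' : Type*} [CommRing S] [CommRing S'] (C : QComplex S)
    (f : S →+* S') (q : ℤ → AddSubgroup S') : QComplex S' :=
  letI : Algebra S S' := f.toAlgebra
  { X := fun i => S' ⊗[S] C.X i
    d := fun i => (C.d i).baseChange S'
    d_comp_d := fun i => by
      rw [← LinearMap.baseChange_comp, C.d_comp_d, LinearMap.baseChange_zero]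
    deg := fun i => tensorDeg q (C.deg i)
    d_mem := fun i _ x hx => by
      induction hx using AddSubgroup.closure_induction with
      | mem x hx =>
        obtain ⟨a, b, m, hm, n, hn, hab, rfl⟩ := hx
        exact AddSubgroup.subset_closure ⟨a, b, m, hm, _, C.d_mem i b n hn, hab, rfl⟩
      | zero => rw [map_zero]; exact zero_mem _
      | add x y _ _ hx hy => rw [map_add]; exact add_mem hx hy
      | neg x _ hx => rw [map_neg]; exact neg_mem hx }

end QComplex

/-! ### The cube of resolutions -/

open TangleDiagram

noncomputable instance (D : TangleDiagram) (v : Finset (Fin D.n)) : DecidableEq (D.Comp v) :=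
  Classical.decEq _

section cube

variable (R A : Type*) [CommRing R] [CommRing A] [Algebra R A] (D : TangleDiagram)

/-- The value of the TQFT on the state `v`: the tensor product over `R` of one copy of `A` for
each component of the smoothed diagram. -/
def StateSpace (v : Finset (Fin D.n)) : Type _ := ⨂[R] _ : D.Comp v, A

noncomputable instance (v : Finset (Fin D.n)) : CommRing (StateSpace R A D v) :=
  inferInstanceAs (CommRing (⨂[R] _ : D.Comp v, A))

noncomputable instance (v : Finset (Fin D.n)) : Algebra R (StateSpace R A D v) :=
  inferInstanceAs (Algebra R (⨂[R] _ : D.Comp v, A))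

variable {D}

/-- `a ↦ 1 ⊗ ⋯ ⊗ a ⊗ ⋯ ⊗ 1`, with `a` in the factor of the component `k`. -/
noncomputable def label {v : Finset (Fin D.n)} (k : D.Comp v) : A →ₐ[R] StateSpace R A D v :=
  PiTensorProduct.singleAlgHom (R := R) (A := fun _ : D.Comp v => A) k

variable (D)

/-- `A` acts on the factor of the special strand. -/
noncomputable instance (v : Finset (Fin D.n)) : Module A (StateSpace R A D v) :=
  Module.compHom _ (label R A (D.strand v)).toRingHom

variable {R A D}

/-- `a ⊗ b ↦ 1 ⊗ ⋯ ⊗ a ⊗ ⋯ ⊗ b ⊗ ⋯ ⊗ 1`, with `a` and `b` in the factors `k` and `k'`. -/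
noncomputable def pairLabel {v : Finset (Fin D.n)} (k k' : D.Comp v) :
    A ⊗[R] A →ₐ[R] StateSpace R A D v :=
  Algebra.TensorProduct.lift (label R A k) (label R A k') fun _ _ => Commute.all _ _

/-- The pure tensor `⨂ a k`. -/
noncomputable def pureTensor {v : Finset (Fin D.n)} (a : D.Comp v → A) : StateSpace R A D v :=
  PiTensorProduct.tprod R a

namespace FrobeniusSystem

variable (F : FrobeniusSystem R A)

open Classical in
/-- The effect of the saddle at the crossing `c` on the tensor factor of the component `k`:
if the saddle splits `k`, apply `Δ`; otherwise send the factor to the one of the component of `w`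
that contains `k`. -/
noncomputable def leg (v w : Finset (Fin D.n)) (c : Fin D.n) (k : D.Comp v) :
    A →ₗ[R] StateSpace R A D w :=
  if D.Splits v c ∧ k = D.comp v (D.corner c 0) then
    (pairLabel (D.comp w (D.corner c 0)) (D.comp w (D.corner c 2))).toLinearMap ∘ₗ F.comul
  else (label R A (D.transport v w k)).toLinearMap

/-- The value of the TQFT on the saddle at `c` from the state `v` to `w = v ∪ {c}`: the product in
`⨂ A` over all components of the contributions of the tensor factors. Thus factors of merging
components are multiplied in `A`, the factor of a splitting component is comultiplied, and
the other factors are left unchanged. -/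
noncomputable def saddle (v w : Finset (Fin D.n)) (c : Fin D.n) :
    StateSpace R A D v →ₗ[R] StateSpace R A D w :=
  PiTensorProduct.lift
    ((MultilinearMap.mkPiAlgebra R (D.Comp v) (StateSpace R A D w)).compLinearMap (F.leg v w c))

/-- The quantum degrees of `A`. -/
noncomputable def degA : ℤ → AddSubgroup A := freeDeg F.basis F.deg

/-- The quantum degrees of the tensor product of the modules `A{1}`. -/
noncomputable def stateDeg (v : Finset (Fin D.n)) (k : ℤ) : AddSubgroup (StateSpace R A D v) :=
  AddSubgroup.closure {z | ∃ (a : D.Comp v → A) (m : D.Comp v → ℤ), (∀ j, a j ∈ F.degA (m j)) ∧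
    ∑ j, (m j + 1) = k ∧ z = pureTensor a}

end FrobeniusSystem

/-! The squares of the cube commute, and saddles have degree `-1`. -/

theorem pure_mul_pure {v : Finset (Fin D.n)} (a b : D.Comp v → A) :
    (pureTensor a : StateSpace R A D v) * pureTensor b = pureTensor (a * b) :=
  PiTensorProduct.tprod_mul_tprod a b

theorem pure_one {v : Finset (Fin D.n)} : (pureTensor 1 : StateSpace R A D v) = 1 := rfl

theorem label_apply {v : Finset (Fin D.n)} (k : D.Comp v) (a : A) :
    label R A k a = pureTensor (Pi.mulSingle k a) := rfl

theorem pure_eq_prod {v : Finset (Fin D.n)} (a : D.Comp v → A) :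
    (pureTensor a : StateSpace R A D v) = ∏ k, label R A k (a k) := by
  conv_lhs => rw [← Finset.univ_prod_mulSingle a]
  exact PiTensorProduct.tprod_prod _ _

theorem state_hom_ext {v : Finset (Fin D.n)} {M : Type*} [AddCommGroup M] [Module R M]
    {f g : StateSpace R A D v →ₗ[R] M} (h : ∀ a, f (pureTensor a) = g (pureTensor a)) : f = g :=
  PiTensorProduct.ext (MultilinearMap.ext h)

theorem smul_state_def {v : Finset (Fin D.n)} (a : A) (x : StateSpace R A D v) :
    a • x = label R A (D.strand v) a * x := rfl

/-- A linear map between state spaces that commutes with multiplication by labels at each point of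
the diagram. -/
def IsLocal {v w : Finset (Fin D.n)} (f : StateSpace R A D v →ₗ[R] StateSpace R A D w) : Prop :=
  (∀ d a x, f (label R A (D.comp v d) a * x) = label R A (D.comp w d) a * f x) ∧
  ∀ l a x, f (label R A (Sum.inr l) a * x) = label R A (Sum.inr l) a * f x

theorem IsLocal.comp {u v w : Finset (Fin D.n)} {f : StateSpace R A D u →ₗ[R] StateSpace R A D v}
    {g : StateSpace R A D v →ₗ[R] StateSpace R A D w} (hf : IsLocal f) (hg : IsLocal g) :
    IsLocal (g ∘ₗ f) :=
  ⟨fun d a x => by rw [LinearMap.comp_apply, hf.1, hg.1, LinearMap.comp_apply],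
    fun d a x => by rw [LinearMap.comp_apply, hf.2, hg.2, LinearMap.comp_apply]⟩

theorem IsLocal.ext {v w : Finset (Fin D.n)} {f g : StateSpace R A D v →ₗ[R] StateSpace R A D w}
    (hf : IsLocal f) (hg : IsLocal g) (h : f 1 = g 1) : f = g := by
  apply state_hom_ext
  intro a
  rw [pure_eq_prod]
  induction (Finset.univ : Finset (D.Comp v)) using Finset.induction_on with
  | empty => simpa using h
  | insert k s hk ih =>
    rw [Finset.prod_insert hk]
    rcases k with q | l
    · rw [← comp_out, hf.1, hg.1, ih]
    · rw [hf.2, hg.2, ih]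

theorem IsLocal.pairLabel {v w : Finset (Fin D.n)}
    {f : StateSpace R A D v →ₗ[R] StateSpace R A D w} (hf : IsLocal f) (d e : Dart D.n)
    (z : A ⊗[R] A) : f (pairLabel (D.comp v d) (D.comp v e) z) =
      Khovanov.pairLabel (D.comp w d) (D.comp w e) z * f 1 := by
  induction z using TensorProduct.induction_on with
  | zero => simp
  | tmul a b =>
    rw [Khovanov.pairLabel, Khovanov.pairLabel, Algebra.TensorProduct.lift_tmul,
      Algebra.TensorProduct.lift_tmul, hf.1, ← mul_one (label R A (D.comp v e) b), hf.1, mul_assoc]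
  | add x y hx hy => rw [map_add, map_add, map_add, hx, hy, add_mul]

theorem pairLabel_comm {v : Finset (Fin D.n)} (k k' : D.Comp v) (z : A ⊗[R] A) :
    pairLabel k k' (TensorProduct.comm R A A z) = pairLabel k' k z := by
  induction z using TensorProduct.induction_on with
  | zero => simp
  | tmul a b =>
    rw [TensorProduct.comm_tmul, pairLabel, pairLabel, Algebra.TensorProduct.lift_tmul,
      Algebra.TensorProduct.lift_tmul, mul_comm]
  | add x y hx hy => rw [map_add, map_add, map_add, hx, hy]

namespace FrobeniusSystem

variable (F : FrobeniusSystem R A)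

theorem comul_mul_right (a b : A) : F.comul (a * b) = (1 ⊗ₜ b) * F.comul a := by
  have h := LinearMap.congr_fun F.frobenius (a ⊗ₜ b)
  simp only [LinearMap.comp_apply, LinearMap.mul'_apply, LinearMap.rTensor_tmul] at h
  rw [h]
  generalize F.comul a = z
  induction z using TensorProduct.induction_on with
  | zero => simp
  | tmul x y => simp [mul_comm]
  | add x y hx hy => rw [TensorProduct.add_tmul, map_add, map_add, hx, hy, mul_add]

theorem comm_comul (a : A) : TensorProduct.comm R A A (F.comul a) = F.comul a :=
  LinearMap.congr_fun F.comm_comp_comul a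

theorem comul_mul_left (a b : A) : F.comul (a * b) = (b ⊗ₜ 1) * F.comul a := by
  have h := congrArg (TensorProduct.comm R A A) (F.comul_mul_right a b)
  rw [F.comm_comul] at h
  rw [h]
  conv_rhs => rw [← F.comm_comul]
  generalize F.comul a = z
  induction z using TensorProduct.induction_on with
  | zero => simp
  | tmul x y => simp
  | add x y hx hy => rw [mul_add, map_add, hx, hy, map_add, mul_add]

variable {v w : Finset (Fin D.n)} {c : Fin D.n}

theorem saddle_pure (a : D.Comp v → A) :
    F.saddle v w c (pureTensor a) = ∏ k, F.leg v w c k (a k) := by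
  rw [saddle, pureTensor]
  erw [PiTensorProduct.lift.tprod]
  rfl

theorem saddle_label_mul {k : D.Comp v} {k' : D.Comp w}
    (h : ∀ a b, F.leg v w c k (a * b) = label R A k' a * F.leg v w c k b)
    (a : A) (x : StateSpace R A D v) :
    F.saddle v w c (label R A k a * x) = label R A k' a * F.saddle v w c x := by
  have : F.saddle v w c ∘ₗ LinearMap.mulLeft R (label R A k a) =
      LinearMap.mulLeft R (label R A k' a) ∘ₗ F.saddle v w c := by
    apply state_hom_ext
    intro b
    rw [LinearMap.comp_apply, LinearMap.comp_apply, LinearMap.mulLeft_apply,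
      LinearMap.mulLeft_apply, label_apply, pure_mul_pure, saddle_pure, saddle_pure,
      ← Finset.mul_prod_erase _ _ (Finset.mem_univ k),
      ← Finset.mul_prod_erase _ (fun j => F.leg v w c j (b j)) (Finset.mem_univ k),
      Pi.mul_apply, Pi.mulSingle_eq_same, h, mul_assoc]
    congr 2
    refine Finset.prod_congr rfl fun j hj => ?_
    rw [Pi.mul_apply, Pi.mulSingle_eq_of_ne (Finset.ne_of_mem_erase hj), one_mul]
  exact LinearMap.congr_fun this x

theorem leg_comul_mul (k k' : D.Comp w) (a b : A) :
    pairLabel k k' (F.comul (a * b)) = label R A k a * pairLabel k k' (F.comul b) ∧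
    pairLabel k k' (F.comul (a * b)) = label R A k' a * pairLabel k k' (F.comul b) := by
  rw [mul_comm a b]
  constructor
  · rw [comul_mul_left, map_mul]; congr 1; simp [pairLabel]
  · rw [comul_mul_right, map_mul]; congr 1; simp [pairLabel]

theorem saddle_isLocal (hc : c ∉ v) (hw : w = insert c v) : IsLocal (F.saddle v w c) := by
  subst hw
  constructor
  · intro d a x
    apply saddle_label_mul
    intro a b
    unfold leg
    by_cases hs : D.Splits v c
    · have r := hs.refines hc
      by_cases hk : D.comp v d = D.comp v (D.corner c 0)
      · rw [if_pos ⟨hs, hk⟩]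
        simp only [LinearMap.comp_apply, AlgHom.toLinearMap_apply]
        have h := F.leg_comul_mul (D.comp (insert c v) (D.corner c 0))
          (D.comp (insert c v) (D.corner c 2)) a b
        rcases r.ge _ _ hk with e | ⟨e, -⟩ | ⟨e, -⟩
        · rw [e]; exact h.1
        · rw [e]; exact h.1
        · rw [e]; exact h.2
      · rw [if_neg (fun h => hk h.2)]
        simp only [AlgHom.toLinearMap_apply, map_mul]
        congr 2
        have h1 : D.comp v (Quotient.out (Quotient.mk (D.conn v) d)) = D.comp v d := comp_out _
        rcases r.ge _ _ h1 with e | ⟨-, e⟩ | ⟨-, e⟩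
        · exact congrArg (fun k => label R A k) e
        · exact absurd ((r.le _ _ e).trans r.eq.symm) hk
        · exact absurd (r.le _ _ e) hk
    · have r := refines_of_not_splits hs hc
      rw [if_neg (fun h => hs h.1)]
      simp only [AlgHom.toLinearMap_apply, map_mul]
      congr 2
      exact congrArg (fun k => label R A k) (r.le _ _ (comp_out (Quotient.mk (D.conn v) d)))
  · intro l a x
    apply saddle_label_mul
    intro a b
    unfold leg
    rw [if_neg (by simp [TangleDiagram.comp])]
    simp only [AlgHom.toLinearMap_apply, map_mul]
    rfl

open Classical in
theorem saddle_one : F.saddle v w c 1 = if D.Splits v c then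
    pairLabel (D.comp w (D.corner c 0)) (D.comp w (D.corner c 2)) (F.comul 1) else 1 := by
  rw [← pure_one, saddle_pure]
  by_cases hs : D.Splits v c
  · rw [if_pos hs, Finset.prod_eq_single (D.comp v (D.corner c 0))]
    · rw [leg, if_pos ⟨hs, rfl⟩]; rfl
    · intro k _ hk
      rw [leg, if_neg (fun h => hk h.2)]
      exact map_one (label R A _)
    · simp
  · rw [if_neg hs]
    refine Finset.prod_eq_one fun k _ => ?_
    rw [leg, if_neg (fun h => hs h.1)]
    exact map_one (label R A _)

theorem saddle_comm {c' : Fin D.n} (hc : c ∉ v) (hc' : c' ∉ v) (hcc : c ≠ c') :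
    F.saddle (insert c v) (insert c' (insert c v)) c' ∘ₗ F.saddle v (insert c v) c =
    F.saddle (insert c' v) (insert c' (insert c v)) c ∘ₗ F.saddle v (insert c' v) c' := by
  classical
  have m1 : c' ∉ insert c v := by simp [hc', hcc.symm]
  have m2 : c ∉ insert c' v := by simp [hc, hcc]
  have comm : insert c' (insert c v) = insert c (insert c' v) := Finset.insert_comm _ _ _
  have l1 := F.saddle_isLocal m1 rfl
  have l2 := F.saddle_isLocal m2 comm
  refine ((F.saddle_isLocal hc rfl).comp l1).ext ((F.saddle_isLocal hc' rfl).comp l2) ?_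
  rw [LinearMap.comp_apply, LinearMap.comp_apply, saddle_one, saddle_one]
  rcases square_cases hc hc' hcc with ⟨h1, h2⟩ | ⟨⟨p, q, p', q'⟩, h⟩ | ⟨⟨p, q, p', q'⟩, h⟩
  · by_cases p : D.Splits v c <;> by_cases q : D.Splits v c'
    · rw [if_pos p, if_pos q, l1.pairLabel, l2.pairLabel, saddle_one, saddle_one,
        if_pos (h1.1 p), if_pos (h2.1 q), mul_comm]
    · rw [if_pos p, if_neg q, l1.pairLabel, saddle_one, saddle_one,
        if_pos (h1.1 p), if_neg (fun h => q (h2.2 h)), mul_one]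
    · rw [if_neg p, if_pos q, l2.pairLabel, saddle_one, saddle_one,
        if_neg (fun h => p (h1.2 h)), if_pos (h2.1 q), mul_one]
    · rw [if_neg p, if_neg q, saddle_one, saddle_one,
        if_neg (fun h => p (h1.2 h)), if_neg (fun h => q (h2.2 h))]
  · rw [if_pos p, if_pos q, l1.pairLabel, l2.pairLabel, saddle_one, saddle_one, if_neg p',
      if_neg q', mul_one, mul_one]
    have a1 := h 0 (by simp) 0 (by simp)
    have a2 := h 2 (by simp) 2 (by simp)
    rw [a1, a2]
  · rw [if_neg p, if_neg q, saddle_one, saddle_one, if_pos p', if_pos q']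
    rcases h with ⟨a, b⟩ | ⟨a, b⟩
    · rw [a, b]
    · rw [a, b, ← pairLabel_comm, F.comm_comul]

theorem mem_degA {a : A} {k : ℤ} :
    a ∈ F.degA k ↔ F.basis.coord 0 a ∈ F.deg k ∧ F.basis.coord 1 a ∈ F.deg (k + 2) := Iff.rfl

theorem one_mem_degA : (1 : A) ∈ F.degA 0 := by
  rw [mem_degA, ← F.basis_zero]
  simp [F.one_mem_deg]

theorem eq_coord (a : A) : a = F.basis.coord 0 a • 1 + F.basis.coord 1 a • F.basis 1 := by
  have h := F.basis.sum_repr a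
  rw [Fin.sum_univ_two, F.basis_zero] at h
  exact h.symm

theorem mul_mem_degA {i j : ℤ} {a b : A} (ha : a ∈ F.degA i) (hb : b ∈ F.degA j) :
    a * b ∈ F.degA (i + j) := by
  obtain ⟨a0, a1⟩ := F.mem_degA.1 ha
  obtain ⟨b0, b1⟩ := F.mem_degA.1 hb
  obtain ⟨p, q⟩ := F.mem_degA.1 F.X_mul_X_mem
  have c1 : F.basis.coord 0 (1 : A) = 1 ∧ F.basis.coord 1 (1 : A) = 0 := by
    rw [← F.basis_zero]; simp
  have cX : F.basis.coord 0 (F.basis 1) = 0 ∧ F.basis.coord 1 (F.basis 1) = 1 := by simp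
  have e : ∀ l, F.basis.coord l (a * b) = F.basis.coord 0 a * F.basis.coord 0 b *
      F.basis.coord l 1 + (F.basis.coord 0 a * F.basis.coord 1 b +
        F.basis.coord 1 a * F.basis.coord 0 b) * F.basis.coord l (F.basis 1) +
      F.basis.coord 1 a * F.basis.coord 1 b * F.basis.coord l (F.basis 1 * F.basis 1) := by
    intro l
    conv_lhs => rw [F.eq_coord a, F.eq_coord b]
    simp only [add_mul, mul_add, smul_mul_assoc, mul_smul_comm, one_mul, mul_one, map_add,
      map_smul, smul_eq_mul]
    ring
  have cast : ∀ {k l : ℤ} {r : R}, r ∈ F.deg k → k = l → r ∈ F.deg l := by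
    rintro k l r h rfl; exact h
  rw [mem_degA, e, e, c1.1, c1.2, cX.1, cX.2]
  simp only [mul_one, mul_zero, add_zero, zero_add]
  refine ⟨add_mem (F.mul_mem_deg a0 b0) ?_, add_mem (add_mem ?_ ?_) ?_⟩
  · exact cast (F.mul_mem_deg (F.mul_mem_deg a1 b1) p) (by ring)
  · exact cast (F.mul_mem_deg a0 b1) (by ring)
  · exact cast (F.mul_mem_deg a1 b0) (by ring)
  · exact cast (F.mul_mem_deg (F.mul_mem_deg a1 b1) q) (by ring)

theorem stateDeg_cast {k l : ℤ} {x : StateSpace R A D v} (h : x ∈ F.stateDeg v k) (e : k = l) :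
    x ∈ F.stateDeg v l := e ▸ h

theorem mul_mem_stateDeg {i j : ℤ} {x y : StateSpace R A D v}
    (hx : x ∈ F.stateDeg v (i + Fintype.card (D.Comp v)))
    (hy : y ∈ F.stateDeg v (j + Fintype.card (D.Comp v))) :
    x * y ∈ F.stateDeg v (i + j + Fintype.card (D.Comp v)) := by
  induction hx using AddSubgroup.closure_induction with
  | mem x hx =>
    induction hy using AddSubgroup.closure_induction with
    | mem y hy =>
      obtain ⟨a, m, ha, hm, rfl⟩ := hx
      obtain ⟨b, n, hb, hn, rfl⟩ := hy
      rw [pure_mul_pure]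
      refine AddSubgroup.subset_closure ⟨_, fun k => m k + n k,
        fun k => F.mul_mem_degA (ha k) (hb k), ?_, rfl⟩
      simp only [Finset.sum_add_distrib, Finset.sum_const, Finset.card_univ, nsmul_eq_mul,
        mul_one] at hm hn ⊢
      linarith
    | zero => rw [mul_zero]; exact zero_mem _
    | add x y _ _ hx hy => rw [mul_add]; exact add_mem hx hy
    | neg x _ hx => rw [mul_neg]; exact neg_mem hx
  | zero => rw [zero_mul]; exact zero_mem _
  | add x y _ _ hx hy => rw [add_mul]; exact add_mem hx hy
  | neg x _ hx => rw [neg_mul]; exact neg_mem hx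

theorem label_mem_stateDeg {k : D.Comp v} {m : ℤ} {a : A} (ha : a ∈ F.degA m) :
    label R A k a ∈ F.stateDeg v (m + Fintype.card (D.Comp v)) := by
  rw [label_apply]
  refine AddSubgroup.subset_closure ⟨_, Pi.single k m, fun j => ?_, ?_, rfl⟩
  · by_cases h : j = k
    · subst h; simpa using ha
    · rw [Pi.mulSingle_eq_of_ne h, Pi.single_eq_of_ne h]; exact F.one_mem_degA
  · simp [Finset.sum_add_distrib]

theorem one_mem_stateDeg : (1 : StateSpace R A D v) ∈ F.stateDeg v (Fintype.card (D.Comp v)) := by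
  have := F.label_mem_stateDeg (k := D.strand v) F.one_mem_degA
  rwa [map_one, zero_add] at this

theorem pairLabel_mem_stateDeg {k k' : D.Comp v} {m : ℤ} {z : A ⊗[R] A}
    (hz : z ∈ tensorDeg F.degA F.degA m) :
    pairLabel k k' z ∈ F.stateDeg v (m + Fintype.card (D.Comp v)) := by
  induction hz using AddSubgroup.closure_induction with
  | mem z hz =>
    obtain ⟨i, j, a, ha, b, hb, rfl, rfl⟩ := hz
    rw [pairLabel, Algebra.TensorProduct.lift_tmul]
    exact F.mul_mem_stateDeg (F.label_mem_stateDeg ha) (F.label_mem_stateDeg hb)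
  | zero => rw [map_zero]; exact zero_mem _
  | add x y _ _ hx hy => rw [map_add]; exact add_mem hx hy
  | neg x _ hx => rw [map_neg]; exact neg_mem hx

theorem prod_mem_stateDeg {ι : Type*} (s : Finset ι) (f : ι → StateSpace R A D v) (m : ι → ℤ)
    (h : ∀ i ∈ s, f i ∈ F.stateDeg v (m i + Fintype.card (D.Comp v))) :
    ∏ i ∈ s, f i ∈ F.stateDeg v (∑ i ∈ s, m i + Fintype.card (D.Comp v)) := by
  classical
  induction s using Finset.induction_on with
  | empty => simpa using F.one_mem_stateDeg
  | insert i s hi ih =>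
    rw [Finset.prod_insert hi, Finset.sum_insert hi]
    exact F.mul_mem_stateDeg (h i (Finset.mem_insert_self i s))
      (ih fun j hj => h j (Finset.mem_insert_of_mem hj))

theorem saddle_mem_stateDeg (hc : c ∉ v) (hw : w = insert c v) {k : ℤ} {x : StateSpace R A D v}
    (hx : x ∈ F.stateDeg v k) : F.saddle v w c x ∈ F.stateDeg w (k - 1) := by
  classical
  subst hw
  have hcard := card_insert_comp hc
  induction hx using AddSubgroup.closure_induction with
  | mem x hx =>
    obtain ⟨a, m, ha, hm, rfl⟩ := hx
    rw [saddle_pure]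
    have h := F.prod_mem_stateDeg Finset.univ (fun k => F.leg v (insert c v) c k (a k))
      (fun k => m k - if D.Splits v c ∧ k = D.comp v (D.corner c 0) then 2 else 0) (by
        intro k _
        unfold leg
        by_cases hk : D.Splits v c ∧ k = D.comp v (D.corner c 0)
        · rw [if_pos hk, if_pos hk]
          exact F.pairLabel_mem_stateDeg (F.comul_mem (ha k))
        · rw [if_neg hk, if_neg hk, sub_zero]
          exact F.label_mem_stateDeg (ha k))
    refine F.stateDeg_cast h ?_
    rw [Finset.sum_add_distrib, Finset.sum_const, Finset.card_univ, nsmul_eq_mul, mul_one] at hm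
    rw [Finset.sum_sub_distrib]
    by_cases hs : D.Splits v c
    · simp only [hs, true_and, if_true, Finset.sum_ite_eq', Finset.mem_univ] at hcard ⊢
      linarith
    · simp only [hs, false_and, if_false, Finset.sum_const_zero] at hcard ⊢
      linarith
  | zero => rw [map_zero]; exact zero_mem _
  | add x y _ _ hx hy => rw [map_add]; exact add_mem hx hy
  | neg x _ hx => rw [map_neg]; exact neg_mem hx

theorem saddle_smul (hc : c ∉ v) (hw : w = insert c v) (a : A) (x : StateSpace R A D v) :
    F.saddle v w c (a • x) = a • F.saddle v w c x :=
  (F.saddle_isLocal hc hw).1 _ a x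

end FrobeniusSystem

variable (R A D)

/-- The chain module in homological degree `i`: the sum over all states with `i + n₋` many
`1`-smoothings. -/
abbrev ChainGroup (i : ℤ) : Type _ :=
  ∀ v : {v : Finset (Fin D.n) // (v.card : ℤ) = i + D.nNeg}, StateSpace R A D v.1

variable {R A D}

/-- The sign of the edge of the cube into the state `w` that changes the crossing `c`. -/
def edgeSign {n : ℕ} (w : Finset (Fin n)) (c : Fin n) : ℤ := (-1) ^ (w.filter (· < c)).card

theorem card_erase_state {i : ℤ} {w : Finset (Fin D.n)} (hw : (w.card : ℤ) = i + 1 + D.nNeg)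
    {c : Fin D.n} (hc : c ∈ w) : ((w.erase c).card : ℤ) = i + D.nNeg := by
  have := Finset.card_erase_add_one hc
  omega

namespace FrobeniusSystem

variable (F : FrobeniusSystem R A)

variable (D) in
/-- The differential of the cube of resolutions. -/
noncomputable def chainD (i : ℤ) : ChainGroup R A D i →ₗ[A] ChainGroup R A D (i + 1) where
  toFun x w := ∑ c : {c // c ∈ w.1}, edgeSign w.1 c.1 •
    F.saddle (w.1.erase c.1) w.1 c.1 (x ⟨w.1.erase c.1, card_erase_state w.2 c.2⟩)
  map_add' x y := by
    funext w
    simp only [Pi.add_apply, map_add, smul_add, Finset.sum_add_distrib]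
  map_smul' a x := by
    funext w
    simp only [Pi.smul_apply, RingHom.id_apply, Finset.smul_sum]
    refine Finset.sum_congr rfl fun c _ => ?_
    rw [F.saddle_smul (Finset.notMem_erase _ _) (Finset.insert_erase c.2).symm, smul_comm]

/-- Extension by zero to all states. -/
noncomputable def extendZero {i : ℤ} (x : ChainGroup R A D i) (v : Finset (Fin D.n)) :
    StateSpace R A D v := if h : (v.card : ℤ) = i + D.nNeg then x ⟨v, h⟩ else 0

theorem chainD_apply {i : ℤ} (x : ChainGroup R A D i) (w) :
    F.chainD D i x w = ∑ c ∈ w.1, edgeSign w.1 c •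
      F.saddle (w.1.erase c) w.1 c (extendZero x (w.1.erase c)) := by
  rw [← Finset.sum_coe_sort]
  refine Finset.sum_congr rfl fun c _ => ?_
  rw [extendZero, dif_pos (card_erase_state w.2 c.2)]

theorem edgeSign_anti {n : ℕ} {w : Finset (Fin n)} {c c' : Fin n} (hc : c ∈ w)
    (h : c < c') : edgeSign w c * edgeSign (w.erase c) c' =
      - (edgeSign w c' * edgeSign (w.erase c') c) := by
  have h1 : (w.erase c').filter (· < c) = w.filter (· < c) := by
    ext e; simp only [Finset.mem_filter, Finset.mem_erase]
    constructor
    · rintro ⟨⟨-, a⟩, b⟩; exact ⟨a, b⟩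
    · rintro ⟨a, b⟩; exact ⟨⟨(b.trans h).ne, a⟩, b⟩
  have h2 : ((w.erase c).filter (· < c')).card + 1 = (w.filter (· < c')).card := by
    rw [Finset.filter_erase]
    exact Finset.card_erase_add_one (by simp [hc, h])
  rw [edgeSign, edgeSign, edgeSign, edgeSign, h1, ← h2, pow_succ]
  ring

theorem chainD_comp_chainD (i : ℤ) : F.chainD D (i + 1) ∘ₗ F.chainD D i = 0 := by
  refine LinearMap.ext fun x => funext fun w => ?_
  obtain ⟨w, hw⟩ := w
  rw [LinearMap.comp_apply, chainD_apply]
  let t : Fin D.n → Fin D.n → StateSpace R A D w := fun c c' =>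
    (edgeSign w c * edgeSign (w.erase c) c') • F.saddle (w.erase c) w c
      (F.saddle ((w.erase c).erase c') (w.erase c) c' (extendZero x ((w.erase c).erase c')))
  have h1 : ∑ c ∈ w, edgeSign w c •
      F.saddle (w.erase c) w c (extendZero (F.chainD D i x) (w.erase c)) =
      ∑ p ∈ w.sigma (fun c => w.erase c), t p.1 p.2 := by
    rw [Finset.sum_sigma]
    refine Finset.sum_congr rfl fun c hc => ?_
    rw [extendZero, dif_pos (card_erase_state hw hc), chainD_apply, map_sum, Finset.smul_sum]
    refine Finset.sum_congr rfl fun c' _ => ?_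
    rw [map_zsmul, smul_smul]
  have hcomm : ∀ c ∈ w, ∀ c' ∈ w, c < c' → t c c' + t c' c = 0 := by
    intro c hc c' hc' hlt
    have key : ∀ u u1 u2 : Finset (Fin D.n), c ∉ u → c' ∉ u → u1 = insert c' u → u2 = insert c u →
        w = insert c' u2 → ∀ y, F.saddle u1 w c (F.saddle u u1 c' y) =
          F.saddle u2 w c' (F.saddle u u2 c y) := by
      rintro u _ _ k1 k2 rfl rfl rfl y
      exact (LinearMap.congr_fun (F.saddle_comm k1 k2 hlt.ne) y).symm
    have hu : (w.erase c).erase c' = (w.erase c').erase c := Finset.erase_right_comm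
    have e1 : w.erase c = insert c' ((w.erase c').erase c) := by
      rw [← hu, Finset.insert_erase (by simp [hc', hlt.ne'])]
    have e2 : w.erase c' = insert c ((w.erase c').erase c) := by
      rw [Finset.insert_erase (by simp [hc, hlt.ne])]
    have e3 : F.saddle (w.erase c) w c (F.saddle ((w.erase c).erase c') (w.erase c) c'
        (extendZero x ((w.erase c).erase c'))) = F.saddle (w.erase c') w c'
        (F.saddle ((w.erase c').erase c) (w.erase c') c
          (extendZero x ((w.erase c').erase c))) := by
      rw [hu]
      exact key _ _ _ (by simp) (by simp) e1 e2 (Finset.insert_erase hc').symm _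
    simp only [t]
    rw [e3, edgeSign_anti hc hlt, neg_smul, neg_add_cancel]
  change ∑ c ∈ w, edgeSign w c •
      F.saddle (w.erase c) w c (extendZero (F.chainD D i x) (w.erase c)) = 0
  rw [h1]
  refine Finset.sum_involution (fun p _ => ⟨p.2, p.1⟩) ?_ ?_ ?_ ?_
  · rintro ⟨c, c'⟩ hp
    simp only [Finset.mem_sigma, Finset.mem_erase] at hp
    rcases lt_or_gt_of_ne hp.2.1 with h | h
    · rw [add_comm]; exact hcomm _ hp.2.2 _ hp.1 h
    · exact hcomm _ hp.1 _ hp.2.2 h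
  · rintro ⟨c, c'⟩ hp _ heq
    simp only [Finset.mem_sigma, Finset.mem_erase] at hp
    simp only [Sigma.mk.injEq, heq_eq_eq] at heq
    exact hp.2.1 heq.1
  · rintro ⟨c, c'⟩ hp
    simp only [Finset.mem_sigma, Finset.mem_erase] at hp ⊢
    exact ⟨hp.2.2, fun h => hp.2.1 h.symm, hp.1⟩
  · rintro ⟨c, c'⟩ _; rfl

variable (D) in
/-- The (unreduced) complex `C_F(D)` of `A`-modules. The state `v` contributes the tensor product
of one copy of `A{1}` for each component of the smoothed diagram, in homological degree `|v| - n₋`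
and with quantum degree shifted by `|v| + n₊ - 2 n₋`. -/
noncomputable def complex : QComplex A where
  X := ChainGroup R A D
  d := F.chainD D
  d_comp_d := F.chainD_comp_chainD
  deg i k := AddSubgroup.pi Set.univ fun v =>
    F.stateDeg v.1 (k - (v.1.card + D.nPos - 2 * D.nNeg))
  d_mem i k x hx := by
    rw [AddSubgroup.mem_pi] at hx ⊢
    rintro ⟨w, hw⟩ -
    refine sum_mem fun c _ => zsmul_mem ?_ _
    have h1 := hx ⟨w.erase c.1, card_erase_state hw c.2⟩ (Set.mem_univ _)
    have h2 := F.saddle_mem_stateDeg (Finset.notMem_erase c.1 w) (Finset.insert_erase c.2).symm h1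
    refine F.stateDeg_cast h2 ?_
    have h3 := Finset.card_erase_add_one c.2
    simp only
    rw [← h3]
    push_cast
    ring

/-! ### The action of `ℤ[G]` -/

/-- The value of the TQFT on the curtain of genus one: the special strand splits off a circle and
merges with it again. -/
noncomputable def curtain : A →ₗ[R] A := LinearMap.mul' R A ∘ₗ F.comul

/-- The curtain acts as multiplication by an element of `A`. -/
theorem curtain_apply (a : A) : F.curtain a = F.curtain 1 * a := by
  have h := F.comul_mul_left 1 a
  rw [one_mul] at h
  rw [curtain, LinearMap.comp_apply, h, LinearMap.comp_apply]
  generalize F.comul 1 = z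
  induction z using TensorProduct.induction_on with
  | zero => simp
  | tmul x y => simp; ring
  | add x y hx hy => rw [mul_add, map_add, hx, hy, map_add, add_mul]

/-- The ring homomorphism `ℤ[G] → A` through which `A` becomes a `ℤ[G]`-module on which `G` acts
as the curtain of genus one. -/
noncomputable def curtainHom : Polynomial ℤ →+* A := (Polynomial.aeval (F.curtain 1)).toRingHom

theorem curtainHom_X_mul (a : A) : F.curtainHom Polynomial.X * a = F.curtain a := by
  rw [curtain_apply]
  congr 1
  exact Polynomial.aeval_X _

end FrobeniusSystem

end cube

/-! ### The universal system and the system over `ℤ[G]` -/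

section quadratic

variable {R : Type*} [CommRing R] (h t : R)

local notation "X₀" => (QuadraticAlgebra.omega : QuadraticAlgebra R t h)

/-- `Δ(1) = 1 ⊗ X + X ⊗ 1 - h 1 ⊗ 1` and `Δ(X) = X ⊗ X + t 1 ⊗ 1`. -/
noncomputable def quadraticComul :
    QuadraticAlgebra R t h →ₗ[R] QuadraticAlgebra R t h ⊗[R] QuadraticAlgebra R t h :=
  (QuadraticAlgebra.reₗ t h).smulRight (1 ⊗ₜ X₀ + X₀ ⊗ₜ 1 - h • (1 ⊗ₜ 1)) +
    (QuadraticAlgebra.imₗ t h).smulRight (X₀ ⊗ₜ X₀ + t • (1 ⊗ₜ 1))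

theorem quadraticComul_one : quadraticComul h t 1 = 1 ⊗ₜ X₀ + X₀ ⊗ₜ 1 - h • (1 ⊗ₜ 1) := by
  simp [quadraticComul, QuadraticAlgebra.re_one, QuadraticAlgebra.im_one]

theorem quadraticComul_omega : quadraticComul h t X₀ = X₀ ⊗ₜ X₀ + t • (1 ⊗ₜ 1) := by
  simp [quadraticComul]

theorem basis_quadratic : QuadraticAlgebra.basis t h 0 = 1 ∧ QuadraticAlgebra.basis t h 1 = X₀ := by
  constructor <;> apply (QuadraticAlgebra.basis t h).repr.injective <;> ext i <;> fin_cases i <;>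
    simp [QuadraticAlgebra.re_one, QuadraticAlgebra.im_one]

theorem quadratic_hom_ext {M : Type*} [AddCommGroup M] [Module R M]
    {f g : QuadraticAlgebra R t h →ₗ[R] M} (h1 : f 1 = g 1) (hX : f X₀ = g X₀) : f = g := by
  refine (QuadraticAlgebra.basis t h).ext fun i => ?_
  fin_cases i
  · change f (QuadraticAlgebra.basis t h 0) = g (QuadraticAlgebra.basis t h 0)
    rw [(basis_quadratic h t).1, h1]
  · change f (QuadraticAlgebra.basis t h 1) = g (QuadraticAlgebra.basis t h 1)
    rw [(basis_quadratic h t).2, hX]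

theorem quadratic_tensor_hom_ext {M : Type*} [AddCommGroup M] [Module R M]
    {f g : QuadraticAlgebra R t h ⊗[R] QuadraticAlgebra R t h →ₗ[R] M}
    (h1 : f (1 ⊗ₜ 1) = g (1 ⊗ₜ 1)) (h2 : f (1 ⊗ₜ X₀) = g (1 ⊗ₜ X₀))
    (h3 : f (X₀ ⊗ₜ 1) = g (X₀ ⊗ₜ 1)) (h4 : f (X₀ ⊗ₜ X₀) = g (X₀ ⊗ₜ X₀)) : f = g :=
  TensorProduct.ext (quadratic_hom_ext h t (quadratic_hom_ext h t h1 h2)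
    (quadratic_hom_ext h t h3 h4))

variable (deg : ℤ → AddSubgroup R)

theorem mem_freeDeg_quadratic {k : ℤ} {a : QuadraticAlgebra R t h} :
    a ∈ freeDeg (QuadraticAlgebra.basis t h) deg k ↔ a.re ∈ deg k ∧ a.im ∈ deg (k + 2) := Iff.rfl

/-- The Frobenius system with `A = R[X]/(X² - hX - t)`, `ε(1) = 0`, `ε(X) = 1`,
`Δ(1) = 1 ⊗ X + X ⊗ 1 - h 1 ⊗ 1` and `Δ(X) = X ⊗ X + t 1 ⊗ 1`. -/
noncomputable def quadratic (one_mem : (1 : R) ∈ deg 0)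
    (mul_mem : ∀ {i j : ℤ} {r s : R}, r ∈ deg i → s ∈ deg j → r * s ∈ deg (i + j))
    (hh : h ∈ deg (-2)) (ht : t ∈ deg (-4)) : FrobeniusSystem R (QuadraticAlgebra R t h) where
  comul := quadraticComul h t
  counit := QuadraticAlgebra.imₗ t h
  coassoc := by
    apply quadratic_hom_ext <;>
    simp only [LinearMap.comp_apply, quadraticComul_one, quadraticComul_omega, map_add, map_sub,
      map_smul, LinearMap.rTensor_tmul, LinearMap.lTensor_tmul, TensorProduct.add_tmul,
      TensorProduct.tmul_add, TensorProduct.sub_tmul, TensorProduct.tmul_sub,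
      ← TensorProduct.smul_tmul', TensorProduct.tmul_smul, LinearEquiv.coe_coe,
      TensorProduct.assoc_tmul] <;> module
  rTensor_counit_comp_comul := by
    apply quadratic_hom_ext <;>
      simp [quadraticComul_one, quadraticComul_omega, QuadraticAlgebra.im_one]
  lTensor_counit_comp_comul := by
    apply quadratic_hom_ext <;>
      simp [quadraticComul_one, quadraticComul_omega, QuadraticAlgebra.im_one]
  comm_comp_comul := by
    apply quadratic_hom_ext <;> simp [quadraticComul_one, quadraticComul_omega, add_comm]
  frobenius := by
    apply quadratic_tensor_hom_ext <;>
    simp only [LinearMap.mul'_apply,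
      LinearMap.comp_apply, one_mul, mul_one, QuadraticAlgebra.omega_mul_omega_eq_add,
      quadraticComul_one, quadraticComul_omega, map_add, map_sub,
      map_smul, LinearMap.rTensor_tmul, LinearMap.lTensor_tmul, TensorProduct.add_tmul,
      TensorProduct.tmul_add, TensorProduct.sub_tmul,
      ← TensorProduct.smul_tmul', TensorProduct.tmul_smul, LinearEquiv.coe_coe,
      TensorProduct.assoc_tmul] <;> module
  basis := QuadraticAlgebra.basis t h
  basis_zero := (basis_quadratic h t).1
  deg := deg
  one_mem_deg := one_mem
  mul_mem_deg := mul_mem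
  X_mul_X_mem := by
    rw [(basis_quadratic h t).2, mem_freeDeg_quadratic]
    simpa using ⟨ht, hh⟩
  counit_mem ha := ha.2
  comul_mem {k a} ha := by
    obtain ⟨h0, h1⟩ := ha
    change a.re ∈ deg k at h0
    change a.im ∈ deg (k + 2) at h1
    have m0 : ∀ {l : ℤ} {r : R}, r ∈ deg l →
        r • (1 : QuadraticAlgebra R t h) ∈ freeDeg (QuadraticAlgebra.basis t h) deg l := by
      intro l r hr
      rw [mem_freeDeg_quadratic]
      simpa [QuadraticAlgebra.re_one, QuadraticAlgebra.im_one] using hr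
    have m1 : ∀ {l : ℤ} {r : R}, r ∈ deg (l + 2) →
        r • X₀ ∈ freeDeg (QuadraticAlgebra.basis t h) deg l := by
      intro l r hr
      rw [mem_freeDeg_quadratic]
      simpa using hr
    have cast : ∀ {i j : ℤ} {r : R}, r ∈ deg i → i = j → r ∈ deg j := by
      rintro i j r hr rfl; exact hr
    have n0 : (1 : QuadraticAlgebra R t h) ∈ freeDeg (QuadraticAlgebra.basis t h) deg 0 := by
      simpa using m0 one_mem
    have n1 : X₀ ∈ freeDeg (QuadraticAlgebra.basis t h) deg (-2) := by
      simpa using m1 (l := -2) (cast one_mem (by norm_num))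
    have e : quadraticComul h t a = (a.re • 1) ⊗ₜ X₀ + (a.re • X₀) ⊗ₜ 1 -
        ((a.re * h) • 1) ⊗ₜ 1 + ((a.im • X₀) ⊗ₜ X₀ + ((a.im * t) • 1) ⊗ₜ 1) := by
      simp only [quadraticComul, LinearMap.add_apply, LinearMap.smulRight_apply,
        QuadraticAlgebra.reₗ_apply, QuadraticAlgebra.imₗ_apply, ← TensorProduct.smul_tmul']
      module
    rw [e]
    refine add_mem (sub_mem (add_mem ?_ ?_) ?_) (add_mem ?_ ?_)
    · exact AddSubgroup.subset_closure ⟨k, -2, _, m0 h0, _, n1, by ring, rfl⟩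
    · exact AddSubgroup.subset_closure
        ⟨k - 2, 0, _, m1 (cast h0 (by ring)), _, n0, by ring, rfl⟩
    · exact AddSubgroup.subset_closure
        ⟨k - 2, 0, _, m0 (cast (mul_mem h0 hh) (by ring)), _, n0, by ring, rfl⟩
    · exact AddSubgroup.subset_closure ⟨k, -2, _, m1 h1, _, n1, by ring, rfl⟩
    · exact AddSubgroup.subset_closure
        ⟨k - 2, 0, _, m0 (cast (mul_mem h1 ht) (by ring)), _, n0, by ring, rfl⟩

end quadratic

/-- `R_univ = ℤ[h, t]`. -/
abbrev RUniv : Type := MvPolynomial (Fin 2) ℤ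

/-- The variable `h` of `ℤ[h, t]`. -/
noncomputable abbrev hUniv : RUniv := MvPolynomial.X 0

/-- The variable `t` of `ℤ[h, t]`. -/
noncomputable abbrev tUniv : RUniv := MvPolynomial.X 1

/-- `A_univ = ℤ[h, t][X]/(X² - hX - t)`. -/
abbrev AUniv : Type := QuadraticAlgebra RUniv tUniv hUniv

/-- The grading of `ℤ[h, t]` with `deg h = -2` and `deg t = -4`. -/
noncomputable def degUniv (k : ℤ) : AddSubgroup RUniv :=
  (MvPolynomial.weightedHomogeneousSubmodule ℤ ![(-2 : ℤ), -4] k).toAddSubgroup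

/-- The universal Frobenius system. -/
noncomputable def univ : FrobeniusSystem RUniv AUniv :=
  quadratic hUniv tUniv degUniv (MvPolynomial.isWeightedHomogeneous_one _ _)
    (fun hr hs => MvPolynomial.IsWeightedHomogeneous.mul hr hs)
    (MvPolynomial.isWeightedHomogeneous_X _ _ _) (MvPolynomial.isWeightedHomogeneous_X _ _ _)

/-- The grading of `ℤ[G]` with `deg G = -2`. -/
def degZG (k : ℤ) : AddSubgroup (Polynomial ℤ) where
  carrier := {p | ∀ n, p.coeff n ≠ 0 → k = -2 * n}
  zero_mem' := by simp
  add_mem' := by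
    intro p q hp hq n hn
    by_contra hk
    apply hn
    rw [Polynomial.coeff_add, not_not.1 (mt (hp n) hk), not_not.1 (mt (hq n) hk), add_zero]
  neg_mem' := by
    intro p hp n hn
    exact hp n (by simpa using hn)

theorem one_mem_degZG : (1 : Polynomial ℤ) ∈ degZG 0 := by
  intro n hn
  rw [Polynomial.coeff_one] at hn
  simp_all

theorem X_mem_degZG : (Polynomial.X : Polynomial ℤ) ∈ degZG (-2) := by
  intro n hn
  rw [Polynomial.coeff_X] at hn
  simp only [ne_eq, ite_eq_right_iff, one_ne_zero, imp_false, not_not] at hn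
  subst hn; norm_num

theorem mul_mem_degZG {i j : ℤ} {p q : Polynomial ℤ} (hp : p ∈ degZG i) (hq : q ∈ degZG j) :
    p * q ∈ degZG (i + j) := by
  intro n hn
  rw [Polynomial.coeff_mul] at hn
  obtain ⟨⟨a, b⟩, hab, hne⟩ := Finset.exists_ne_zero_of_sum_ne_zero hn
  rw [hp a (left_ne_zero_of_mul hne), hq b (right_ne_zero_of_mul hne),
    ← (Finset.HasAntidiagonal.mem_antidiagonal.1 hab : a + b = n)]
  push_cast; ring

/-- `A_{ℤ[G]} = ℤ[G][X]/(X² + GX)`. -/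
abbrev AZG : Type := QuadraticAlgebra (Polynomial ℤ) 0 (-Polynomial.X)

/-- The Frobenius system over `ℤ[G]` with `Δ(1) = 1 ⊗ X + X ⊗ 1 + G 1 ⊗ 1`, `Δ(X) = X ⊗ X`. -/
noncomputable def zg : FrobeniusSystem (Polynomial ℤ) AZG :=
  quadratic (-Polynomial.X) 0 degZG one_mem_degZG mul_mem_degZG (neg_mem X_mem_degZG)
    (zero_mem _)

/-- The quotient map `A_{ℤ[G]} → A_{ℤ[G]}/(X) = ℤ[G]`. -/
noncomputable def reduceHom : AZG →+* Polynomial ℤ where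
  toFun := QuadraticAlgebra.re
  map_one' := rfl
  map_zero' := rfl
  map_add' _ _ := rfl
  map_mul' a b := by simp

theorem reduceHom_surjective : Function.Surjective reduceHom := fun p => ⟨⟨p, 0⟩, rfl⟩

theorem ker_reduceHom : RingHom.ker reduceHom = Ideal.span {(QuadraticAlgebra.omega : AZG)} := by
  ext a
  rw [RingHom.mem_ker, Ideal.mem_span_singleton]
  constructor
  · intro h
    refine ⟨algebraMap _ _ a.im, ?_⟩
    have h' : a.re = 0 := h
    ext <;> simp [h']
  · rintro ⟨b, rfl⟩
    change (QuadraticAlgebra.omega * b : AZG).re = 0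
    simp

/-- The `ℤ[G]`-complex `⟦D⟧ = C_{ℤ[G]}(D) ⊗ A_{ℤ[G]}/(X){-1}`. -/
noncomputable def bracket (D : TangleDiagram) : QComplex (Polynomial ℤ) :=
  ((zg.complex D).baseChange reduceHom degZG).shift (-1)

/-- The ring homomorphism `ℤ[h, t] → ℤ[G]` with `h ↦ -G` and `t ↦ 0`. -/
noncomputable def baseHom : RUniv →+* Polynomial ℤ :=
  (MvPolynomial.aeval ![-Polynomial.X, 0]).toRingHom

/-- The ring homomorphism `A_univ → ℤ[G]` with `X ↦ 0`, `h ↦ -G` and `t ↦ 0`. -/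
noncomputable def univToZG : AUniv →+* Polynomial ℤ where
  toFun a := baseHom a.re
  map_one' := map_one baseHom
  map_zero' := map_zero baseHom
  map_add' a b := map_add baseHom _ _
  map_mul' a b := by
    simp [baseHom]

end Khovanov

/-!
Every rank-two Frobenius system is a twist of the standard one: if `X² = hX + t`, then
`Δ(1) = (u ⊗ 1) (1 ⊗ X + X ⊗ 1 - h 1 ⊗ 1)` for a unit `u` of `A` of degree `0`
(`comul_one`, `twist_mul_twistInv`), and so the curtain of genus one is multiplication by
`G = u (2X - h)`.

*Delooping.* Let `s` be the special strand of a state and put `Y_k = u_s (X_k - X_s)` for a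
component `k`. Then `Y_s = 0` and `Y_k² = -G_s Y_k`, which is the relation of the generator in
`A_{ℤ[G]}` modulo the generator of the strand. Hence `X_k ↦ Y_k` defines a ring homomorphism from
the state space over `ℤ[G]` to the one of `F`, and after extension of scalars to `A` it becomes an
isomorphism (`deloopEquiv`), because `X_k = X_s + u_s⁻¹ Y_k`. It commutes with merges; at a split it
sends `X_k + X_l + G` to `u_s (X_k + X_l - h)`, whereas the comultiplication of `F` gives
`u_k (X_k + X_l - h)`.

*Correction of the twist.* The discrepancy is removed by multiplying the delooping map at each state
by a product of powers `(u_k / u_s) ^ e(k)`, where `k` runs over the components. This gives a map of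
complexes if the exponents are additive under merges and satisfy `e(k) + e(l) = e(j) + 1` if `j`
splits into `k` and `l`. Such exponents exist by planarity. Choose a checkerboard coloring of the
faces, and let `ε(k)` be the color (`0` or `1`) on the inner side of the circle `k`. Two disjoint
circles cannot lie inside each other (`not_inside_each_other`), and therefore
`ε(j) + [color at the crossing] = ε(k) + ε(l)` whenever `j` is obtained from `k` and `l` by a change
of smoothing (`innerColor_merge`). The contribution of the color is compensated by counting
`1`-smoothed crossings of one of the two types (`weight`, `sum_weight_of_not_splits`,
`sum_weight_of_splits`).

Since `u` and `u⁻¹` have degree `0`, all these maps and their inverses preserve degrees. This proves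
the first part. For the universal system `u = 1`, so `G = 2X - h`, which is the second part. The third
part follows from the first one: `G ↦ 2X - h ↦ G` under `ℤ[G] → A_univ → ℤ[G]`, so a further
base change of `C_univ(D)`, written as a base change of `⟦D⟧`, gives back `⟦D⟧`.
-/

namespace Khovanov

open TangleDiagram

/-! ### Base change of graded complexes -/

/-- The elements of `S ⊗ N` of degree `k` are sent to degree `k` by an additive map that does so on
the generators `m ⊗ n`. -/
theorem map_mem_of_mem_tensorDeg {S M N P : Type*} [CommRing S] [AddCommGroup M] [Module S M]
    [AddCommGroup N] [Module S N] [AddCommGroup P] {p : ℤ → AddSubgroup M} {q : ℤ → AddSubgroup N}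
    {k : ℤ} (f : M ⊗[S] N →+ P) (T : AddSubgroup P)
    (h : ∀ i j : ℤ, i + j = k → ∀ m ∈ p i, ∀ n ∈ q j, f (m ⊗ₜ n) ∈ T)
    {z : M ⊗[S] N} (hz : z ∈ tensorDeg p q k) : f z ∈ T := by
  induction hz using AddSubgroup.closure_induction with
  | mem z hz =>
    obtain ⟨i, j, m, hm, n, hn, hij, rfl⟩ := hz
    exact h i j hij m hm n hn
  | zero => rw [map_zero]; exact zero_mem _
  | add x y _ _ hx hy => rw [map_add]; exact add_mem hx hy
  | neg x _ hx => rw [map_neg]; exact neg_mem hx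

theorem tmul_mem_tensorDeg {S M N : Type*} [CommRing S] [AddCommGroup M] [Module S M]
    [AddCommGroup N] [Module S N] {p : ℤ → AddSubgroup M} {q : ℤ → AddSubgroup N}
    {i j k : ℤ} {m : M} {n : N} (hm : m ∈ p i) (hn : n ∈ q j) (h : i + j = k) :
    m ⊗ₜ[S] n ∈ tensorDeg p q k :=
  AddSubgroup.subset_closure ⟨i, j, m, hm, n, hn, h, rfl⟩

theorem addHom_eq_of_tmul {S M N P : Type*} [CommRing S] [AddCommGroup M] [Module S M]
    [AddCommGroup N] [Module S N] [AddCommGroup P] {f g : M ⊗[S] N →+ P}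
    (h : ∀ m n, f (m ⊗ₜ n) = g (m ⊗ₜ n)) (z : M ⊗[S] N) : f z = g z := by
  induction z using TensorProduct.induction_on with
  | zero => rw [map_zero, map_zero]
  | add x y hx hy => rw [map_add, map_add, hx, hy]
  | tmul m n => exact h m n

theorem mem_deg_cast {M : Type*} [AddCommGroup M] {p : ℤ → AddSubgroup M} {i j : ℤ} {m : M}
    (hm : m ∈ p i) (h : i = j) : m ∈ p j := h ▸ hm

theorem tensorDeg_shift {S M N : Type*} [CommRing S] [AddCommGroup M] [Module S M]
    [AddCommGroup N] [Module S N] (p : ℤ → AddSubgroup M) (q : ℤ → AddSubgroup N) (k m : ℤ) :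
    tensorDeg (S := S) p (fun l => q (l - m)) k = tensorDeg p q (k - m) := by
  apply le_antisymm <;>
    refine fun x hx => map_mem_of_mem_tensorDeg (AddMonoidHom.id _) _ (fun a b hab s hs y hy => ?_) hx
  · exact tmul_mem_tensorDeg (j := b - m) hs hy (by omega)
  · exact tmul_mem_tensorDeg (j := b + m) hs (mem_deg_cast hy (by ring)) (by omega)

/-- `q` is a grading or filtration of the ring `S`. -/
structure IsMulDeg {S : Type*} [CommRing S] (q : ℤ → AddSubgroup S) : Prop where
  one_mem : (1 : S) ∈ q 0
  mul_mem : ∀ {i j : ℤ} {r s : S}, r ∈ q i → s ∈ q j → r * s ∈ q (i + j)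

namespace QComplex

variable {S S' S'' : Type*} [CommRing S] [CommRing S'] [CommRing S'']

/-- The inverse of an isomorphism of complexes. -/
def Iso.symm {C D : QComplex S} (I : C.Iso D) : D.Iso C where
  e i := (I.e i).symm
  comm i x := by
    rw [LinearEquiv.symm_apply_eq, I.comm, LinearEquiv.apply_symm_apply]
  mem_deg_iff i k x := by
    rw [← I.mem_deg_iff, LinearEquiv.apply_symm_apply]

/-- The composition of isomorphisms of complexes. -/
def Iso.trans {C D E : QComplex S} (I : C.Iso D) (J : D.Iso E) : C.Iso E where
  e i := (I.e i).trans (J.e i)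
  comm i x := by simp only [LinearEquiv.trans_apply, I.comm, J.comm]
  mem_deg_iff i k x := by rw [LinearEquiv.trans_apply, J.mem_deg_iff, I.mem_deg_iff]

/-- An isomorphism of complexes shifts. -/
def Iso.shift {C D : QComplex S} (I : C.Iso D) (m : ℤ) : (C.shift m).Iso (D.shift m) where
  e := I.e
  comm := I.comm
  mem_deg_iff i k x := I.mem_deg_iff i (k - m) x

/-- Successive shifts by `m` and `m'` that cancel. -/
def Iso.shiftCancel (C : QComplex S) {m m' : ℤ} (h : m + m' = 0) :
    ((C.shift m).shift m').Iso C where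
  e i := LinearEquiv.refl S (C.X i)
  comm _ _ := rfl
  mem_deg_iff i k x := by
    change _ ↔ x ∈ C.deg i (k - m' - m)
    rw [show k - m' - m = k by omega]
    rfl

/-- A shift commutes with a base change. -/
noncomputable def Iso.baseChangeShift (C : QComplex S) (f : S →+* S') (q : ℤ → AddSubgroup S') (m : ℤ) :
    ((C.shift m).baseChange f q).Iso ((C.baseChange f q).shift m) where
  e i := LinearEquiv.refl S' ((C.baseChange f q).X i)
  comm _ _ := rfl
  mem_deg_iff i k x := by
    let _ := f.toAlgebra
    have h := tensorDeg_shift (S := S) q (C.deg i) k m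
    exact ⟨fun hx => h.ge hx, fun hx => h.le hx⟩

/-- An isomorphism of complexes induces one of the base changes. -/
noncomputable def Iso.baseChange {C D : QComplex S} (I : C.Iso D) (f : S →+* S')
    (q : ℤ → AddSubgroup S') : (C.baseChange f q).Iso (D.baseChange f q) :=
  letI := f.toAlgebra
  { e := fun i => (I.e i).baseChange S S' _ _
    comm := fun i x => by
      exact addHom_eq_of_tmul
        (f := ((I.e (i + 1)).toLinearMap.baseChange S' ∘ₗ (C.d i).baseChange S').toAddMonoidHom)
        (g := ((D.d i).baseChange S' ∘ₗ (I.e i).toLinearMap.baseChange S').toAddMonoidHom)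
        (fun s y => congrArg (s ⊗ₜ[S] ·) (I.comm i y)) x
    mem_deg_iff := fun i k x => by
      constructor
      · intro hx
        have h := map_mem_of_mem_tensorDeg
          ((I.e i).symm.baseChange S S' _ _).toLinearMap.toAddMonoidHom
          (tensorDeg q (C.deg i) k) (fun a b hab s hs y hy => tmul_mem_tensorDeg (n := (I.e i).symm y)
            hs ((I.mem_deg_iff i b _).1 (by rwa [LinearEquiv.apply_symm_apply])) hab) hx
        have e : ((I.e i).symm.baseChange S S' _ _) ((I.e i).baseChange S S' _ _ x) = x :=
          addHom_eq_of_tmul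
            (f := ((I.e i).symm.toLinearMap.baseChange S' ∘ₗ
              (I.e i).toLinearMap.baseChange S').toAddMonoidHom)
            (g := AddMonoidHom.id _)
            (fun s y => congrArg (s ⊗ₜ[S] ·) ((I.e i).symm_apply_apply y)) x
        rw [← e]
        exact h
      · exact fun hx => map_mem_of_mem_tensorDeg
          ((I.e i).baseChange S S' _ _).toLinearMap.toAddMonoidHom
          (tensorDeg q (D.deg i) k) (fun a b hab s hs y hy => tmul_mem_tensorDeg (n := (I.e i) y)
            hs ((I.mem_deg_iff i b _).2 hy) hab) hx }

/-- Two successive base changes are a base change along the composition. -/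
noncomputable def Iso.baseChangeComp (C : QComplex S) (f : S →+* S') (g : S' →+* S'')
    {q : ℤ → AddSubgroup S'} {q' : ℤ → AddSubgroup S''} (hq : IsMulDeg q) (hq' : IsMulDeg q')
    (hg : ∀ k, ∀ s ∈ q k, g s ∈ q' k) :
    ((C.baseChange f q).baseChange g q').Iso (C.baseChange (g.comp f) q') :=
  letI := f.toAlgebra
  letI := g.toAlgebra
  letI := (g.comp f).toAlgebra
  haveI : IsScalarTower S S' S'' := IsScalarTower.of_algebraMap_eq fun _ => rfl
  { e := fun i => TensorProduct.AlgebraTensorModule.cancelBaseChange S S' S'' S'' (C.X i)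
    comm := fun i x => by
      refine addHom_eq_of_tmul
        (f := ((TensorProduct.AlgebraTensorModule.cancelBaseChange S S' S'' S''
          (C.X (i + 1))).toLinearMap ∘ₗ ((C.d i).baseChange S').baseChange S'').toAddMonoidHom)
        (g := ((C.d i).baseChange S'' ∘ₗ (TensorProduct.AlgebraTensorModule.cancelBaseChange
          S S' S'' S'' (C.X i)).toLinearMap).toAddMonoidHom) (fun s y => ?_) x
      exact addHom_eq_of_tmul
        (f := ((TensorProduct.AlgebraTensorModule.cancelBaseChange S S' S'' S''
          (C.X (i + 1))).toLinearMap ∘ₗ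
            ((C.d i).baseChange S').baseChange S'').toAddMonoidHom.comp
              (TensorProduct.mk S' S'' _ s).toAddMonoidHom)
        (g := ((C.d i).baseChange S'' ∘ₗ (TensorProduct.AlgebraTensorModule.cancelBaseChange
          S S' S'' S'' (C.X i)).toLinearMap).toAddMonoidHom.comp
              (TensorProduct.mk S' S'' _ s).toAddMonoidHom) (fun _ _ => rfl) y
    mem_deg_iff := fun i k x => by
      constructor
      · intro hx
        have h := map_mem_of_mem_tensorDeg
          (TensorProduct.AlgebraTensorModule.cancelBaseChange S S' S'' S''
            (C.X i)).symm.toLinearMap.toAddMonoidHom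
          (tensorDeg q' (tensorDeg q (C.deg i)) k) (fun a b hab s hs y hy => by
            exact tmul_mem_tensorDeg (n := (1 : S') ⊗ₜ[S] y) hs
              (tmul_mem_tensorDeg hq.one_mem hy (zero_add b)) hab) hx
        have e := (TensorProduct.AlgebraTensorModule.cancelBaseChange S S' S'' S''
          (C.X i)).symm_apply_apply x
        rw [← e]
        exact h
      · refine fun hx => map_mem_of_mem_tensorDeg
          (TensorProduct.AlgebraTensorModule.cancelBaseChange S S' S'' S''
            (C.X i)).toLinearMap.toAddMonoidHom
          (tensorDeg q' (C.deg i) k) (fun a b hab s hs y hy => ?_) hx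
        refine map_mem_of_mem_tensorDeg
          ((TensorProduct.AlgebraTensorModule.cancelBaseChange S S' S'' S''
            (C.X i)).toLinearMap.toAddMonoidHom.comp (TensorProduct.mk S' S'' _ s).toAddMonoidHom)
          (tensorDeg q' (C.deg i) k) (fun a' b' hab' s' hs' y hy => ?_) hy
        change ((g s' * s) ⊗ₜ[S] y) ∈ _
        exact tmul_mem_tensorDeg (hq'.mul_mem (hg _ _ hs') hs) hy (by omega) }

/-- The base change along the identity of a complex whose degrees are compatible with those of the
ring. -/
noncomputable def Iso.baseChangeId (C : QComplex S) {q : ℤ → AddSubgroup S}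
    (hq : (1 : S) ∈ q 0)
    (hC : ∀ (i a b : ℤ) (s : S) (x : C.X i), s ∈ q a → x ∈ C.deg i b → s • x ∈ C.deg i (a + b)) :
    (C.baseChange (RingHom.id S) q).Iso C where
  e i := TensorProduct.lid S (C.X i)
  comm i x := by
    exact addHom_eq_of_tmul
      (f := ((TensorProduct.lid S (C.X (i + 1))).toLinearMap ∘ₗ
        (C.d i).baseChange S).toAddMonoidHom)
      (g := (C.d i ∘ₗ (TensorProduct.lid S (C.X i)).toLinearMap).toAddMonoidHom)
      (fun s y => (map_smul (C.d i) s y).symm) x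
  mem_deg_iff i k x := by
    constructor
    · intro hx
      have e : (1 : S) ⊗ₜ[S] (TensorProduct.lid S (C.X i) x) = x :=
        (TensorProduct.lid S (C.X i)).symm_apply_apply x
      rw [← e]
      exact tmul_mem_tensorDeg hq hx (zero_add k)
    · exact fun hx => map_mem_of_mem_tensorDeg
        (TensorProduct.lid S (C.X i)).toLinearMap.toAddMonoidHom (C.deg i k)
        (fun a b hab s hs y hy => mem_deg_cast (hC i a b s y hs hy) hab) hx

theorem smul_mem_deg_baseChange (C : QComplex S) (f : S →+* S') {q : ℤ → AddSubgroup S'}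
    (hq : IsMulDeg q) (i a b : ℤ) (s : S') (x : (C.baseChange f q).X i) (hs : s ∈ q a)
    (hx : x ∈ (C.baseChange f q).deg i b) : s • x ∈ (C.baseChange f q).deg i (a + b) := by
  let _ := f.toAlgebra
  refine map_mem_of_mem_tensorDeg (DistribSMul.toAddMonoidHom (S' ⊗[S] C.X i) s)
    ((C.baseChange f q).deg i (a + b)) (fun c d hcd s' hs' y hy => ?_) hx
  exact tmul_mem_tensorDeg (hq.mul_mem hs hs') hy (by omega)

end QComplex

namespace TangleDiagram

variable (D : TangleDiagram)

/-! ### Nesting of circles -/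

/-- A chosen end on each connected component of the diagram: the face at this end counts as the
unbounded one. -/
noncomputable def rootDart (d : Dart D.n) : Dart D.n :=
  (Quotient.mk (orbits (rot D.n) D.arc) d).out

theorem rootDart_eq_of_rel {d e : Dart D.n} (h : e = rot D.n d ∨ e = D.arc d) :
    D.rootDart e = D.rootDart d := by
  rw [rootDart, rootDart, Quotient.sound (Relation.EqvGen.symm _ _ (Relation.EqvGen.rel d e h))]

theorem rootDart_rel (d : Dart D.n) : orbits (rot D.n) D.arc (D.rootDart d) d :=
  Quotient.exact (Quotient.out_eq _)

/-- `f` is a function on the faces whose coboundary is `z` and which vanishes on the faces at the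
chosen ends.  A face is represented by the ends `d`, `rot (arc d)`, ...; the edge of `d` separates
the faces represented by `d` and by `arc d`. -/
structure IsInside (z f : Dart D.n → ZMod 2) : Prop where
  face : ∀ d, f (rot D.n (D.arc d)) = f d
  jump : ∀ d, f d + f (D.arc d) = z d
  root : ∀ d, f (D.rootDart d) = 0

variable {D}

theorem IsInside.arc {z f : Dart D.n → ZMod 2} (h : D.IsInside z f) (d : Dart D.n) :
    f (D.arc d) = f d + z d := by
  rw [← h.jump, ← add_assoc, CharTwo.add_self_eq_zero, zero_add]

theorem IsInside.rot {z f : Dart D.n → ZMod 2} (h : D.IsInside z f) (d : Dart D.n) :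
    f (Khovanov.rot D.n d) = f d + z d := by
  rw [← h.arc, ← h.face (D.arc d), D.arc_arc]

theorem IsInside.add {z z' f f' : Dart D.n → ZMod 2} (h : D.IsInside z f)
    (h' : D.IsInside z' f') : D.IsInside (z + z') (f + f') where
  face d := by simp only [Pi.add_apply, h.face, h'.face]
  jump d := by simp only [Pi.add_apply, ← h.jump, ← h'.jump]; ring
  root d := by simp only [Pi.add_apply, h.root, h'.root, add_zero]

theorem IsInside.unique {z f f' : Dart D.n → ZMod 2} (h : D.IsInside z f)
    (h' : D.IsInside z f') : f = f' := by
  funext d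
  have key : ∀ a b, orbits (Khovanov.rot D.n) D.arc a b → f a + f' a = f b + f' b := by
    intro a b hab
    induction hab with
    | rel a b hab =>
      have two : z a + z a = 0 := CharTwo.add_self_eq_zero _
      rcases hab with rfl | rfl
      · rw [h.rot, h'.rot]; linear_combination -two
      · rw [h.arc, h'.arc]; linear_combination -two
    | refl => rfl
    | symm _ _ _ ih => exact ih.symm
    | trans _ _ _ _ _ ih1 ih2 => exact ih1.trans ih2
  have h1 := key _ _ (D.rootDart_rel d)
  rw [h.root, h'.root, add_zero] at h1
  exact CharTwo.add_eq_zero.1 h1.symm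

variable (D)

/-- The two ends joined by a smoothing are neighbours at their crossing. -/
theorem smoothing_eq (v : Finset (Fin D.n)) (d : Dart D.n) :
    smoothing v d = rot D.n d ∨ d = rot D.n (smoothing v d) := by
  rcases d with ⟨c, i⟩ | b
  · by_cases h : c ∈ v <;> fin_cases i <;> simp [smoothing, h, rot]
  · exact Or.inl rfl

theorem smoothing_ne (v : Finset (Fin D.n)) (d : Dart D.n) : smoothing v d ≠ d := by
  rcases d with ⟨c, i⟩ | b
  · by_cases h : c ∈ v <;> fin_cases i <;> simp [smoothing, h]
  · simp [smoothing]

open Classical in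
/-- The indicator function of a set of ends. -/
noncomputable def indicator (P : Dart D.n → Prop) (d : Dart D.n) : ZMod 2 := if P d then 1 else 0

variable {D}

/-- By planarity, a union of circles has an inside. -/
theorem exists_isInside (v : Finset (Fin D.n)) (P : Dart D.n → Prop)
    (hP : ∀ d e, D.conn v d e → (P d ↔ P e)) : ∃ f, D.IsInside (D.indicator P) f := by
  classical
  have hz : ∀ d e, D.conn v d e → D.indicator P d = D.indicator P e := by
    intro d e h
    simp only [indicator, hP d e h]
  obtain ⟨f, h1, h2⟩ := D.exists_face_coloring (D.indicator P)
    (fun d => (hz _ _ (D.conn_arc v d)).symm) (by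
      intro g hg
      refine Finset.sum_involution (fun d _ => smoothing v d) ?_ ?_ ?_ ?_
      · intro d _
        have hgs : g (smoothing v d) = g d := by
          rcases D.smoothing_eq v d with h | h
          · rw [h, hg]
          · conv_rhs => rw [h, hg]
        rw [hgs, ← hz _ _ (D.conn_smoothing v d)]
        exact CharTwo.add_self_eq_zero _
      · exact fun d _ _ => D.smoothing_ne v d
      · exact fun d _ => Finset.mem_univ _
      · exact fun d _ => smoothing_smoothing v d)
  have r1 : ∀ d, D.rootDart (D.arc d) = D.rootDart d := fun d => D.rootDart_eq_of_rel (Or.inr rfl)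
  have r2 : ∀ d, D.rootDart (rot D.n d) = D.rootDart d := fun d =>
    D.rootDart_eq_of_rel (Or.inl rfl)
  refine ⟨fun d => f d + f (D.rootDart d), fun d => ?_, fun d => ?_, fun d => ?_⟩
  · simp only [h1, r1, r2]
  · simp only [r1, ← h2]
    linear_combination CharTwo.add_self_eq_zero (f (D.rootDart d))
  · have : D.rootDart (D.rootDart d) = D.rootDart d := by
      rw [rootDart, Quotient.sound (D.rootDart_rel d)]; rfl
    simp only [this]
    exact CharTwo.add_self_eq_zero _

variable (D)

/-- The indicator function of the inside of a component of a state. -/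
noncomputable def inside (v : Finset (Fin D.n)) (d : Dart D.n) : Dart D.n → ZMod 2 :=
  (exists_isInside v (fun e => D.conn v d e) (fun _ _ h =>
    ⟨fun h' => (D.conn v).trans h' h, fun h' => (D.conn v).trans h' ((D.conn v).symm h)⟩)).choose

theorem inside_isInside (v : Finset (Fin D.n)) (d : Dart D.n) :
    D.IsInside (D.indicator fun e => D.conn v d e) (D.inside v d) :=
  Exists.choose_spec _

/-- A chosen source-sink orientation; it also records the checkerboard coloring of the faces. -/
noncomputable def color : Dart D.n → ZMod 2 := D.exists_checkerboard.choose

theorem color_rot (d : Dart D.n) : D.color (rot D.n d) = D.color d + 1 :=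
  D.exists_checkerboard.choose_spec.1 d

theorem color_arc (d : Dart D.n) : D.color (D.arc d) = D.color d + 1 :=
  D.exists_checkerboard.choose_spec.2 d

/-- The color of the faces just inside the component through `d`: `0` or `1`.  This is `0` or `1`
according to the sense of rotation of the component for the source-sink orientation. -/
noncomputable def innerColor (v : Finset (Fin D.n)) (d : Dart D.n) : ℕ :=
  (D.inside v d d + D.color d).val

variable {D}

theorem indicator_of {P : Dart D.n → Prop} {d : Dart D.n} (h : P d) : D.indicator P d = 1 :=
  if_pos h

theorem indicator_of_not {P : Dart D.n → Prop} {d : Dart D.n} (h : ¬ P d) :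
    D.indicator P d = 0 := if_neg h

theorem inside_congr {v : Finset (Fin D.n)} {d e : Dart D.n} (h : D.conn v d e) :
    D.inside v d = D.inside v e := by
  refine (D.inside_isInside v d).unique ?_
  have : (fun a => D.conn v d a) = fun a => D.conn v e a := by
    funext a
    exact propext ⟨fun h' => (D.conn v).trans ((D.conn v).symm h) h', (D.conn v).trans h⟩
  rw [this]
  exact D.inside_isInside v e

/-- A function on the ends that does not change along the edges of a component, nor when passing to
the next end at a crossing of the component, is constant on it. -/
theorem conn_induction {v : Finset (Fin D.n)} {M : Type*} {g : Dart D.n → M} {x : Dart D.n}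
    (ha : ∀ d, D.conn v x d → g (D.arc d) = g d)
    (hr : ∀ d, D.conn v x d → g (rot D.n d) = g d) {d : Dart D.n} (h : D.conn v x d) :
    g d = g x := by
  have key : ∀ a b, D.conn v a b → D.conn v x a → g b = g a := by
    intro a b hab
    induction hab with
    | rel a b hab =>
      intro hx
      rcases hab with rfl | rfl
      · exact ha a hx
      · rcases D.smoothing_eq v a with h | h
        · rw [h]; exact hr a hx
        · conv_rhs => rw [h]
          exact (hr _ ((D.conn v).trans hx (D.conn_smoothing v a))).symm
    | refl => exact fun _ => rfl
    | symm a b hab ih =>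
      exact fun hx => (ih ((D.conn v).trans hx ((D.conn v).symm hab))).symm
    | trans a b c hab _ ih1 ih2 =>
      exact fun hx => (ih2 ((D.conn v).trans hx hab)).trans (ih1 hx)
  exact key x d h ((D.conn v).refl x)

theorem innerColor_congr {v : Finset (Fin D.n)} {d e : Dart D.n} (h : D.conn v d e) :
    D.innerColor v d = D.innerColor v e := by
  have hi := D.inside_isInside v d
  rw [innerColor, innerColor, ← inside_congr h]
  congr 1
  refine (conn_induction (g := fun a => D.inside v d a + D.color a) ?_ ?_ h).symm
  · intro a ha
    rw [hi.arc, indicator_of ha, D.color_arc]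
    linear_combination CharTwo.add_self_eq_zero (1 : ZMod 2)
  · intro a ha
    rw [hi.rot, indicator_of ha, D.color_rot]
    linear_combination CharTwo.add_self_eq_zero (1 : ZMod 2)

/-- The inside of a component is determined by the set of its ends. -/
theorem inside_eq_of_iff {v w : Finset (Fin D.n)} {d : Dart D.n}
    (h : ∀ e, D.conn v d e ↔ D.conn w d e) : D.inside v d = D.inside w d := by
  refine (D.inside_isInside v d).unique ?_
  simp only [h]
  exact D.inside_isInside w d

/-- Two distinct components do not lie inside each other. -/
theorem not_inside_each_other {v : Finset (Fin D.n)} {x y : Dart D.n} (hxy : ¬ D.conn v x y)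
    (h1 : D.inside v x y = 1) (h2 : D.inside v y x = 1) : False := by
  have i1 := D.inside_isInside v x
  have i2 := D.inside_isInside v y
  have off : ∀ x y, ¬ D.conn v x y → D.inside v x y = 1 →
      ∀ d, D.conn v y d → D.inside v x d = 1 := by
    intro x y hxy h d hd
    have i := D.inside_isInside v x
    rw [← h]
    refine conn_induction ?_ ?_ hd
    · intro a ha
      rw [i.arc, indicator_of_not, add_zero]
      exact fun h => hxy ((D.conn v).trans h ((D.conn v).symm ha))
    · intro a ha
      rw [i.rot, indicator_of_not, add_zero]
      exact fun h => hxy ((D.conn v).trans h ((D.conn v).symm ha))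
  have o1 := off x y hxy h1
  have o2 := off y x (fun h => hxy ((D.conn v).symm h)) h2
  -- the product has the same coboundary as the sum
  have hprod : D.IsInside ((D.indicator fun e => D.conn v x e) +
      D.indicator fun e => D.conn v y e) (D.inside v x * D.inside v y) := by
    refine ⟨fun d => by simp only [Pi.mul_apply, i1.face, i2.face], fun d => ?_,
      fun d => by simp only [Pi.mul_apply, i1.root, zero_mul]⟩
    have j1 := i1.arc d
    have j2 := i2.arc d
    simp only [Pi.mul_apply, Pi.add_apply, j1, j2]
    by_cases hx : D.conn v x d
    · have hy : ¬ D.conn v y d := fun h => hxy ((D.conn v).trans hx ((D.conn v).symm h))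
      rw [indicator_of hx, indicator_of_not hy, o2 d hx]
      linear_combination CharTwo.add_self_eq_zero (D.inside v x d)
    · by_cases hy : D.conn v y d
      · rw [indicator_of_not hx, indicator_of hy, o1 d hy]
        linear_combination CharTwo.add_self_eq_zero (D.inside v y d)
      · rw [indicator_of_not hx, indicator_of_not hy]
        linear_combination CharTwo.add_self_eq_zero (D.inside v x d * D.inside v y d)
  have all : ∀ d, D.inside v x d = 0 := by
    intro d
    have h := congrFun (hprod.unique (i1.add i2)) d
    simp only [Pi.mul_apply, Pi.add_apply] at h
    revert h
    generalize D.inside v x d = a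
    generalize D.inside v y d = b
    revert a b
    decide
  rw [all] at h1
  exact zero_ne_one h1

end TangleDiagram

namespace TangleDiagram

variable {D : TangleDiagram}

/-! ### Weights of the ends -/

/-- How the colors of the insides behave when two components are merged at a crossing. The inside of
the merged circle is the sum modulo two of the insides of its parts, which gives the claim modulo two.
It holds in `ℕ` because the parts are not inside each other. -/
theorem innerColor_merge {m r : Finset (Fin D.n)} {a b : Dart D.n} (hb : rot D.n (rot D.n a) = b)
    (ha : rot D.n (rot D.n b) = a) (ha' : D.conn r a (rot D.n a)) (hb' : D.conn r b (rot D.n b))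
    (hab : ¬ D.conn r a b) (hm : ∀ e, D.conn m a e ↔ D.conn r a e ∨ D.conn r b e) :
    D.innerColor m a + (D.color a).val = D.innerColor r a + D.innerColor r b := by
  have off : ∀ {x y}, ¬ D.conn r x y → D.conn r y (rot D.n y) →
      D.inside r x (rot D.n (rot D.n y)) = D.inside r x y := by
    intro x y hxy hy
    have i := D.inside_isInside r x
    rw [i.rot, i.rot, indicator_of_not hxy, indicator_of_not
      (fun h => hxy ((D.conn r).trans h ((D.conn r).symm hy))), add_zero, add_zero]
  have hba : ¬ D.conn r b a := fun h => hab ((D.conn r).symm h)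
  have h1 := off hab hb'
  have h2 := off hba ha'
  rw [ha] at h1
  rw [hb] at h2
  have hc : D.color b = D.color a := by
    rw [← hb, D.color_rot, D.color_rot]
    linear_combination CharTwo.add_self_eq_zero (1 : ZMod 2)
  have hsum : D.inside m a = D.inside r a + D.inside r b := by
    refine (D.inside_isInside m a).unique ?_
    have : (D.indicator fun e => D.conn m a e) =
        (D.indicator fun e => D.conn r a e) + D.indicator fun e => D.conn r b e := by
      funext e
      rw [Pi.add_apply]
      by_cases hx : D.conn r a e
      · rw [indicator_of hx, indicator_of_not
          (fun h => hab ((D.conn r).trans hx ((D.conn r).symm h))),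
          indicator_of ((hm e).2 (Or.inl hx)), add_zero]
      · by_cases hy : D.conn r b e
        · rw [indicator_of_not hx, indicator_of hy, indicator_of ((hm e).2 (Or.inr hy)), zero_add]
        · rw [indicator_of_not hx, indicator_of_not hy, indicator_of_not
            (fun h => ((hm e).1 h).elim hx hy), zero_add]
    rw [this]
    exact (D.inside_isInside r a).add (D.inside_isInside r b)
  have hnot : ¬ (D.inside r a a = 1 ∧ D.inside r b b = 1) := by
    rintro ⟨h, h'⟩
    exact not_inside_each_other hab (h1.symm.trans h) (h2.symm.trans h')
  rw [innerColor, innerColor, innerColor, hsum, Pi.add_apply, hc, ← h2]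
  revert hnot
  generalize D.inside r a a = x
  generalize D.inside r b b = y
  generalize D.color a = z
  revert x y z
  decide

open Classical in
/-- The exponents of the correction factor: on each component they add up to the color of its
inside, plus the number of the `1`-smoothed crossings of one of the two types whose end `0` lies on
the component. -/
noncomputable def weight (v : Finset (Fin D.n)) (d : Dart D.n) : ℕ :=
  (if (Quotient.mk (D.conn v) d).out = d then D.innerColor v d else 0) +
    ∑ c ∈ v, if D.corner c 0 = d then (D.color d).val else 0

open Classical in
theorem sum_innerColor (v : Finset (Fin D.n)) (x : Dart D.n) :
    ∑ d with D.conn v x d, (if (Quotient.mk (D.conn v) d).out = d then D.innerColor v d else 0) =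
      D.innerColor v x := by
  have hx : D.conn v x (Quotient.mk (D.conn v) x).out :=
    (D.conn v).symm (Quotient.exact (Quotient.out_eq _))
  rw [Finset.sum_eq_single (Quotient.mk (D.conn v) x).out]
  · rw [Quotient.out_eq, if_pos rfl, innerColor_congr hx]
  · intro d hd hne
    rw [if_neg]
    intro h
    apply hne
    rw [← h]
    congr 1
    exact (Quotient.sound (Finset.mem_filter.1 hd).2).symm
  · intro h
    exact absurd (Finset.mem_filter.2 ⟨Finset.mem_univ _, hx⟩) h

open Classical in
theorem sum_crossing (v : Finset (Fin D.n)) (P : Dart D.n → Prop) :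
    ∑ d with P d, ∑ c ∈ v, (if D.corner c 0 = d then (D.color d).val else 0) =
      ∑ c ∈ v, if P (D.corner c 0) then (D.color (D.corner c 0)).val else 0 := by
  rw [Finset.sum_comm]
  refine Finset.sum_congr rfl fun c _ => ?_
  rw [Finset.sum_ite_eq]
  simp

theorem Refines.conn_iff_of_not {m r : Finset (Fin D.n)} {c : Fin D.n} (h : Refines m r c)
    {x : Dart D.n} (hx : ¬ D.conn m x (D.corner c 0)) (e : Dart D.n) :
    D.conn m x e ↔ D.conn r x e := by
  rw [← comp_eq] at hx
  rw [← comp_eq, ← comp_eq]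
  refine ⟨fun he => ?_, h.le _ _⟩
  rcases h.ge _ _ he with h1 | ⟨h1, -⟩ | ⟨h1, -⟩
  · exact h1
  · exact absurd (h.le _ _ h1) hx
  · exact absurd ((h.le _ _ h1).trans h.eq.symm) hx

theorem Refines.conn_iff {m r : Finset (Fin D.n)} {c : Fin D.n} (h : Refines m r c) (e : Dart D.n) :
    D.conn m (D.corner c 0) e ↔ D.conn r (D.corner c 0) e ∨ D.conn r (D.corner c 2) e := by
  rw [← comp_eq, ← comp_eq, ← comp_eq]
  constructor
  · intro he
    rcases h.ge _ _ he with h1 | ⟨-, h1⟩ | ⟨-, h1⟩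
    · exact Or.inl h1
    · exact Or.inr h1.symm
    · exact Or.inl h1.symm
  · rintro (he | he)
    · exact h.le _ _ he
    · exact h.eq.trans (h.le _ _ he)

open Classical in
/-- The sum of the colors of the insides over the components of `r` that make up a component of
`m`. -/
theorem Refines.sum_innerColor {m r : Finset (Fin D.n)} {c : Fin D.n} (h : Refines m r c)
    (x : Dart D.n) :
    ∑ d with D.conn m x d, (if (Quotient.mk (D.conn r) d).out = d then D.innerColor r d else 0) =
      if D.conn m x (D.corner c 0) then
        D.innerColor r (D.corner c 0) + D.innerColor r (D.corner c 2) else D.innerColor m x := by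
  by_cases hx : D.conn m x (D.corner c 0)
  · rw [if_pos hx, ← TangleDiagram.sum_innerColor r (D.corner c 0),
      ← TangleDiagram.sum_innerColor r (D.corner c 2), ← Finset.sum_union, ← Finset.filter_or]
    · refine Finset.sum_congr (Finset.filter_congr fun d _ => ?_) fun _ _ => rfl
      rw [← h.conn_iff]
      exact ⟨(D.conn m).trans ((D.conn m).symm hx), (D.conn m).trans hx⟩
    · rw [Finset.disjoint_filter]
      intro d _ h1 h2
      exact h.ne (D.comp_eq.2 ((D.conn r).trans h1 ((D.conn r).symm h2)))
  · rw [if_neg hx, innerColor, inside_eq_of_iff (h.conn_iff_of_not hx), ← innerColor,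
      ← TangleDiagram.sum_innerColor r x]
    exact Finset.sum_congr (Finset.filter_congr fun d _ => h.conn_iff_of_not hx d) fun _ _ => rfl

variable {v : Finset (Fin D.n)} {c : Fin D.n}

open Classical in
theorem sum_weight (v u : Finset (Fin D.n)) (x : Dart D.n) :
    ∑ d with D.conn u x d, weight v d =
      ∑ d with D.conn u x d,
        (if (Quotient.mk (D.conn v) d).out = d then D.innerColor v d else 0) +
      ∑ c ∈ v, if D.conn u x (D.corner c 0) then (D.color (D.corner c 0)).val else 0 := by
  simp only [weight, Finset.sum_add_distrib]
  rw [sum_crossing]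

open Classical in
/-- The exponents are additive when components are merged. -/
theorem sum_weight_of_not_splits (hs : ¬ D.Splits v c) (hc : c ∉ v) (x : Dart D.n) :
    ∑ d with D.conn (insert c v) x d, weight v d =
      ∑ d with D.conn (insert c v) x d, weight (insert c v) d := by
  have h := refines_of_not_splits hs hc
  rw [sum_weight, sum_weight, Finset.sum_insert hc, h.sum_innerColor,
    TangleDiagram.sum_innerColor, ← add_assoc]
  congr 1
  by_cases hx : D.conn (insert c v) x (D.corner c 0)
  · rw [if_pos hx, if_pos hx, innerColor_congr hx]
    refine (innerColor_merge rfl rfl (conn_corner_zero hc).1 (conn_corner_zero hc).2 ?_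
      h.conn_iff).symm
    exact fun h' => h.ne (D.comp_eq.2 h')
  · rw [if_neg hx, if_neg hx, add_zero]

open Classical in
/-- When a component is split, the exponents of its parts add up to one more than its own. -/
theorem sum_weight_of_splits (hs : D.Splits v c) (hc : c ∉ v) (x : Dart D.n) :
    ∑ d with D.conn v x d, weight (insert c v) d = ∑ d with D.conn v x d, weight v d +
      if D.conn v x (D.corner c 0) then 1 else 0 := by
  have h := hs.refines hc
  rw [sum_weight, sum_weight, Finset.sum_insert hc, h.sum_innerColor,
    TangleDiagram.sum_innerColor, add_right_comm, ← add_assoc]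
  congr 1
  by_cases hx : D.conn v x (D.corner c 0)
  · rw [if_pos hx, if_pos hx, if_pos hx, innerColor_congr hx]
    have h3 := conn_corner_one (Finset.mem_insert_self c v)
    have hc1 : D.conn v (D.corner c 0) (D.corner c 1) := (conn_corner_zero hc).1
    have e0 := innerColor_congr (v := insert c v) ((D.conn _).symm h3.2)
    have e1 := innerColor_merge (m := v) (r := insert c v) (a := D.corner c 1)
      (b := D.corner c 3) rfl rfl ((D.conn _).symm h3.2) ((D.conn _).symm h3.1) (fun h' =>
        h.ne (D.comp_eq.2 ((D.conn _).trans h3.1 ((D.conn _).symm ((D.conn _).trans h3.2 h')))))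
      (by
        intro e
        have s1 : D.conn v (D.corner c 1) e ↔ D.conn v (D.corner c 0) e :=
          ⟨(D.conn v).trans hc1, (D.conn v).trans ((D.conn v).symm hc1)⟩
        rw [s1, h.conn_iff, or_comm]
        exact or_congr ⟨(D.conn _).trans ((D.conn _).symm h3.2), (D.conn _).trans h3.2⟩
          ⟨(D.conn _).trans ((D.conn _).symm h3.1), (D.conn _).trans h3.1⟩)
    have e2 := innerColor_congr h3.1
    have e3 := innerColor_congr hc1
    have e4 : (D.color (D.corner c 0)).val + (D.color (D.corner c 1)).val = 1 := by
      have : D.color (D.corner c 1) = D.color (D.corner c 0) + 1 := D.color_rot (D.corner c 0)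
      rw [this]
      generalize D.color (D.corner c 0) = z
      revert z
      decide
    omega
  · rw [if_neg hx, if_neg hx, if_neg hx]

end TangleDiagram

/-! ### Frobenius systems as twists -/

namespace FrobeniusSystem

variable {R A : Type*} [CommRing R] [CommRing A] [Algebra R A] (F : FrobeniusSystem R A)

/-- The generator `X` of `A`. -/
noncomputable def gen : A := F.basis 1

/-- The coefficient `h` in `X² = hX + t`. -/
noncomputable def relH : R := F.basis.coord 1 (F.gen * F.gen)

/-- The coefficient `t` in `X² = hX + t`. -/
noncomputable def relT : R := F.basis.coord 0 (F.gen * F.gen)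

theorem gen_mul_gen : F.gen * F.gen = F.relT • 1 + F.relH • F.gen := F.eq_coord _

theorem coord_one : F.basis.coord 0 (1 : A) = 1 ∧ F.basis.coord 1 (1 : A) = 0 := by
  rw [← F.basis_zero]; simp

theorem coord_gen : F.basis.coord 0 F.gen = 0 ∧ F.basis.coord 1 F.gen = 1 := by simp [gen]

/-- The coordinates of an element of `A ⊗ A`. -/
noncomputable def coordTensor (i j : Fin 2) : A ⊗[R] A →ₗ[R] R :=
  LinearMap.mul' R R ∘ₗ TensorProduct.map (F.basis.coord i) (F.basis.coord j)

theorem coordTensor_tmul (i j : Fin 2) (a b : A) :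
    F.coordTensor i j (a ⊗ₜ b) = F.basis.coord i a * F.basis.coord j b := rfl

theorem eq_coordTensor (z : A ⊗[R] A) : z = F.coordTensor 0 0 z • (1 ⊗ₜ 1) +
    F.coordTensor 0 1 z • (1 ⊗ₜ F.gen) + F.coordTensor 1 0 z • (F.gen ⊗ₜ 1) +
    F.coordTensor 1 1 z • (F.gen ⊗ₜ F.gen) := by
  induction z using TensorProduct.induction_on with
  | zero => simp
  | tmul a b =>
    conv_lhs => rw [F.eq_coord a, F.eq_coord b]
    simp only [coordTensor_tmul, TensorProduct.add_tmul, TensorProduct.tmul_add,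
      ← TensorProduct.smul_tmul', TensorProduct.tmul_smul, gen]
    module
  | add x y hx hy =>
    conv_lhs => rw [hx, hy]
    simp only [map_add]
    module

theorem coordTensor_mem {k l : ℤ} (i j : Fin 2) {z : A ⊗[R] A} (hz : z ∈ tensorDeg F.degA F.degA k)
    (hl : l = k + 2 * i + 2 * j) : F.coordTensor i j z ∈ F.deg l := by
  have hc : ∀ (i : Fin 2) {m : ℤ} {a : A}, a ∈ F.degA m → F.basis.coord i a ∈ F.deg (m + 2 * i) := by
    intro i m a ha
    fin_cases i
    · simpa using (F.mem_degA.1 ha).1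
    · simpa using (F.mem_degA.1 ha).2
  refine map_mem_of_mem_tensorDeg (F.coordTensor i j).toAddMonoidHom _ ?_ hz
  intro a b hab m hm n hn
  exact mem_deg_cast (F.mul_mem_deg (hc i hm) (hc j hn)) (by omega)

theorem coordTensor_comul_one_symm :
    F.coordTensor 1 0 (F.comul 1) = F.coordTensor 0 1 (F.comul 1) := by
  conv_rhs => rw [← F.comm_comul]
  generalize F.comul 1 = z
  induction z using TensorProduct.induction_on with
  | zero => simp
  | tmul a b => rw [TensorProduct.comm_tmul, coordTensor_tmul, coordTensor_tmul, mul_comm]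
  | add x y hx hy => rw [map_add, map_add, map_add, hx, hy]

theorem comul_balanced : (F.gen ⊗ₜ[R] (1 : A)) * F.comul 1 = (1 ⊗ₜ F.gen) * F.comul 1 := by
  rw [← F.comul_mul_left, ← F.comul_mul_right]

theorem coordTensor_comul_one : F.coordTensor 0 0 (F.comul 1) =
    F.coordTensor 1 1 (F.comul 1) * F.relT - F.coordTensor 0 1 (F.comul 1) * F.relH := by
  have h := congrArg (F.coordTensor 1 0) F.comul_balanced
  rw [F.eq_coordTensor (F.comul 1), F.coordTensor_comul_one_symm] at h
  simp only [mul_add, mul_smul_comm, Algebra.TensorProduct.tmul_mul_tmul, one_mul, mul_one,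
    F.gen_mul_gen, map_add, map_smul, coordTensor_tmul, F.coord_one, F.coord_gen, smul_eq_mul,
    mul_zero, zero_mul, add_zero, zero_add] at h
  linear_combination h

/-- The element `u` of `A` with `Δ(1) = (u ⊗ 1) (1 ⊗ X + X ⊗ 1 - h 1 ⊗ 1)`. -/
noncomputable def twist : A :=
  F.coordTensor 0 1 (F.comul 1) • 1 + F.coordTensor 1 1 (F.comul 1) • F.gen

/-- The inverse of `u`: the counit is `a ↦ ε₀(u⁻¹ a)`, where `ε₀(1) = 0` and `ε₀(X) = 1`. -/
noncomputable def twistInv : A :=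
  (F.counit F.gen - F.counit 1 * F.relH) • 1 + (F.counit 1 : R) • F.gen

theorem comul_one : F.comul 1 = (F.twist ⊗ₜ[R] (1 : A)) *
    (1 ⊗ₜ F.gen + F.gen ⊗ₜ 1 - F.relH • (1 ⊗ₜ 1)) := by
  conv_lhs => rw [F.eq_coordTensor (F.comul 1), F.coordTensor_comul_one_symm,
    F.coordTensor_comul_one]
  simp only [twist, TensorProduct.add_tmul, ← TensorProduct.smul_tmul', add_mul, mul_add, mul_sub,
    smul_mul_assoc, mul_smul_comm, Algebra.TensorProduct.tmul_mul_tmul, one_mul, mul_one,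
    F.gen_mul_gen]
  module

theorem twist_mul_twistInv : F.twist * F.twistInv = 1 := by
  have h := congrArg (TensorProduct.lid R A) (LinearMap.congr_fun F.rTensor_counit_comp_comul 1)
  rw [LinearMap.comp_apply, F.eq_coordTensor (F.comul 1), F.coordTensor_comul_one_symm] at h
  simp only [map_add, map_smul, LinearMap.rTensor_tmul, TensorProduct.lid_tmul,
    TensorProduct.mk_apply, one_smul] at h
  have h0 := congrArg (F.basis.coord 0) h
  have h1 := congrArg (F.basis.coord 1) h
  simp only [map_add, map_smul, F.coord_one, F.coord_gen, smul_eq_mul, mul_one, mul_zero, add_zero,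
    zero_add] at h0 h1
  rw [F.coordTensor_comul_one] at h0
  have e : F.twist * F.twistInv = (1 : R) • (1 : A) + (0 : R) • F.gen := by
    rw [← h0, ← h1, twist, twistInv]
    simp only [add_mul, mul_add, smul_mul_assoc, mul_smul_comm, one_mul, mul_one, F.gen_mul_gen]
    module
  rw [e]; simp

theorem smul_one_mem_degA {r : R} {k : ℤ} (hr : r ∈ F.deg k) : r • (1 : A) ∈ F.degA k := by
  rw [mem_degA, map_smul, map_smul, F.coord_one.1, F.coord_one.2]
  simpa using hr

theorem smul_gen_mem_degA {r : R} {k : ℤ} (hr : r ∈ F.deg (k + 2)) : r • F.gen ∈ F.degA k := by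
  rw [mem_degA, map_smul, map_smul, F.coord_gen.1, F.coord_gen.2]
  simpa using hr

theorem gen_mem_degA : F.gen ∈ F.degA (-2) := by
  simpa using F.smul_gen_mem_degA (k := -2) F.one_mem_deg

theorem relH_mem : F.relH ∈ F.deg (-2) := F.X_mul_X_mem.2

theorem twist_mem : F.twist ∈ F.degA 0 := by
  have h := F.comul_mem F.one_mem_degA
  exact add_mem (F.smul_one_mem_degA (F.coordTensor_mem _ _ h (by norm_num)))
    (F.smul_gen_mem_degA (F.coordTensor_mem _ _ h (by norm_num)))

theorem twistInv_mem : F.twistInv ∈ F.degA 0 := by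
  have h1 := F.counit_mem F.one_mem_degA
  have hX := F.counit_mem F.gen_mem_degA
  exact add_mem (F.smul_one_mem_degA (sub_mem hX (F.mul_mem_deg h1 F.relH_mem)))
    (F.smul_gen_mem_degA h1)

theorem curtain_one : F.curtain 1 = F.twist * (2 * F.gen - algebraMap R A F.relH) := by
  rw [curtain, LinearMap.comp_apply, comul_one]
  simp only [mul_add, mul_sub, map_add, map_sub, Algebra.TensorProduct.tmul_mul_tmul, mul_smul_comm,
    map_smul, LinearMap.mul'_apply, one_mul, mul_one, Algebra.algebraMap_eq_smul_one]
  ring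

theorem curtain_one_mem : F.curtain 1 ∈ F.degA (-2) := by
  rw [curtain_one]
  refine mem_deg_cast (F.mul_mem_degA F.twist_mem (j := -2) (sub_mem ?_ ?_)) (zero_add _)
  · rw [two_mul]; exact add_mem F.gen_mem_degA F.gen_mem_degA
  · rw [Algebra.algebraMap_eq_smul_one]; exact F.smul_one_mem_degA F.relH_mem

theorem isMulDeg_degA : IsMulDeg F.degA := ⟨F.one_mem_degA, F.mul_mem_degA⟩

theorem curtainHom_mem {k : ℤ} {p : Polynomial ℤ} (hp : p ∈ degZG k) :
    F.curtainHom p ∈ F.degA k := by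
  have hpow : ∀ n : ℕ, F.curtain 1 ^ n ∈ F.degA (-2 * n) := by
    intro n
    induction n with
    | zero => simpa using F.one_mem_degA
    | succ n ih =>
      rw [pow_succ]
      exact mem_deg_cast (F.mul_mem_degA ih F.curtain_one_mem) (by push_cast; ring)
  change Polynomial.aeval (F.curtain 1) p ∈ _
  rw [Polynomial.aeval_eq_sum_range]
  refine sum_mem fun n _ => ?_
  by_cases hn : p.coeff n = 0
  · rw [hn, zero_smul]; exact zero_mem _
  · exact zsmul_mem (mem_deg_cast (hpow n) (hp n hn).symm) _

end FrobeniusSystem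

/-! ### Ring homomorphisms on state spaces -/

section stateHom

variable {R A : Type*} [CommRing R] [CommRing A] [Algebra R A] {D : TangleDiagram}
  {v : Finset (Fin D.n)}

/-- The state space as an `A`-algebra through the factor of the special strand. -/
noncomputable instance strandAlgebra (v : Finset (Fin D.n)) : Algebra A (StateSpace R A D v) where
  algebraMap := (label R A (D.strand v)).toRingHom
  commutes' _ _ := mul_comm _ _
  smul_def' := smul_state_def

theorem algebraMap_strand (a : A) :
    algebraMap A (StateSpace R A D v) a = label R A (D.strand v) a := rfl

theorem state_induction {P : StateSpace R A D v → Prop} (hpure : ∀ a, P (pureTensor a))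
    (hadd : ∀ x y, P x → P y → P (x + y)) (x : StateSpace R A D v) : P x := by
  refine PiTensorProduct.induction_on (motive := P) x (fun r a => ?_) hadd
  have : r • (pureTensor a : StateSpace R A D v) =
      pureTensor (Pi.mulSingle (D.strand v) (algebraMap R A r) * a) := by
    rw [← pure_mul_pure, ← label_apply, AlgHom.commutes, Algebra.smul_def]
  exact this ▸ hpure _

theorem state_hom_eq {B : Type*} [CommRing B] {f g : StateSpace R A D v →+* B}
    (h : ∀ k a, f (label R A k a) = g (label R A k a)) (x : StateSpace R A D v) : f x = g x := by
  induction x using state_induction with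
  | hpure a => rw [pure_eq_prod, map_prod, map_prod, Finset.prod_congr rfl fun k _ => h k (a k)]
  | hadd x y hx hy => rw [map_add, map_add, hx, hy]

/-- A family of ring homomorphisms on the tensor factors which agree on `R` defines a ring
homomorphism on the state space. -/
noncomputable def liftState {B : Type*} [CommRing B] (g : R →+* B) (f : D.Comp v → A →+* B)
    (hf : ∀ k r, f k (algebraMap R A r) = g r) : StateSpace R A D v →+* B :=
  letI := g.toAlgebra
  (PiTensorProduct.liftAlgHom ((MultilinearMap.mkPiAlgebra R (D.Comp v) B).compLinearMap
    fun k => ({ f k with commutes' := hf k } : A →ₐ[R] B).toLinearMap) (by simp)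
    (by intro x y; simp [Finset.prod_mul_distrib])).toRingHom

theorem liftState_label {B : Type*} [CommRing B] {g : R →+* B} {f : D.Comp v → A →+* B}
    (hf : ∀ k r, f k (algebraMap R A r) = g r) (k : D.Comp v) (a : A) :
    liftState g f hf (label R A k a) = f k a := by
  let _ := g.toAlgebra
  have h : liftState g f hf (label R A k a) = ∏ j, f j ((Pi.mulSingle k a : D.Comp v → A) j) :=
    PiTensorProduct.lift.tprod (R := R) (φ := (MultilinearMap.mkPiAlgebra R (D.Comp v) B
      ).compLinearMap fun k => ({ f k with commutes' := hf k } : A →ₐ[R] B).toLinearMap)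
      (Pi.mulSingle k a)
  rw [h, Finset.prod_eq_single k]
  · rw [Pi.mulSingle_eq_same]
  · intro j _ hj
    rw [Pi.mulSingle_eq_of_ne hj, map_one]
  · simp

end stateHom

/-! ### Extension of scalars of rings -/

section extend

variable {S S' M N : Type*} [CommRing S] [CommRing S'] [CommRing M] [CommRing N] [Algebra S S']
  [Algebra S M] [Algebra S' N]

/-- The homomorphism `a ⊗ m ↦ a ρ(m)` of `S'`-algebras. -/
noncomputable def extendHom (ρ : M →+* N)
    (hρ : ∀ s, ρ (algebraMap S M s) = algebraMap S' N (algebraMap S S' s)) :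
    S' ⊗[S] M →ₐ[S'] N :=
  letI : Algebra S N := ((algebraMap S' N).comp (algebraMap S S')).toAlgebra
  haveI : IsScalarTower S S' N := IsScalarTower.of_algebraMap_eq fun _ => rfl
  Algebra.TensorProduct.lift (Algebra.ofId S' N) { ρ with commutes' := hρ }
    fun _ _ => Commute.all _ _

theorem extendHom_tmul {ρ : M →+* N}
    (hρ : ∀ s, ρ (algebraMap S M s) = algebraMap S' N (algebraMap S S' s)) (a : S') (m : M) :
    extendHom ρ hρ (a ⊗ₜ m) = algebraMap S' N a * ρ m := rfl

/-- A ring homomorphism `κ` in the opposite direction is inverse to `extendHom ρ`. -/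
noncomputable def extendEquiv (ρ : M →+* N)
    (hρ : ∀ s, ρ (algebraMap S M s) = algebraMap S' N (algebraMap S S' s))
    (κ : N →+* S' ⊗[S] M) (h1 : ∀ a, κ (algebraMap S' N a) = a ⊗ₜ 1) (h2 : ∀ m, κ (ρ m) = 1 ⊗ₜ m)
    (h3 : ∀ n, extendHom ρ hρ (κ n) = n) : S' ⊗[S] M ≃ₐ[S'] N :=
  AlgEquiv.ofAlgHom (extendHom ρ hρ) { κ with commutes' := h1 } (AlgHom.ext h3) (by
    refine Algebra.TensorProduct.ext' fun a m => ?_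
    change κ (extendHom ρ hρ (a ⊗ₜ m)) = a ⊗ₜ m
    rw [extendHom_tmul, map_mul, h1, h2, Algebra.TensorProduct.tmul_mul_tmul, one_mul, mul_one])

end extend

/-! ### Delooping -/

namespace FrobeniusSystem

variable {R A : Type*} [CommRing R] [CommRing A] [Algebra R A] (F : FrobeniusSystem R A)
  {D : TangleDiagram}

theorem eq_coord_gen (a : A) : a = F.basis.coord 0 a • 1 + F.basis.coord 1 a • F.gen :=
  F.eq_coord a

/-- The ring homomorphism on `A` with prescribed restriction to `R` and value at `X`. -/
noncomputable def genLift {B : Type*} [CommRing B] (g : R →+* B) (ξ : B)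
    (hξ : ξ * ξ = g F.relT + g F.relH * ξ) : A →+* B where
  toFun a := g (F.basis.coord 0 a) + g (F.basis.coord 1 a) * ξ
  map_one' := by rw [F.coord_one.1, F.coord_one.2, map_one, map_zero, zero_mul, add_zero]
  map_zero' := by simp
  map_add' a b := by simp only [map_add]; ring
  map_mul' a b := by
    have e : a * b = F.basis.coord 0 a • F.basis.coord 0 b • (1 : A) +
        (F.basis.coord 0 a * F.basis.coord 1 b +
          F.basis.coord 1 a * F.basis.coord 0 b) • F.gen +
        F.basis.coord 1 a • F.basis.coord 1 b • (F.gen * F.gen) := by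
      conv_lhs => rw [F.eq_coord_gen a, F.eq_coord_gen b]
      simp only [add_mul, mul_add, smul_mul_assoc, mul_smul_comm, one_mul, mul_one]
      module
    rw [e, F.gen_mul_gen]
    simp only [map_add, map_smul, F.coord_one, F.coord_gen, smul_eq_mul, map_mul, mul_one, mul_zero,
      add_zero, zero_add]
    linear_combination (-g (F.basis.coord 1 a) * g (F.basis.coord 1 b)) * hξ

theorem genLift_algebraMap {B : Type*} [CommRing B] {g : R →+* B} {ξ : B}
    (hξ : ξ * ξ = g F.relT + g F.relH * ξ) (r : R) : F.genLift g ξ hξ (algebraMap R A r) = g r := by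
  change g (F.basis.coord 0 _) + g (F.basis.coord 1 _) * ξ = g r
  rw [Algebra.algebraMap_eq_smul_one, (F.basis.coord 0).map_smul, (F.basis.coord 1).map_smul,
    F.coord_one.1, F.coord_one.2]
  simp

theorem genLift_gen {B : Type*} [CommRing B] {g : R →+* B} {ξ : B}
    (hξ : ξ * ξ = g F.relT + g F.relH * ξ) : F.genLift g ξ hξ F.gen = ξ := by
  change g (F.basis.coord 0 _) + g (F.basis.coord 1 _) * ξ = ξ
  rw [F.coord_gen.1, F.coord_gen.2]
  simp

/-- Ring homomorphisms on `A` are equal if they agree on `R` and at `X`. -/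
theorem hom_eq {B : Type*} [CommRing B] {f g : A →+* B}
    (h : ∀ r, f (algebraMap R A r) = g (algebraMap R A r)) (hX : f F.gen = g F.gen) (a : A) :
    f a = g a := by
  rw [F.eq_coord_gen a, Algebra.smul_def, Algebra.smul_def, map_add, map_add, map_mul, map_mul,
    map_mul, map_mul, h, h, hX, map_one, map_one]

variable {v : Finset (Fin D.n)}

/-- The element `u_s (X_k - X_s)`, where `s` is the special strand. -/
noncomputable def diffGen (k : D.Comp v) : StateSpace R A D v :=
  label R A (D.strand v) F.twist * (label R A k F.gen - label R A (D.strand v) F.gen)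

theorem label_gen_mul_gen (k : D.Comp v) : label R A k F.gen * label R A k F.gen =
    algebraMap R _ F.relT + algebraMap R _ F.relH * label R A k F.gen := by
  rw [← map_mul, F.gen_mul_gen, map_add, map_smul, map_smul, map_one, Algebra.smul_def,
    Algebra.smul_def, mul_one]

theorem diffGen_strand : F.diffGen (D.strand v) = 0 := by rw [diffGen, sub_self, mul_zero]

theorem label_curtain_one (k : D.Comp v) : label R A k (F.curtain 1) =
    label R A k F.twist * (2 * label R A k F.gen - algebraMap R _ F.relH) := by
  rw [curtain_one, map_mul, map_sub, map_mul, AlgHom.commutes, map_ofNat]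

theorem diffGen_mul_diffGen (k : D.Comp v) : F.diffGen k * F.diffGen k =
    -label R A (D.strand v) (F.curtain 1) * F.diffGen k := by
  rw [label_curtain_one, diffGen]
  linear_combination (label R A (D.strand v) F.twist) ^ 2 *
    (F.label_gen_mul_gen k - F.label_gen_mul_gen (D.strand v))

variable (D v) in
/-- The action of `ℤ[G]` on the state space. -/
noncomputable def strandHom : Polynomial ℤ →+* StateSpace R A D v :=
  (algebraMap A (StateSpace R A D v)).comp F.curtainHom

theorem strandHom_apply (p : Polynomial ℤ) :
    F.strandHom D v p = label R A (D.strand v) (F.curtainHom p) := rfl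

theorem curtainHom_X : F.curtainHom Polynomial.X = F.curtain 1 := Polynomial.aeval_X _

/-- The ring homomorphism `A_{ℤ[G]} → ⨂ A` with `X ↦ u_s (X_k - X_s)`. -/
noncomputable def deloopLabel (k : D.Comp v) : AZG →+* StateSpace R A D v where
  toFun a := F.strandHom D v a.re + F.strandHom D v a.im * F.diffGen k
  map_one' := by simp [QuadraticAlgebra.re_one, QuadraticAlgebra.im_one]
  map_zero' := by simp
  map_add' a b := by simp only [QuadraticAlgebra.re_add, QuadraticAlgebra.im_add, map_add]; ring
  map_mul' a b := by
    have h := F.diffGen_mul_diffGen k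
    rw [← curtainHom_X, ← strandHom_apply] at h
    simp only [QuadraticAlgebra.re_mul, QuadraticAlgebra.im_mul, map_add, map_mul, map_neg,
      map_zero]
    linear_combination (-F.strandHom D v a.im * F.strandHom D v b.im) * h

theorem deloopLabel_apply (k : D.Comp v) (a : AZG) :
    F.deloopLabel k a = F.strandHom D v a.re + F.strandHom D v a.im * F.diffGen k := rfl

theorem deloopLabel_algebraMap (k : D.Comp v) (p : Polynomial ℤ) :
    F.deloopLabel k (algebraMap _ _ p) = F.strandHom D v p := by
  rw [deloopLabel_apply]; simp

variable (D v) in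
/-- The ring homomorphism from the state space over `ℤ[G]` to the one of `F` which sends the
generator `X_k` to `u_s (X_k - X_s)`. In particular it sends `X_s` to `0`. -/
noncomputable def deloop : StateSpace (Polynomial ℤ) AZG D v →+* StateSpace R A D v :=
  liftState (F.strandHom D v) F.deloopLabel F.deloopLabel_algebraMap

theorem deloop_label (k : D.Comp v) (a : AZG) :
    F.deloop D v (label _ _ k a) = F.strandHom D v a.re + F.strandHom D v a.im * F.diffGen k :=
  liftState_label _ k a

theorem deloop_algebraMap (a : AZG) :
    F.deloop D v (algebraMap AZG _ a) =
      algebraMap A (StateSpace R A D v) (F.curtainHom (reduceHom a)) := by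
  rw [algebraMap_strand, deloop_label, diffGen_strand, mul_zero, add_zero]
  rfl

end FrobeniusSystem

namespace FrobeniusSystem

variable {R A : Type*} [CommRing R] [CommRing A] [Algebra R A] (F : FrobeniusSystem R A)
  {D : TangleDiagram} {v : Finset (Fin D.n)}

/-- The generator `X_k` of the state space over `ℤ[G]`. -/
noncomputable def stateGen (k : D.Comp v) : StateSpace (Polynomial ℤ) AZG D v :=
  label _ _ k QuadraticAlgebra.omega

theorem deloop_stateGen (k : D.Comp v) : F.deloop D v (stateGen k) = F.diffGen k := by
  rw [stateGen, deloop_label]; simp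

theorem label_zg_eq (k : D.Comp v) (a : AZG) : label (Polynomial ℤ) AZG k a =
    algebraMap AZG _ (algebraMap (Polynomial ℤ) AZG a.re) +
      algebraMap AZG _ (algebraMap (Polynomial ℤ) AZG a.im) * stateGen k := by
  have h : a = algebraMap (Polynomial ℤ) AZG a.re + algebraMap (Polynomial ℤ) AZG a.im * QuadraticAlgebra.omega := by
    ext <;> simp
  conv_lhs => rw [h]
  rw [map_add, map_mul, algebraMap_strand, algebraMap_strand, AlgHom.commutes, AlgHom.commutes,
    AlgHom.commutes, AlgHom.commutes]
  rfl

theorem stateGen_mul_stateGen (k : D.Comp v) : stateGen k * stateGen k =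
    -algebraMap AZG _ (algebraMap (Polynomial ℤ) AZG Polynomial.X) * stateGen k := by
  have h : (QuadraticAlgebra.omega : AZG) * QuadraticAlgebra.omega =
      -algebraMap (Polynomial ℤ) AZG Polynomial.X * QuadraticAlgebra.omega := by
    ext <;> simp
  rw [stateGen, ← map_mul, h, map_mul, map_neg, algebraMap_strand, AlgHom.commutes,
    AlgHom.commutes]

variable [Algebra AZG A]

theorem reduceHom_algebraMap (p : Polynomial ℤ) : reduceHom (algebraMap (Polynomial ℤ) AZG p) = p := by
  change (algebraMap (Polynomial ℤ) AZG p).re = p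
  simp

/-- The element `X ⊗ 1 + u⁻¹ ⊗ X_k`, which corresponds to the generator `X_k` of the state space
of `F`. -/
noncomputable def reloopGen (k : D.Comp v) : A ⊗[AZG] StateSpace (Polynomial ℤ) AZG D v :=
  F.gen ⊗ₜ 1 + F.twistInv ⊗ₜ stateGen k

variable (R A D v) in
/-- The inclusion of `R` into `A ⊗ StateSpace`. -/
noncomputable def reloopScalar : R →+* A ⊗[AZG] StateSpace (Polynomial ℤ) AZG D v :=
  (algebraMap A _).comp (algebraMap R A)

theorem one_tmul_algebraMap (a : AZG) :
    (1 : A) ⊗ₜ[AZG] (algebraMap AZG (StateSpace (Polynomial ℤ) AZG D v) a) =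
      algebraMap AZG A a ⊗ₜ 1 := by
  rw [Algebra.algebraMap_eq_smul_one, Algebra.algebraMap_eq_smul_one, TensorProduct.tmul_smul,
    TensorProduct.smul_tmul']

theorem one_tmul_stateGen_sq (hA : ∀ a, algebraMap AZG A a = F.curtainHom (reduceHom a))
    (k : D.Comp v) :
    (1 : A) ⊗ₜ[AZG] stateGen k * 1 ⊗ₜ stateGen k +
      F.curtain 1 ⊗ₜ 1 * 1 ⊗ₜ[AZG] stateGen k = 0 := by
  have hX : algebraMap AZG A (algebraMap (Polynomial ℤ) AZG Polynomial.X) = F.curtain 1 := by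
    rw [hA, reduceHom_algebraMap, curtainHom_X]
  have h : (1 : A) ⊗ₜ[AZG] (algebraMap AZG (StateSpace (Polynomial ℤ) AZG D v)
      (algebraMap (Polynomial ℤ) AZG Polynomial.X) * stateGen k) =
      F.curtain 1 ⊗ₜ 1 * (1 ⊗ₜ stateGen k) := by
    rw [← hX, ← one_tmul_algebraMap, Algebra.TensorProduct.tmul_mul_tmul, one_mul]
  rw [Algebra.TensorProduct.tmul_mul_tmul, one_mul, stateGen_mul_stateGen, ← h,
    ← TensorProduct.tmul_add, neg_mul, neg_add_cancel, TensorProduct.tmul_zero]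

theorem one_tmul_stateGen_strand (hA : ∀ a, algebraMap AZG A a = F.curtainHom (reduceHom a))
    :
    (1 : A) ⊗ₜ[AZG] (stateGen (D.strand v)) = 0 := by
  have h : stateGen (D.strand v) = algebraMap AZG _ QuadraticAlgebra.omega := rfl
  have h0 : reduceHom (QuadraticAlgebra.omega : AZG) = 0 := rfl
  rw [h, one_tmul_algebraMap, hA, h0, map_zero, TensorProduct.zero_tmul]

theorem reloopGen_eq (k : D.Comp v) : F.reloopGen k =
    algebraMap A _ F.gen + algebraMap A _ F.twistInv * 1 ⊗ₜ[AZG] stateGen k := by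
  rw [reloopGen, Algebra.TensorProduct.algebraMap_apply, Algebra.TensorProduct.algebraMap_apply,
    Algebra.TensorProduct.tmul_mul_tmul, mul_one, one_mul]
  rfl

theorem reloopGen_mul_reloopGen (hA : ∀ a, algebraMap AZG A a = F.curtainHom (reduceHom a))
    (k : D.Comp v) : F.reloopGen k * F.reloopGen k =
    reloopScalar R A D v F.relT + reloopScalar R A D v F.relH * F.reloopGen k := by
  have h1 := F.one_tmul_stateGen_sq hA k
  have h2 : F.curtain 1 ⊗ₜ[AZG] (1 : StateSpace (Polynomial ℤ) AZG D v) =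
    algebraMap A _ F.twist * (2 * algebraMap A _ F.gen - reloopScalar R A D v F.relH) := by
    change algebraMap A (A ⊗[AZG] StateSpace (Polynomial ℤ) AZG D v) (F.curtain 1) = _
    rw [curtain_one, map_mul, map_sub, map_mul, map_ofNat]; rfl
  have h3 : algebraMap A (A ⊗[AZG] StateSpace (Polynomial ℤ) AZG D v) F.gen * algebraMap A _ F.gen =
      reloopScalar R A D v F.relT + reloopScalar R A D v F.relH * algebraMap A _ F.gen := by
    rw [← map_mul, F.gen_mul_gen, map_add, Algebra.smul_def, Algebra.smul_def, map_mul, map_mul,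
      map_one, mul_one]; rfl
  have h4 : algebraMap A (A ⊗[AZG] StateSpace (Polynomial ℤ) AZG D v) F.twist *
      algebraMap A _ F.twistInv = 1 := by
    rw [← map_mul, F.twist_mul_twistInv, map_one]
  rw [h2] at h1
  rw [reloopGen_eq]
  generalize (1 : A) ⊗ₜ[AZG] stateGen k = Y at *
  generalize reloopScalar R A D v F.relT = t at *
  generalize reloopScalar R A D v F.relH = h at *
  generalize algebraMap A (A ⊗[AZG] StateSpace (Polynomial ℤ) AZG D v) F.gen = x at *
  generalize algebraMap A (A ⊗[AZG] StateSpace (Polynomial ℤ) AZG D v) F.twist = p at *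
  generalize algebraMap A (A ⊗[AZG] StateSpace (Polynomial ℤ) AZG D v) F.twistInv = q at *
  linear_combination h3 + q ^ 2 * h1 - q * (2 * x - h) * Y * h4

/-- The ring homomorphism `A → A ⊗ StateSpace` that corresponds to the tensor factor of `k`. -/
noncomputable def reloopLabel (hA : ∀ a, algebraMap AZG A a = F.curtainHom (reduceHom a))
    (k : D.Comp v) : A →+* A ⊗[AZG] StateSpace (Polynomial ℤ) AZG D v :=
  F.genLift (reloopScalar R A D v) (F.reloopGen k) (F.reloopGen_mul_reloopGen hA k)

variable (D v) in
/-- The inverse of the extension of scalars of `deloop`. -/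
noncomputable def reloop (hA : ∀ a, algebraMap AZG A a = F.curtainHom (reduceHom a))
    : StateSpace R A D v →+* A ⊗[AZG] StateSpace (Polynomial ℤ) AZG D v :=
  liftState (reloopScalar R A D v) (F.reloopLabel hA) fun _ => F.genLift_algebraMap _

theorem reloop_label (hA : ∀ a, algebraMap AZG A a = F.curtainHom (reduceHom a))
    (k : D.Comp v) (a : A) :
    F.reloop D v hA (label R A k a) = F.reloopLabel hA k a := liftState_label _ k a

theorem reloop_label_gen (hA : ∀ a, algebraMap AZG A a = F.curtainHom (reduceHom a))
    (k : D.Comp v) : F.reloop D v hA (label R A k F.gen) = F.reloopGen k := by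
  rw [reloop_label, reloopLabel, genLift_gen]

theorem reloop_algebraMap (hA : ∀ a, algebraMap AZG A a = F.curtainHom (reduceHom a))
    (a : A) : F.reloop D v hA (algebraMap A _ a) = a ⊗ₜ 1 := by
  refine (F.reloop_label hA (D.strand v) a).trans ?_
  refine F.hom_eq (f := F.reloopLabel hA (D.strand v)) (g := algebraMap A _) (fun r => ?_) ?_ a
  · exact F.genLift_algebraMap _ r
  · rw [reloopLabel, genLift_gen, reloopGen_eq, F.one_tmul_stateGen_strand hA, mul_zero, add_zero]

theorem reloop_diffGen (hA : ∀ a, algebraMap AZG A a = F.curtainHom (reduceHom a))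
    (k : D.Comp v) :
    F.reloop D v hA (F.diffGen k) = 1 ⊗ₜ stateGen k := by
  have h : F.diffGen k = algebraMap A _ F.twist * (label R A k F.gen - algebraMap A _ F.gen) := rfl
  rw [h, map_mul, map_sub, reloop_algebraMap, reloop_algebraMap, reloop_label_gen, reloopGen,
    add_sub_cancel_left, Algebra.TensorProduct.tmul_mul_tmul, F.twist_mul_twistInv, one_mul]

theorem reloop_deloop (hA : ∀ a, algebraMap AZG A a = F.curtainHom (reduceHom a))
    (x : StateSpace (Polynomial ℤ) AZG D v) :
    F.reloop D v hA (F.deloop D v x) = 1 ⊗ₜ x := by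
  refine state_hom_eq (f := (F.reloop D v hA).comp (F.deloop D v))
    (g := (Algebra.TensorProduct.includeRight : _ →ₐ[AZG] A ⊗[AZG] _).toRingHom)
    (fun k a => ?_) x
  change F.reloop D v hA (F.deloop D v (label _ _ k a)) = 1 ⊗ₜ label _ _ k a
  have h : (1 : A) ⊗ₜ[AZG] label (Polynomial ℤ) AZG k a =
      1 ⊗ₜ (algebraMap AZG _ (algebraMap (Polynomial ℤ) AZG a.re)) +
      1 ⊗ₜ (algebraMap AZG _ (algebraMap (Polynomial ℤ) AZG a.im)) * 1 ⊗ₜ stateGen k := by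
    rw [label_zg_eq k a, TensorProduct.tmul_add, Algebra.TensorProduct.tmul_mul_tmul, one_mul]
  rw [h, one_tmul_algebraMap, one_tmul_algebraMap, hA, hA, reduceHom_algebraMap,
    reduceHom_algebraMap, deloop_label, map_add, map_mul, reloop_diffGen]
  congr 1
  · exact F.reloop_algebraMap hA _
  · exact congrArg (· * _) (F.reloop_algebraMap hA _)

theorem deloop_algebraMap_eq (hA : ∀ a, algebraMap AZG A a = F.curtainHom (reduceHom a))
    (a : AZG) : F.deloop D v (algebraMap AZG _ a) =
    algebraMap A (StateSpace R A D v) (algebraMap AZG A a) := by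
  rw [deloop_algebraMap, hA]

variable (D v) in
/-- The extension of scalars of `deloop` along `ℤ[G] → A`. -/
noncomputable def deloopHom (hA : ∀ a, algebraMap AZG A a = F.curtainHom (reduceHom a))
    :
    A ⊗[AZG] StateSpace (Polynomial ℤ) AZG D v →ₐ[A] StateSpace R A D v :=
  extendHom (F.deloop D v) (F.deloop_algebraMap_eq hA)

theorem deloopHom_tmul (hA : ∀ a, algebraMap AZG A a = F.curtainHom (reduceHom a))
    (a : A) (x : StateSpace (Polynomial ℤ) AZG D v) :
    F.deloopHom D v hA (a ⊗ₜ x) = a • F.deloop D v x := by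
  rw [Algebra.smul_def]; rfl

theorem deloopHom_reloop (hA : ∀ a, algebraMap AZG A a = F.curtainHom (reduceHom a))
    (x : StateSpace R A D v) :
    F.deloopHom D v hA (F.reloop D v hA x) = x := by
  refine state_hom_eq (f := (F.deloopHom D v hA).toRingHom.comp (F.reloop D v hA))
    (g := RingHom.id _) (fun k a => ?_) x
  refine F.hom_eq (f := ((F.deloopHom D v hA).toRingHom.comp (F.reloop D v hA)).comp
    (label R A k).toRingHom) (g := (label R A k).toRingHom) (fun r => ?_) ?_ a
  · change F.deloopHom D v hA (F.reloop D v hA (label R A k (algebraMap R A r))) =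
      label R A k (algebraMap R A r)
    rw [reloop_label, reloopLabel, genLift_algebraMap, reloopScalar, RingHom.comp_apply,
      AlgHom.commutes, algebraMap_strand, AlgHom.commutes, AlgHom.commutes]
  · change F.deloopHom D v hA (F.reloop D v hA (label R A k F.gen)) = label R A k F.gen
    rw [reloop_label_gen, reloopGen, map_add, deloopHom_tmul, deloopHom_tmul, map_one,
      deloop_stateGen, smul_state_def, smul_state_def, diffGen, ← mul_assoc, ← map_mul,
      mul_comm F.twistInv, F.twist_mul_twistInv, map_one, mul_one, one_mul, add_sub_cancel]

variable (D v) in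
/-- The delooping isomorphism: after extension of scalars, the state spaces over `ℤ[G]` and of `F`
are isomorphic as rings. -/
noncomputable def deloopEquiv (hA : ∀ a, algebraMap AZG A a = F.curtainHom (reduceHom a))
    :
    A ⊗[AZG] StateSpace (Polynomial ℤ) AZG D v ≃ₐ[A] StateSpace R A D v :=
  extendEquiv (F.deloop D v) (F.deloop_algebraMap_eq hA) (F.reloop D v hA)
    (F.reloop_algebraMap hA) (F.reloop_deloop hA) (F.deloopHom_reloop hA)

end FrobeniusSystem

/-! ### The correction factors -/

open Classical in
/-- If the values of `η` on a class of `s` become equal after multiplication by `B`, then the product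
of powers of values of `η`, multiplied by `B`, depends only on the total exponents of the classes. -/
theorem prod_pow_mul_eq {X M : Type*} [Fintype X] [CommMonoid M] (s : Setoid X) {η : X → M} {B : M}
    (h : ∀ d e, s d e → η d * B = η e * B) {W W' : X → ℕ}
    (hW : ∀ x, ∑ d with s x d, W d = ∑ d with s x d, W' d) :
    (∏ d, η d ^ W d) * B = (∏ d, η d ^ W' d) * B := by
  have key : ∀ W : X → ℕ, (∏ d, η d ^ W d) * B =
      (∏ q : Quotient s, η q.out ^ ∑ d with s q.out d, W d) * B := by
    intro W
    have hpow : ∀ d e, s d e → ∀ n : ℕ, η d ^ n * B = η e ^ n * B := by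
      intro d e hde n
      induction n with
      | zero => rw [pow_zero, pow_zero]
      | succ n ih => rw [pow_succ, pow_succ, mul_assoc, h d e hde, mul_left_comm, ih, mul_left_comm,
          mul_assoc]
    have h1 : ∀ t : Finset X, (∏ d ∈ t, η d ^ W d) * B =
        (∏ d ∈ t, η (Quotient.mk s d).out ^ W d) * B := by
      intro t
      induction t using Finset.induction_on with
      | empty => rw [Finset.prod_empty, Finset.prod_empty]
      | insert d t hd ih =>
        rw [Finset.prod_insert hd, Finset.prod_insert hd, mul_assoc, ih, mul_left_comm,
          hpow d _ (s.symm (Quotient.exact (Quotient.out_eq _))), mul_left_comm, mul_assoc]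
    rw [h1, ← Finset.prod_fiberwise Finset.univ (fun d => Quotient.mk s d)]
    congr 1
    refine Finset.prod_congr rfl fun q _ => ?_
    rw [← Finset.prod_pow_eq_pow_sum]
    refine Finset.prod_congr (Finset.filter_congr fun d _ => ?_) fun d hd => ?_
    · constructor
      · rintro rfl; exact Quotient.exact (Quotient.out_eq _)
      · intro hd
        rw [← Quotient.out_eq q]
        exact (Quotient.sound hd).symm
    · have hd' : s q.out d := (Finset.mem_filter.1 hd).2
      rw [← Quotient.sound hd', Quotient.out_eq]
  rw [key, key]
  simp only [hW]

section intertwines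

variable {R A : Type*} [CommRing R] [CommRing A] [Algebra R A] {D : TangleDiagram}
  {v w : Finset (Fin D.n)} {f : StateSpace R A D v →ₗ[R] StateSpace R A D w}

/-- The linear map `f` intertwines the multiplications by `x` and by `y`. -/
def Intertwines (f : StateSpace R A D v →ₗ[R] StateSpace R A D w) (x : StateSpace R A D v)
    (y : StateSpace R A D w) : Prop := ∀ z, f (x * z) = y * f z

theorem Intertwines.add {x x' : StateSpace R A D v} {y y' : StateSpace R A D w}
    (h : Intertwines f x y) (h' : Intertwines f x' y') : Intertwines f (x + x') (y + y') := by
  intro z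
  rw [add_mul, map_add, h, h', add_mul]

theorem Intertwines.sub {x x' : StateSpace R A D v} {y y' : StateSpace R A D w}
    (h : Intertwines f x y) (h' : Intertwines f x' y') : Intertwines f (x - x') (y - y') := by
  intro z
  rw [sub_mul, map_sub, h, h', sub_mul]

theorem Intertwines.mul {x x' : StateSpace R A D v} {y y' : StateSpace R A D w}
    (h : Intertwines f x y) (h' : Intertwines f x' y') : Intertwines f (x * x') (y * y') := by
  intro z
  rw [mul_assoc, h, h', mul_assoc]

theorem Intertwines.one : Intertwines f 1 1 := fun z => by rw [one_mul, one_mul]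

theorem Intertwines.pow {x : StateSpace R A D v} {y : StateSpace R A D w}
    (h : Intertwines f x y) (n : ℕ) : Intertwines f (x ^ n) (y ^ n) := by
  induction n with
  | zero => rw [pow_zero, pow_zero]; exact Intertwines.one
  | succ n ih => rw [pow_succ, pow_succ]; exact ih.mul h

theorem Intertwines.prod {ι : Type*} {s : Finset ι} {x : ι → StateSpace R A D v}
    {y : ι → StateSpace R A D w} (h : ∀ i ∈ s, Intertwines f (x i) (y i)) :
    Intertwines f (∏ i ∈ s, x i) (∏ i ∈ s, y i) := by
  classical
  induction s using Finset.induction_on with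
  | empty => exact Intertwines.one
  | insert i s hi ih =>
    rw [Finset.prod_insert hi, Finset.prod_insert hi]
    exact (h i (Finset.mem_insert_self i s)).mul (ih fun j hj => h j (Finset.mem_insert_of_mem hj))

theorem IsLocal.label (hf : IsLocal f) (d : Dart D.n) (a : A) :
    Intertwines f (Khovanov.label R A (D.comp v d) a) (Khovanov.label R A (D.comp w d) a) :=
  hf.1 d a

theorem IsLocal.strand (hf : IsLocal f) (a : A) :
    Intertwines f (Khovanov.label R A (D.strand v) a) (Khovanov.label R A (D.strand w) a) :=
  hf.1 _ a

end intertwines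

namespace FrobeniusSystem

variable {R A : Type*} [CommRing R] [CommRing A] [Algebra R A] (F : FrobeniusSystem R A)
  {D : TangleDiagram} {v w : Finset (Fin D.n)} {c : Fin D.n}

variable (v) in
/-- The quotient of the twisting elements at the component through `d` and at the special strand. -/
noncomputable def relTwist (d : Dart D.n) : StateSpace R A D v :=
  label R A (D.strand v) F.twistInv * label R A (D.comp v d) F.twist

variable (v) in
/-- The inverse of `relTwist`. -/
noncomputable def relTwistInv (d : Dart D.n) : StateSpace R A D v :=
  label R A (D.strand v) F.twist * label R A (D.comp v d) F.twistInv

theorem label_twist_mul (k : D.Comp v) : label R A k F.twist * label R A k F.twistInv = 1 := by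
  rw [← map_mul, F.twist_mul_twistInv, map_one]

theorem relTwist_mul_relTwistInv (d : Dart D.n) : F.relTwist v d * F.relTwistInv v d = 1 := by
  rw [relTwist, relTwistInv, mul_mul_mul_comm, mul_comm (label R A _ F.twistInv), label_twist_mul,
    label_twist_mul, one_mul]

variable (v) in
/-- The product of powers of twisting elements with given exponents. -/
noncomputable def twistProd (W : Dart D.n → ℕ) : StateSpace R A D v := ∏ d, F.relTwist v d ^ W d

variable (v) in
/-- The inverse of `twistProd`. -/
noncomputable def twistProdInv (W : Dart D.n → ℕ) : StateSpace R A D v :=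
  ∏ d, F.relTwistInv v d ^ W d

theorem twistProd_mul_twistProdInv (W : Dart D.n → ℕ) :
    F.twistProd v W * F.twistProdInv v W = 1 := by
  rw [twistProd, twistProdInv, ← Finset.prod_mul_distrib]
  refine Finset.prod_eq_one fun d _ => ?_
  rw [← mul_pow, relTwist_mul_relTwistInv, one_pow]

theorem intertwines_twistProd {f : StateSpace R A D v →ₗ[R] StateSpace R A D w} (hf : IsLocal f)
    (W : Dart D.n → ℕ) : Intertwines f (F.twistProd v W) (F.twistProd w W) :=
  Intertwines.prod fun d _ => ((hf.strand _).mul (hf.label d _)).pow _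

/-! ### Delooping is a map of complexes -/

theorem intertwines_diffGen {f : StateSpace R A D v →ₗ[R] StateSpace R A D w} (hf : IsLocal f)
    (d : Dart D.n) : Intertwines f (F.diffGen (D.comp v d)) (F.diffGen (D.comp w d)) :=
  (hf.strand _).mul ((hf.label d _).sub (hf.strand _))

theorem intertwines_diffGen_loop {f : StateSpace R A D v →ₗ[R] StateSpace R A D w} (hf : IsLocal f)
    (l : Fin D.loops) :
    Intertwines f (F.diffGen (v := v) (Sum.inr l)) (F.diffGen (v := w) (Sum.inr l)) :=
  (hf.strand _).mul (Intertwines.sub (hf.2 l _) (hf.strand _))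

theorem intertwines_deloop {f : StateSpace R A D v →ₗ[R] StateSpace R A D w} (hf : IsLocal f)
    {k : D.Comp v} {k' : D.Comp w} (hk : Intertwines f (F.diffGen k) (F.diffGen k')) (a : AZG) :
    Intertwines f (F.deloop D v (label _ _ k a)) (F.deloop D w (label _ _ k' a)) := by
  rw [deloop_label, deloop_label]
  exact (hf.strand _).add ((hf.strand _).mul hk)

theorem pairLabel_comul_one (k l : D.Comp w) : pairLabel k l (F.comul 1) =
    label R A k F.twist * (label R A k F.gen + label R A l F.gen - algebraMap R _ F.relH) := by
  rw [F.comul_one, map_mul, map_sub, map_add, map_smul, pairLabel]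
  simp only [Algebra.TensorProduct.lift_tmul, map_one, one_mul, mul_one]
  rw [Algebra.smul_def, mul_one, add_comm (label R A l F.gen)]

theorem deloop_pairLabel_comul_one (k l : D.Comp w) :
    F.deloop D w (pairLabel k l (zg.comul 1)) = label R A (D.strand w) F.twist *
      (label R A k F.gen + label R A l F.gen - algebraMap R _ F.relH) := by
  have h : zg.comul 1 = (1 : AZG) ⊗ₜ[Polynomial ℤ] QuadraticAlgebra.omega +
      QuadraticAlgebra.omega ⊗ₜ 1 - (-Polynomial.X : Polynomial ℤ) • (1 ⊗ₜ 1) :=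
    quadraticComul_one _ _
  have hX : F.deloop D w (algebraMap (Polynomial ℤ) _ Polynomial.X) =
      label R A (D.strand w) (F.curtain 1) := by
    rw [← AlgHom.commutes (label (Polynomial ℤ) AZG (D.strand w)), deloop_label, strandHom_apply,
      ← curtainHom_X]
    simp
  rw [h, map_sub, map_add, map_smul, pairLabel]
  simp only [Algebra.TensorProduct.lift_tmul, map_one, one_mul, mul_one]
  rw [Algebra.smul_def, mul_one, map_sub, map_add, map_neg, map_neg, hX]
  have hg : ∀ k : D.Comp w, F.deloop D w (label _ _ k QuadraticAlgebra.omega) = F.diffGen k :=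
    F.deloop_stateGen
  rw [hg, hg, label_curtain_one, diffGen, diffGen]
  ring

theorem twistProd_of_not_splits (hs : ¬ D.Splits v c) (hc : c ∉ v) :
    F.twistProd (insert c v) (weight v) = F.twistProd (insert c v) (weight (insert c v)) := by
  have h := prod_pow_mul_eq (D.conn (insert c v)) (η := F.relTwist (insert c v)) (B := 1)
    (fun d e hde => by rw [relTwist, relTwist, D.comp_eq.2 hde]) (sum_weight_of_not_splits hs hc)
  rwa [mul_one, mul_one] at h

theorem twistProd_of_splits (hs : D.Splits v c) (hc : c ∉ v) :
    F.twistProd (insert c v) (weight (insert c v)) * pairLabel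
      (D.comp (insert c v) (D.corner c 0)) (D.comp (insert c v) (D.corner c 2)) (F.comul 1) =
    F.twistProd (insert c v) (weight v) * F.relTwist (insert c v) (D.corner c 0) * pairLabel
      (D.comp (insert c v) (D.corner c 0)) (D.comp (insert c v) (D.corner c 2)) (F.comul 1) := by
  classical
  have r := hs.refines hc
  have hB : ∀ a, label R A (D.comp (insert c v) (D.corner c 0)) a * pairLabel
      (D.comp (insert c v) (D.corner c 0)) (D.comp (insert c v) (D.corner c 2)) (F.comul 1) =
      label R A (D.comp (insert c v) (D.corner c 2)) a * pairLabel
      (D.comp (insert c v) (D.corner c 0)) (D.comp (insert c v) (D.corner c 2)) (F.comul 1) :=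
    fun a => (F.leg_comul_mul _ _ a 1).1.symm.trans (F.leg_comul_mul _ _ a 1).2
  have h := prod_pow_mul_eq (D.conn v) (η := F.relTwist (insert c v))
    (B := pairLabel (D.comp (insert c v) (D.corner c 0)) (D.comp (insert c v) (D.corner c 2))
      (F.comul 1)) (W := weight (insert c v))
    (W' := fun d => weight v d + if d = D.corner c 0 then 1 else 0) (by
      intro d e hde
      rw [relTwist, relTwist, mul_assoc, mul_assoc]
      rcases r.ge _ _ (D.comp_eq.2 hde) with h | ⟨h1, h2⟩ | ⟨h1, h2⟩
      · rw [h]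
      · rw [h1, h2, hB]
      · rw [h1, h2, hB]) (by
      intro x
      rw [sum_weight_of_splits hs hc, Finset.sum_add_distrib, Finset.sum_ite_eq']
      simp)
  rw [twistProd, h, twistProd]
  simp only [pow_add, Finset.prod_mul_distrib]
  congr 2
  rw [Finset.prod_eq_single (D.corner c 0)]
  · rw [if_pos rfl, pow_one]
  · intro d _ hd; rw [if_neg hd, pow_zero]
  · simp

/-- The correction factors make delooping commute with the saddles. -/
theorem twistProd_mul_deloop_saddle_one (hc : c ∉ v) :
    F.twistProd (insert c v) (weight (insert c v)) *
      F.deloop D (insert c v) (zg.saddle v (insert c v) c 1) =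
    F.twistProd (insert c v) (weight v) * F.saddle v (insert c v) c 1 := by
  rw [saddle_one, saddle_one]
  by_cases hs : D.Splits v c
  · have h := F.twistProd_of_splits hs hc
    rw [if_pos hs, if_pos hs, deloop_pairLabel_comul_one]
    rw [pairLabel_comul_one, relTwist] at h
    rw [pairLabel_comul_one]
    have h0 := F.label_twist_mul (D.comp (insert c v) (D.corner c 0))
    have h1 := F.label_twist_mul (D.strand (insert c v))
    generalize label R A (D.comp (insert c v) (D.corner c 0)) F.gen +
      label R A (D.comp (insert c v) (D.corner c 2)) F.gen - algebraMap R _ F.relH = B at *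
    generalize label R A (D.comp (insert c v) (D.corner c 0)) F.twist = a at *
    generalize label R A (D.comp (insert c v) (D.corner c 0)) F.twistInv = a' at *
    generalize label R A (D.strand (insert c v)) F.twist = b at *
    generalize label R A (D.strand (insert c v)) F.twistInv = b' at *
    generalize F.twistProd (insert c v) (weight (insert c v)) = P at *
    generalize F.twistProd (insert c v) (weight v) = Q at *
    linear_combination b * a' * h - b * P * B * h0 + Q * a * B * (a * a') * h1 + Q * a * B * h0
  · rw [if_neg hs, if_neg hs, map_one, F.twistProd_of_not_splits hs hc]

variable (D v) in
/-- The delooping map, with the correction factor. -/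
noncomputable def deloopMap (x : StateSpace (Polynomial ℤ) AZG D v) : StateSpace R A D v :=
  F.twistProd v (weight v) * F.deloop D v x

theorem deloopMap_saddle (hc : c ∉ v) (hw : w = insert c v)
    (x : StateSpace (Polynomial ℤ) AZG D v) :
    F.deloopMap D w (zg.saddle v w c x) = F.saddle v w c (F.deloopMap D v x) := by
  subst hw
  have hz := zg.saddle_isLocal hc rfl
  have hf := F.saddle_isLocal hc rfl
  have step : ∀ {k : D.Comp v} {k' : D.Comp (insert c v)} {a : AZG}
      {x : StateSpace (Polynomial ℤ) AZG D v},
      zg.saddle v (insert c v) c (label _ _ k a * x) =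
        label _ _ k' a * zg.saddle v (insert c v) c x →
      Intertwines (F.saddle v (insert c v) c) (F.diffGen k) (F.diffGen k') →
      F.deloopMap D (insert c v) (zg.saddle v (insert c v) c x) =
        F.saddle v (insert c v) c (F.deloopMap D v x) →
      F.deloopMap D (insert c v) (zg.saddle v (insert c v) c (label _ _ k a * x)) =
        F.saddle v (insert c v) c (F.deloopMap D v (label _ _ k a * x)) := by
    intro k k' a x h1 h2 h3
    rw [deloopMap, deloopMap] at h3
    rw [h1, deloopMap, deloopMap, map_mul (F.deloop D v), map_mul (F.deloop D (insert c v)),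
      mul_left_comm, h3, mul_left_comm, F.intertwines_deloop hf h2]
  induction x using state_induction with
  | hadd x y hx hy =>
    rw [deloopMap, deloopMap] at hx hy ⊢
    rw [map_add, map_add, mul_add, map_add, mul_add, map_add, hx, hy]
  | hpure a =>
    rw [pure_eq_prod]
    induction (Finset.univ : Finset (D.Comp v)) using Finset.induction_on with
    | empty =>
      rw [Finset.prod_empty, deloopMap, deloopMap, map_one (F.deloop D v),
        F.twistProd_mul_deloop_saddle_one hc, F.intertwines_twistProd hf]
    | insert k s hk ih =>
      rw [Finset.prod_insert hk]
      rcases k with q | l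
      · rw [← TangleDiagram.comp_out]
        exact step (hz.1 _ _ _) (F.intertwines_diffGen hf _) ih
      · exact step (hz.2 _ _ _) (F.intertwines_diffGen_loop hf _) ih

end FrobeniusSystem

/-! ### Delooping preserves degrees -/

theorem IsMulDeg.prod_mem {S : Type*} [CommRing S] {q : ℤ → AddSubgroup S} (hq : IsMulDeg q)
    {ι : Type*} {s : Finset ι} {f : ι → S} {m : ι → ℤ} (h : ∀ i ∈ s, f i ∈ q (m i)) :
    ∏ i ∈ s, f i ∈ q (∑ i ∈ s, m i) := by
  classical
  induction s using Finset.induction_on with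
  | empty => simpa using hq.one_mem
  | insert i s hi ih =>
    rw [Finset.prod_insert hi, Finset.sum_insert hi]
    exact hq.mul_mem (h i (Finset.mem_insert_self i s))
      (ih fun j hj => h j (Finset.mem_insert_of_mem hj))

theorem IsMulDeg.pow_mem {S : Type*} [CommRing S] {q : ℤ → AddSubgroup S} (hq : IsMulDeg q)
    {x : S} (hx : x ∈ q 0) (n : ℕ) : x ^ n ∈ q 0 := by
  induction n with
  | zero => rw [pow_zero]; exact hq.one_mem
  | succ n ih => rw [pow_succ]; exact mem_deg_cast (hq.mul_mem ih hx) (add_zero 0)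

namespace FrobeniusSystem

variable {R A : Type*} [CommRing R] [CommRing A] [Algebra R A] (F : FrobeniusSystem R A)
  {D : TangleDiagram} {v w : Finset (Fin D.n)} {c : Fin D.n}

variable (v) in
/-- The grading of the state space as a ring: the unit has degree `0`. -/
noncomputable def ringDeg (k : ℤ) : AddSubgroup (StateSpace R A D v) :=
  F.stateDeg v (k + Fintype.card (D.Comp v))

theorem isMulDeg_ringDeg : IsMulDeg (F.ringDeg v) where
  one_mem := by rw [ringDeg, zero_add]; exact F.one_mem_stateDeg
  mul_mem := F.mul_mem_stateDeg

theorem label_mem_ringDeg {k : D.Comp v} {m : ℤ} {a : A} (ha : a ∈ F.degA m) :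
    label R A k a ∈ F.ringDeg v m := F.label_mem_stateDeg ha

/-- An additive map that sends the degrees of pure tensors correctly preserves degrees. -/
theorem map_mem_of_mem_ringDeg {B : Type*} [AddCommGroup B] (f : StateSpace R A D v →+ B)
    {T : ℤ → AddSubgroup B} {k : ℤ}
    (h : ∀ (a : D.Comp v → A) (m : D.Comp v → ℤ), (∀ j, a j ∈ F.degA (m j)) →
      f (∏ j, label R A j (a j)) ∈ T (∑ j, m j)) {x : StateSpace R A D v}
    (hx : x ∈ F.ringDeg v k) : f x ∈ T k := by
  rw [ringDeg] at hx
  induction hx using AddSubgroup.closure_induction with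
  | mem x hx =>
    obtain ⟨a, m, ha, hm, rfl⟩ := hx
    rw [pure_eq_prod]
    refine mem_deg_cast (h a m ha) ?_
    rw [Finset.sum_add_distrib, Finset.sum_const, Finset.card_univ, nsmul_eq_mul, mul_one] at hm
    linarith
  | zero => rw [map_zero]; exact zero_mem _
  | add x y _ _ hx hy => rw [map_add]; exact add_mem hx hy
  | neg x _ hx => rw [map_neg]; exact neg_mem hx

theorem hom_mem_of_mem_ringDeg {B : Type*} [CommRing B] (f : StateSpace R A D v →+* B)
    {T : ℤ → AddSubgroup B} (hT : IsMulDeg T) {k : ℤ}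
    (h : ∀ (j : D.Comp v) (a : A) (m : ℤ), a ∈ F.degA m → f (label R A j a) ∈ T m)
    {x : StateSpace R A D v} (hx : x ∈ F.ringDeg v k) : f x ∈ T k := by
  refine F.map_mem_of_mem_ringDeg f.toAddMonoidHom (fun a m ha => ?_) hx
  change f (∏ j, label R A j (a j)) ∈ _
  rw [map_prod]
  exact hT.prod_mem fun j _ => h j _ _ (ha j)

theorem strandHom_mem {p : Polynomial ℤ} {k : ℤ} (hp : p ∈ degZG k) :
    F.strandHom D v p ∈ F.ringDeg v k := F.label_mem_ringDeg (F.curtainHom_mem hp)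

theorem diffGen_mem (k : D.Comp v) : F.diffGen k ∈ F.ringDeg v (-2) :=
  mem_deg_cast (F.isMulDeg_ringDeg.mul_mem (F.label_mem_ringDeg F.twist_mem)
    (sub_mem (F.label_mem_ringDeg F.gen_mem_degA) (F.label_mem_ringDeg F.gen_mem_degA)))
    (zero_add (-2))

theorem deloop_mem {x : StateSpace (Polynomial ℤ) AZG D v} {k : ℤ} (hx : x ∈ zg.ringDeg v k) :
    F.deloop D v x ∈ F.ringDeg v k := by
  refine zg.hom_mem_of_mem_ringDeg (F.deloop D v) F.isMulDeg_ringDeg (fun j a m ha => ?_) hx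
  rw [deloop_label]
  have h0 : a.re ∈ degZG m := ha.1
  have h1 : a.im ∈ degZG (m + 2) := ha.2
  exact add_mem (F.strandHom_mem h0) (mem_deg_cast
    (F.isMulDeg_ringDeg.mul_mem (F.strandHom_mem h1) (F.diffGen_mem j)) (by ring))

theorem twistProd_mem (W : Dart D.n → ℕ) : F.twistProd v W ∈ F.ringDeg v 0 := by
  have h := F.isMulDeg_ringDeg.prod_mem (s := Finset.univ) (f := fun d => F.relTwist v d ^ W d)
    (m := fun _ => 0) fun d _ => F.isMulDeg_ringDeg.pow_mem (mem_deg_cast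
      (F.isMulDeg_ringDeg.mul_mem (F.label_mem_ringDeg F.twistInv_mem)
        (F.label_mem_ringDeg F.twist_mem)) (add_zero 0)) (W d)
  exact mem_deg_cast h (by simp)

theorem twistProdInv_mem (W : Dart D.n → ℕ) : F.twistProdInv v W ∈ F.ringDeg v 0 := by
  have h := F.isMulDeg_ringDeg.prod_mem (s := Finset.univ) (f := fun d => F.relTwistInv v d ^ W d)
    (m := fun _ => 0) fun d _ => F.isMulDeg_ringDeg.pow_mem (mem_deg_cast
      (F.isMulDeg_ringDeg.mul_mem (F.label_mem_ringDeg F.twist_mem)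
        (F.label_mem_ringDeg F.twistInv_mem)) (add_zero 0)) (W d)
  exact mem_deg_cast h (by simp)

variable [Algebra AZG A]

theorem isMulDeg_tensorDeg :
    IsMulDeg (tensorDeg (S := AZG) F.degA (zg.ringDeg v) : ℤ → AddSubgroup (A ⊗[AZG] StateSpace (Polynomial ℤ) AZG D v)) where
  one_mem := tmul_mem_tensorDeg F.one_mem_degA zg.isMulDeg_ringDeg.one_mem (add_zero 0)
  mul_mem {i j x y} hx hy := by
    refine map_mem_of_mem_tensorDeg (AddMonoidHom.mulRight y) _ (fun a b hab m hm n hn => ?_) hx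
    refine map_mem_of_mem_tensorDeg (AddMonoidHom.mulLeft (m ⊗ₜ[AZG] n)) _
      (fun a' b' hab' m' hm' n' hn' => ?_) hy
    change (m ⊗ₜ[AZG] n) * (m' ⊗ₜ[AZG] n') ∈ _
    rw [Algebra.TensorProduct.tmul_mul_tmul]
    exact tmul_mem_tensorDeg (F.mul_mem_degA hm hm') (zg.isMulDeg_ringDeg.mul_mem hn hn')
      (by omega)

theorem algebraMap_mem_tensorDeg {a : A} {k : ℤ} (ha : a ∈ F.degA k) :
    algebraMap A (A ⊗[AZG] StateSpace (Polynomial ℤ) AZG D v) a ∈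
      tensorDeg F.degA (zg.ringDeg v) k :=
  tmul_mem_tensorDeg ha zg.isMulDeg_ringDeg.one_mem (add_zero k)

theorem reloop_mem (hA : ∀ a, algebraMap AZG A a = F.curtainHom (reduceHom a))
    {x : StateSpace R A D v} {k : ℤ} (hx : x ∈ F.ringDeg v k) :
    F.reloop D v hA x ∈ tensorDeg F.degA (zg.ringDeg v) k := by
  refine F.hom_mem_of_mem_ringDeg (F.reloop D v hA) F.isMulDeg_tensorDeg (fun j a m ha => ?_) hx
  rw [reloop_label]
  change reloopScalar R A D v (F.basis.coord 0 a) + reloopScalar R A D v (F.basis.coord 1 a) *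
    F.reloopGen j ∈ _
  obtain ⟨h0, h1⟩ := F.mem_degA.1 ha
  have hs : ∀ {r l}, r ∈ F.deg l →
      reloopScalar R A D v r ∈ tensorDeg F.degA (zg.ringDeg v) l := by
    intro r l hr
    refine F.algebraMap_mem_tensorDeg (a := algebraMap R A r) ?_
    rw [Algebra.algebraMap_eq_smul_one]
    exact F.smul_one_mem_degA hr
  have hX : (QuadraticAlgebra.omega : AZG) ∈ zg.degA (-2) := by
    have h := zg.gen_mem_degA
    rwa [gen, show zg.basis 1 = QuadraticAlgebra.omega from (basis_quadratic _ _).2] at h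
  have hg : F.reloopGen j ∈ tensorDeg F.degA (zg.ringDeg v) (-2) :=
    add_mem (tmul_mem_tensorDeg F.gen_mem_degA zg.isMulDeg_ringDeg.one_mem (add_zero _))
      (tmul_mem_tensorDeg F.twistInv_mem (zg.label_mem_ringDeg hX) (zero_add _))
  exact add_mem (hs h0) (mem_deg_cast (F.isMulDeg_tensorDeg.mul_mem (hs h1) hg) (by ring))

variable (D v) in
/-- The delooping isomorphism of a state space, with the correction factor. -/
noncomputable def stateEquiv (hA : ∀ a, algebraMap AZG A a = F.curtainHom (reduceHom a)) :
    A ⊗[AZG] StateSpace (Polynomial ℤ) AZG D v ≃ₗ[A] StateSpace R A D v where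
  toFun x := F.twistProd v (weight v) * F.deloopEquiv D v hA x
  map_add' x y := by rw [map_add, mul_add]
  map_smul' a x := by rw [map_smul, RingHom.id_apply, mul_smul_comm]
  invFun y := (F.deloopEquiv D v hA).symm (F.twistProdInv v (weight v) * y)
  left_inv x := by
    beta_reduce
    rw [← mul_assoc, mul_comm (F.twistProdInv _ _), F.twistProd_mul_twistProdInv, one_mul,
      AlgEquiv.symm_apply_apply]
  right_inv y := by
    beta_reduce
    rw [AlgEquiv.apply_symm_apply, ← mul_assoc, F.twistProd_mul_twistProdInv, one_mul]

theorem stateEquiv_tmul (hA : ∀ a, algebraMap AZG A a = F.curtainHom (reduceHom a)) (a : A)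
    (x : StateSpace (Polynomial ℤ) AZG D v) :
    F.stateEquiv D v hA (a ⊗ₜ x) = a • F.deloopMap D v x := by
  change F.twistProd v (weight v) * F.deloopHom D v hA (a ⊗ₜ x) = _
  rw [deloopHom_tmul, smul_state_def, smul_state_def, deloopMap, mul_left_comm]

theorem stateEquiv_mem_iff (hA : ∀ a, algebraMap AZG A a = F.curtainHom (reduceHom a)) {k : ℤ}
    (x : A ⊗[AZG] StateSpace (Polynomial ℤ) AZG D v) :
    F.stateEquiv D v hA x ∈ F.stateDeg v k ↔ x ∈ tensorDeg F.degA (zg.stateDeg v) k := by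
  have hdeg : ∀ k, F.stateDeg v k = F.ringDeg v (k - Fintype.card (D.Comp v)) := fun k => by
    rw [ringDeg, sub_add_cancel]
  constructor
  · intro hx
    rw [hdeg] at hx
    have h1 : x = F.reloop D v hA (F.twistProdInv v (weight v) * F.stateEquiv D v hA x) :=
      ((F.stateEquiv D v hA).symm_apply_apply x).symm
    have h2 := F.reloop_mem hA (F.isMulDeg_ringDeg.mul_mem (F.twistProdInv_mem (weight v)) hx)
    rw [h1]
    refine map_mem_of_mem_tensorDeg (AddMonoidHom.id _) _ (fun a b hab m hm n hn => ?_) h2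
    exact tmul_mem_tensorDeg hm hn (by omega)
  · intro hx
    refine map_mem_of_mem_tensorDeg (F.stateEquiv D v hA).toLinearMap.toAddMonoidHom _
      (fun a b hab m hm n hn => ?_) hx
    change F.stateEquiv D v hA (m ⊗ₜ n) ∈ _
    have hn' : n ∈ zg.ringDeg v (b - Fintype.card (D.Comp v)) := by
      rwa [ringDeg, sub_add_cancel]
    rw [stateEquiv_tmul, smul_state_def, deloopMap, hdeg]
    exact mem_deg_cast (F.isMulDeg_ringDeg.mul_mem (F.label_mem_ringDeg hm)
      (F.isMulDeg_ringDeg.mul_mem (F.twistProd_mem (weight v)) (F.deloop_mem hn'))) (by omega)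

end FrobeniusSystem

/-! ### The isomorphism of complexes -/

/-- The degrees of a finite product of modules, after extension of scalars. -/
theorem piRight_mem_iff {S S' ι : Type*} [CommRing S] [CommRing S'] [Algebra S S'] [Fintype ι]
    [DecidableEq ι] (M : ι → Type*) [∀ i, AddCommGroup (M i)] [∀ i, Module S (M i)]
    (p : ℤ → AddSubgroup S') (q : ∀ i, ℤ → AddSubgroup (M i)) (k : ℤ) (x : S' ⊗[S] ∀ i, M i) :
    (∀ i, TensorProduct.piRight S S' S' M x i ∈ tensorDeg p (q i) k) ↔
      x ∈ tensorDeg p (fun l => AddSubgroup.pi Set.univ fun i => q i l) k := by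
  constructor
  · intro h
    have hx : x = ∑ i, (LinearMap.single S M i).lTensor S' (TensorProduct.piRight S S' S' M x i) := by
      apply (TensorProduct.piRight S S' S' M).injective
      generalize TensorProduct.piRight S S' S' M x = y
      rw [map_sum]
      funext j
      rw [Finset.sum_apply]
      have hone : ∀ i (z : S' ⊗[S] M i), TensorProduct.piRight S S' S' M
          ((LinearMap.single S M i).lTensor S' z) = Pi.single i z := by
        intro i z
        exact addHom_eq_of_tmul (f := ((TensorProduct.piRight S S' S' M).toLinearMap.restrictScalars S
          ∘ₗ (LinearMap.single S M i).lTensor S').toAddMonoidHom)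
          (g := AddMonoidHom.single (fun i => S' ⊗[S] M i) i) (fun a m => by
            funext l
            change a ⊗ₜ[S] (Pi.single i m : ∀ i, M i) l = (Pi.single i (a ⊗ₜ[S] m) : ∀ i, S' ⊗[S] M i) l
            by_cases hl : l = i
            · subst hl; simp
            · simp [hl]) z
      simp only [hone]
      rw [Finset.sum_pi_single]
      simp
    rw [hx]
    refine sum_mem fun i _ => ?_
    refine map_mem_of_mem_tensorDeg ((LinearMap.single S M i).lTensor S').toAddMonoidHom _
      (fun a b hab s hs m hm => ?_) (h i)
    change s ⊗ₜ[S] (Pi.single i m : ∀ i, M i) ∈ _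
    refine tmul_mem_tensorDeg hs ?_ hab
    rw [AddSubgroup.mem_pi]
    intro j _
    by_cases hj : j = i
    · subst hj; simpa using hm
    · rw [Pi.single_eq_of_ne hj]; exact zero_mem _
  · intro hx i
    refine map_mem_of_mem_tensorDeg ((LinearMap.proj (R := S') (φ := fun i => S' ⊗[S] M i) i).toAddMonoidHom.comp
      (TensorProduct.piRight S S' S' M).toLinearMap.toAddMonoidHom) _
      (fun a b hab s hs m hm => ?_) hx
    exact tmul_mem_tensorDeg hs (hm i (Set.mem_univ i)) hab

namespace FrobeniusSystem

variable {R A : Type*} [CommRing R] [CommRing A] [Algebra R A] (F : FrobeniusSystem R A)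

theorem deloopMap_chainD {D : TangleDiagram} {i : ℤ} (y : ChainGroup (Polynomial ℤ) AZG D i)
    (w : {v : Finset (Fin D.n) // (v.card : ℤ) = i + 1 + D.nNeg}) :
    F.deloopMap D w.1 (zg.chainD D i y w) =
      F.chainD D i (fun v : {v : Finset (Fin D.n) // (v.card : ℤ) = i + D.nNeg} =>
        F.deloopMap D v.1 (y v)) w := by
  change F.deloopMap D w.1 (∑ c : {c // c ∈ w.1}, edgeSign w.1 c.1 • zg.saddle (w.1.erase c.1) w.1
      c.1 (y ⟨w.1.erase c.1, card_erase_state w.2 c.2⟩)) =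
    ∑ c : {c // c ∈ w.1}, edgeSign w.1 c.1 • F.saddle (w.1.erase c.1) w.1 c.1
      (F.deloopMap D _ (y ⟨w.1.erase c.1, card_erase_state w.2 c.2⟩))
  rw [deloopMap, map_sum, Finset.mul_sum]
  refine Finset.sum_congr rfl fun c _ => ?_
  rw [map_zsmul, mul_smul_comm, ← deloopMap, F.deloopMap_saddle (Finset.notMem_erase c.1 w.1)
    (Finset.insert_erase c.2).symm]

/-- The complex of `F` is obtained by extension of scalars from the one over `ℤ[G]`. -/
noncomputable def complexIso (D : TangleDiagram) :
    ((zg.complex D).baseChange (F.curtainHom.comp reduceHom) F.degA).Iso (F.complex D) :=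
  letI := (F.curtainHom.comp reduceHom).toAlgebra
  have hA : ∀ a : AZG, algebraMap AZG A a = F.curtainHom (reduceHom a) := fun _ => rfl
  { e := fun i => (TensorProduct.piRight AZG A A
        (fun v : {v : Finset (Fin D.n) // (v.card : ℤ) = i + D.nNeg} =>
          StateSpace (Polynomial ℤ) AZG D v.1)).trans
        (LinearEquiv.piCongrRight fun v => F.stateEquiv D v.1 hA)
    comm := fun i x => by
      refine addHom_eq_of_tmul
        (f := (LinearEquiv.piCongrRight fun v : {v : Finset (Fin D.n) //
            (v.card : ℤ) = i + 1 + D.nNeg} => F.stateEquiv D v.1 hA).toLinearMap.toAddMonoidHom.comp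
          (((TensorProduct.piRight AZG A A (fun v : {v : Finset (Fin D.n) //
            (v.card : ℤ) = i + 1 + D.nNeg} =>
              StateSpace (Polynomial ℤ) AZG D v.1)).toLinearMap.toAddMonoidHom).comp
            ((zg.chainD D i).baseChange A).toAddMonoidHom))
        (g := (F.chainD D i).toAddMonoidHom.comp
          ((LinearEquiv.piCongrRight fun v : {v : Finset (Fin D.n) //
            (v.card : ℤ) = i + D.nNeg} => F.stateEquiv D v.1 hA).toLinearMap.toAddMonoidHom.comp
          (TensorProduct.piRight AZG A A (fun v : {v : Finset (Fin D.n) //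
            (v.card : ℤ) = i + D.nNeg} =>
              StateSpace (Polynomial ℤ) AZG D v.1)).toLinearMap.toAddMonoidHom))
        (fun a y => ?_) x
      funext w
      change F.stateEquiv D w.1 hA (a ⊗ₜ zg.chainD D i y w) =
        F.chainD D i (fun v => F.stateEquiv D v.1 hA (a ⊗ₜ y v)) w
      simp only [stateEquiv_tmul]
      rw [F.deloopMap_chainD]
      exact (congrFun ((F.chainD D i).map_smul a fun v => F.deloopMap D v.1 (y v)) w).symm
    mem_deg_iff := fun i k x => by
      refine Iff.trans ?_ (piRight_mem_iff (S := AZG) _ F.degA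
        (fun (v : {v : Finset (Fin D.n) // (v.card : ℤ) = i + D.nNeg}) l =>
          zg.stateDeg v.1 (l - (v.1.card + D.nPos - 2 * D.nNeg))) k x)
      refine (AddSubgroup.mem_pi _).trans ?_
      refine forall_congr' fun v => ?_
      rw [tensorDeg_shift F.degA (zg.stateDeg v.1)]
      exact ⟨fun h => (F.stateEquiv_mem_iff hA _).1 (h (Set.mem_univ v)),
        fun h _ => (F.stateEquiv_mem_iff hA _).2 h⟩ }

end FrobeniusSystem

/-! ### The theorem -/

theorem isMulDeg_degZG : IsMulDeg degZG := ⟨one_mem_degZG, mul_mem_degZG⟩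

/-- The complex of `F` as a base change of `⟦D⟧`, where the two quantum shifts cancel. -/
noncomputable def bracketIso {R A : Type*} [CommRing R] [CommRing A] [Algebra R A]
    (F : FrobeniusSystem R A) (D : TangleDiagram) :
    (((bracket D).baseChange F.curtainHom F.degA).shift 1).Iso (F.complex D) :=
  ((QComplex.Iso.baseChangeShift ((zg.complex D).baseChange reduceHom degZG) F.curtainHom F.degA
    (-1)).shift 1).trans <|
  (QComplex.Iso.shiftCancel _ (by norm_num)).trans <|
  (QComplex.Iso.baseChangeComp (zg.complex D) reduceHom F.curtainHom isMulDeg_degZG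
    F.isMulDeg_degA fun _ _ hs => F.curtainHom_mem hs).trans (F.complexIso D)

theorem univ_curtain_one : univ.curtain 1 =
    2 * QuadraticAlgebra.omega - algebraMap RUniv AUniv hUniv := by
  have h : univ.comul 1 = (1 : AUniv) ⊗ₜ[RUniv] QuadraticAlgebra.omega +
      QuadraticAlgebra.omega ⊗ₜ 1 - hUniv • (1 ⊗ₜ 1) := quadraticComul_one _ _
  rw [FrobeniusSystem.curtain, LinearMap.comp_apply, h, map_sub, map_add, map_smul,
    LinearMap.mul'_apply, LinearMap.mul'_apply, LinearMap.mul'_apply, one_mul, mul_one, mul_one,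
    Algebra.algebraMap_eq_smul_one, two_mul]

theorem univToZG_comp_curtainHom : univToZG.comp univ.curtainHom = RingHom.id (Polynomial ℤ) := by
  refine Polynomial.ringHom_ext' (RingHom.ext_int _ _) ?_
  rw [RingHom.comp_apply, FrobeniusSystem.curtainHom_X, univ_curtain_one, RingHom.id_apply]
  change baseHom _ = _
  simp [baseHom, hUniv]

theorem baseHom_mem {k : ℤ} {p : RUniv} (hp : p ∈ degUniv k) : baseHom p ∈ degZG k := by
  change MvPolynomial.aeval ![-Polynomial.X, 0] p ∈ _
  rw [MvPolynomial.aeval_def, MvPolynomial.eval₂_eq']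
  refine sum_mem fun d hd => ?_
  rw [← Algebra.smul_def]
  refine zsmul_mem ?_ _
  have hk : Finsupp.weight ![(-2 : ℤ), -4] d = k := hp (MvPolynomial.mem_support_iff.1 hd)
  rw [Finsupp.weight_apply, Finsupp.sum_fintype _ _ (by simp)] at hk
  simp only [Fin.sum_univ_two, Matrix.cons_val_zero, Matrix.cons_val_one,
    nsmul_eq_mul] at hk
  rw [Fin.prod_univ_two]
  simp only [Matrix.cons_val_zero, Matrix.cons_val_one]
  rcases Nat.eq_zero_or_pos (d 1) with h0 | h0
  · rw [h0, pow_zero, mul_one]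
    have hpow : ∀ n : ℕ, (-Polynomial.X : Polynomial ℤ) ^ n ∈ degZG (n * (-2)) := by
      intro n
      induction n with
      | zero => simpa using one_mem_degZG
      | succ n ih =>
        rw [pow_succ]
        exact mem_deg_cast (mul_mem_degZG ih (neg_mem X_mem_degZG)) (by push_cast; ring)
    refine mem_deg_cast (hpow (d 0)) ?_
    rw [← hk, h0]
    simp
  · rw [zero_pow h0.ne', mul_zero]
    exact zero_mem _

theorem univToZG_mem {k : ℤ} {a : AUniv} (ha : a ∈ univ.degA k) : univToZG a ∈ degZG k :=
  baseHom_mem ha.1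

theorem smul_mem_deg_bracket (D : TangleDiagram) (i a b : ℤ) (s : Polynomial ℤ)
    (x : (bracket D).X i) (hs : s ∈ degZG a) (hx : x ∈ (bracket D).deg i b) :
    s • x ∈ (bracket D).deg i (a + b) := by
  have h := QComplex.smul_mem_deg_baseChange (zg.complex D) reduceHom isMulDeg_degZG i a
    (b - (-1)) s x hs hx
  rw [show a + (b - (-1)) = a + b - (-1) by ring] at h
  exact h

/-- `⟦D⟧` as a base change of the universal complex. -/
noncomputable def univIso (D : TangleDiagram) :
    (((univ.complex D).baseChange univToZG degZG).shift (-1)).Iso (bracket D) :=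
  (((bracketIso univ D).symm.baseChange univToZG degZG).shift (-1)).trans <|
  ((QComplex.Iso.baseChangeShift ((bracket D).baseChange univ.curtainHom univ.degA) univToZG degZG
    1).shift (-1)).trans <|
  (QComplex.Iso.shiftCancel _ (by norm_num)).trans <|
  (QComplex.Iso.baseChangeComp (bracket D) univ.curtainHom univToZG univ.isMulDeg_degA
    isMulDeg_degZG fun _ _ hs => univToZG_mem hs).trans <| by
    rw [univToZG_comp_curtainHom]
    exact QComplex.Iso.baseChangeId (bracket D) one_mem_degZG (smul_mem_deg_bracket D)

end Khovanov

theorem theorem1p3 (D : Khovanov.TangleDiagram) :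
    (∀ {R : Type*} {A : Type*} [CommRing R] [CommRing A] [Algebra R A]
      (F : Khovanov.FrobeniusSystem R A),
      Nonempty ((F.complex D).Iso
        (((Khovanov.bracket D).baseChange F.curtainHom F.degA).shift 1))) ∧
    (∀ a : Khovanov.AUniv, Khovanov.univ.curtain a =
      (2 * QuadraticAlgebra.omega -
        algebraMap Khovanov.RUniv Khovanov.AUniv Khovanov.hUniv) * a) ∧
    Nonempty ((Khovanov.bracket D).Iso
      (((Khovanov.univ.complex D).baseChange Khovanov.univToZG Khovanov.degZG).shift (-1))) := by
  refine ⟨fun F => ⟨(Khovanov.bracketIso F D).symm⟩, fun a => ?_, ⟨(Khovanov.univIso D).symm⟩⟩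
  rw [Khovanov.FrobeniusSystem.curtain_apply, Khovanov.univ_curtain_one]
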